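/- **Setting.** Let $(\xi_j)_{j\in\mathbb Z}$ be a stationary process on a probability space $(\Omega_0,\mathscr F,\mathbf P)$ with values in a measurable space $\mathcal Y$, let $\mathbb P$ be its law on $\Omega=\mathcal Y^{\mathbb Z}$ and $\sigma$ the left shift on $\Omega$. Let $(X,\mathcal B,m)$ be a probability space and let $v$ assign to functions $f:X\to\mathbb C$ a variation $v(f)\in[0,\infty]$ such that $v(cf)=|c|v(f)$ for $c\in\mathbb R$, $v(f+g)\le v(f)+v(g)$, $v(fg)\le\sup|f|\,v(g)+\sup|g|\,v(f)$, $\sup|f|\le C_0(v(f)+\|f\|_{L^1(m)})$ for a constant $C_0$, and constants have zero variation. Put $\|f\|_{BV}=\|f\|_{L^1(m)}+v(f)$. Let $T_y:X\to X$ ($y\in\mathcal Y$) be measurable maps that are nonsingular with respect to $m$, write $T_\omega=T_{\omega_0}$, and assume that $\tau(\omega,x)=(\sigma\omega,T_\omega x)$ is measurable on $\Omega\times X$. Let $\mathcal L_\omega$ be the transfer operator, $\int g\cdot(f\circ T_\omega)\,dm=\int(\mathcal L_\omega g)f\,dm$ for $g\in L^1(m)$, $f\in L^\infty(m)$, and $\mathcal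 L^n_\omega=\mathcal L_{\sigma^{n-1}\omega}\circ\cdots\circ\mathcal L_\omega$. Elements of $L^1(m)$ obtained from transfer operators are determined up to $m$-null sets; a bound on their BV norm means that some version satisfies it. **Standing assumption.** (1) There is a measurable $h\ge0$ on $\Omega\times X$ such that $d\mu=h\,dm\,d\mathbb P$ is a $\tau$-invariant probability measure and, for $\mathbb P$-a.e. $\omega$, with $h_\omega=h(\omega,\cdot)$: $\|h_\omega\|_{BV}<\infty$, $\int h_\omega\,dm=1$, $h_\omega>0$ and $\mathcal L_\omega h_\omega=h_{\sigma\omega}$ ($m$-a.e.). Write $\mu_\omega=h_\omega\,dm$. (2) There are $\lambda>0$ and a tempered random variable $K:\Omega\to[1,\infty)$ (that is, $\frac1n\ln K(\sigma^n\omega)\to0$ a.s.) such that for some $\varepsilon\in(0,\lambda/3)$ and $\mathbb P$-a.e. $\omega$, $K(\omega)e^{-\varepsilon|n|}\le K(\sigma^n\omega)\le K(\omega)e^{\varepsilon|n|}$ for all $n\in\mathbb Z$, and for $\mathbb P$-a.e. $\omega$, all $n\ge0$ and all $g:X\to\mathbb C$, $$\|\mathcal L^n_\omega\mathbf 1-h_{\sigma^n\omega}\|_{BV}\le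 K(\omega)e^{-\lambda n},\qquad v(g\circ T_\omega)\le K(\omega)v(g),\qquad \|L^n_\omega g-\mu_\omega(g)\mathbf 1\|_{BV}\le K(\omega)\|g\|_{BV}e^{-\lambda n},$$ where $L_\omega g=\mathcal L_\omega(gh_\omega)/h_{\sigma\omega}$ and $L^n_\omega=L_{\sigma^{n-1}\omega}\circ\cdots\circ L_\omega$. **Observable and mixing.** Let $\varphi:\Omega\times X\to\mathbb R$ be measurable, depending on $\omega$ only through $\omega_0$, with $\int\varphi\,d\mu=0$ and $\|\varphi\|_K:=\operatorname{ess\,sup}_{\omega}K(\omega)\|\varphi_\omega\|_{BV}<\infty$, where $\varphi_\omega=\varphi(\omega,\cdot)$. Let $S_n=\sum_{j=0}^{n-1}\varphi\circ\tau^j$ and $$\alpha_n=\sup_{k\in\mathbb Z}\sup\{|\mathbf P(A\cap B)-\mathbf P(A)\mathbf P(B)|:\ A\in\sigma(\xi_j,\,j\le k),\ B\in\sigma(\xi_j,\,j\ge k+n)\}.$$ **Theorem.** Suppose that $\sum_n n\alpha_n<\infty$. Then $S_n\in L^2(\mu)$ for every $n$, the limit $s=\lim_{n\to\infty}n^{-1/2}\|S_n\|_{L^2(\mu)}\in[0,\infty)$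 exists, and $s=0$ if and only if $\varphi=r\circ\tau-r$ $\mu$-a.e. for some $r\in L^2(\mu)$. If in addition there are constants $c_1,c_2,\eta>0$ with $\alpha_n\le c_1e^{-c_2n^\eta}$ for every $n$, then $n^{-1/2}S_n$ converges in distribution to $sZ$, where $Z$ is a standard normal random variable. Moreover, if $s>0$, there is a constant $C>0$ such that for all $n\ge1$ $$\sup_{t\in\mathbb R}\Big|\mu(S_n\le ts\sqrt n)-\Phi(t)\Big|\le C\,n^{-\frac1{2+4\gamma}},\qquad\gamma=\frac1\eta,$$ where $\Phi$ is the standard normal distribution function. The constant $C$ depends only on $c_1,c_2,\eta$, on $C_0$, $\lambda$, on an upper bound for $\|\varphi\|_K$ and on a positive lower bound for $s$. -/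

import Mathlib

open MeasureTheory ProbabilityTheory Filter Topology
open scoped ENNReal

namespace RandomMaps

noncomputable section

/-! ### The driving system -/

/-- The `n`-th power `σⁿ` of the left shift on two-sided sequences. -/
def shift {Y : Type*} (n : ℤ) (ω : ℤ → Y) : ℤ → Y := fun j => ω (j + n)

/-- The law on `ℤ → Y` of the two-sided process `ξ`. -/
def pathLaw {Ω₀ Y : Type*} [MeasurableSpace Ω₀] [MeasurableSpace Y]
    (P₀ : Measure Ω₀) (ξ : ℤ → Ω₀ → Y) : Measure (ℤ → Y) :=
  P₀.map (fun w j => ξ j w)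

/-- `ξ` is a (strictly) stationary two-sided process. -/
structure IsStationary {Ω₀ Y : Type*} [MeasurableSpace Ω₀] [MeasurableSpace Y]
    (P₀ : Measure Ω₀) (ξ : ℤ → Ω₀ → Y) : Prop where
  measurable : ∀ j, Measurable (ξ j)
  map_shift : (pathLaw P₀ ξ).map (shift 1) = pathLaw P₀ ξ

/-- The `α`-dependence coefficient of two sub-`σ`-algebras. -/
def alphaDep {Ω₀ : Type*} [MeasurableSpace Ω₀] (P₀ : Measure Ω₀)
    (𝒢 ℋ : MeasurableSpace Ω₀) : ℝ :=
  sSup {a : ℝ | ∃ A B : Set Ω₀, MeasurableSet[𝒢] A ∧ MeasurableSet[ℋ] B ∧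
    a = |P₀.real (A ∩ B) - P₀.real A * P₀.real B|}

/-- The `σ`-algebra generated by `ξ j`, `j ≤ k`. -/
abbrev pastAlgebra {Ω₀ Y : Type*} [MeasurableSpace Y] (ξ : ℤ → Ω₀ → Y) (k : ℤ) :
    MeasurableSpace Ω₀ :=
  ⨆ j : ℤ, ⨆ _ : j ≤ k, MeasurableSpace.comap (ξ j) inferInstance

/-- The `σ`-algebra generated by `ξ j`, `j ≥ k`. -/
abbrev futureAlgebra {Ω₀ Y : Type*} [MeasurableSpace Y] (ξ : ℤ → Ω₀ → Y) (k : ℤ) :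
    MeasurableSpace Ω₀ :=
  ⨆ j : ℤ, ⨆ _ : k ≤ j, MeasurableSpace.comap (ξ j) inferInstance

/-- The `n`-th `α`-mixing coefficient of the process `ξ`. -/
def alphaCoeff {Ω₀ Y : Type*} [MeasurableSpace Ω₀] [MeasurableSpace Y]
    (P₀ : Measure Ω₀) (ξ : ℤ → Ω₀ → Y) (n : ℕ) : ℝ :=
  ⨆ k : ℤ, alphaDep P₀ (pastAlgebra ξ k) (futureAlgebra ξ (k + n))

/-! ### Variation and the BV norm -/

/-- `v` is a notion of variation of functions `X → ℂ` with constant `C₀` (the value `∞` is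
allowed, for functions which are not of bounded variation). -/
structure IsVariation {X : Type*} [MeasurableSpace X] (m : Measure X)
    (v : (X → ℂ) → ℝ≥0∞) (C₀ : ℝ) : Prop where
  smul : ∀ (c : ℝ) (f : X → ℂ), AEStronglyMeasurable f m →
    v (fun x => (c : ℂ) * f x) = ‖c‖ₑ * v f
  add_le : ∀ f g : X → ℂ, AEStronglyMeasurable f m → AEStronglyMeasurable g m →
    v (fun x => f x + g x) ≤ v f + v g
  mul_le : ∀ f g : X → ℂ, AEStronglyMeasurable f m → AEStronglyMeasurable g m →
    v (fun x => f x * g x) ≤ (⨆ x, ‖f x‖ₑ) * v g + (⨆ x, ‖g x‖ₑ) * v f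
  sup_le : ∀ f : X → ℂ, AEStronglyMeasurable f m →
    (⨆ x, ‖f x‖ₑ) ≤ ENNReal.ofReal C₀ * (v f + ∫⁻ x, ‖f x‖ₑ ∂m)
  const : ∀ c : ℂ, v (fun _ => c) = 0

/-- `‖f‖_BV = ‖f‖_{L¹(m)} + v(f)`. -/
def bvNorm {X : Type*} [MeasurableSpace X] (m : Measure X) (v : (X → ℂ) → ℝ≥0∞)
    (f : X → ℂ) : ℝ≥0∞ :=
  ∫⁻ x, ‖f x‖ₑ ∂m + v f

/-! ### Transfer operators -/

/-- `u` is a version of the image of `g ∈ L¹(m)` under the transfer operator of `S`, i.e.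
`∫ g · (f ∘ S) dm = ∫ u · f dm` for all `f ∈ L^∞(m)`. -/
structure IsTransferImage {X : Type*} [MeasurableSpace X] (m : Measure X) (S : X → X)
    (g u : X → ℂ) : Prop where
  integrable_left : Integrable g m
  integrable_right : Integrable u m
  duality : ∀ f : X → ℂ, MemLp f ∞ m → ∫ x, g x * f (S x) ∂m = ∫ x, u x * f x ∂m

/-- For a nonsingular map every integrable function has an image under the transfer operator. -/
theorem exists_isTransferImage {X : Type*} [MeasurableSpace X] {m : Measure X} [SigmaFinite m]
    {S : X → X} (hS : Measure.QuasiMeasurePreserving S m m) {g : X → ℂ} (hg : Integrable g m) :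
    ∃ u, IsTransferImage m S g u := by
  have nonneg : ∀ k : X → ℝ, Integrable k m → (∀ x, 0 ≤ k x) →
      ∃ u : X → ℝ, Integrable u m ∧ ∀ f : X → ℂ, MemLp f ∞ m →
        ∫ x, (k x : ℂ) * f (S x) ∂m = ∫ x, (u x : ℂ) * f x ∂m := by
    intro k hk hk0
    set ρ := m.withDensity (fun x => ENNReal.ofReal (k x)) with hρ
    have hkf : ∀ᵐ x ∂m, ENNReal.ofReal (k x) < ∞ := by simp
    have : IsFiniteMeasure ρ := isFiniteMeasure_withDensity_ofReal hk.2
    have hρm : ρ ≪ m := withDensity_absolutelyContinuous _ _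
    have hac : ρ.map S ≪ m := (hρm.map hS.measurable).trans hS.absolutelyContinuous
    refine ⟨fun x => ((ρ.map S).rnDeriv m x).toReal, Measure.integrable_toReal_rnDeriv, ?_⟩
    intro f hf
    have h1 : ∫ x, f x ∂(ρ.map S) = ∫ x, f (S x) ∂ρ :=
      integral_map hS.measurable.aemeasurable (hf.1.mono_ac hac)
    have h2 : ∫ x, f (S x) ∂ρ = ∫ x, (k x : ℂ) * f (S x) ∂m := by
      rw [hρ, integral_withDensity_eq_integral_toReal_smul₀ hk.aemeasurable.ennreal_ofReal hkf]
      refine integral_congr_ae (Eventually.of_forall fun x => ?_)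
      simp [ENNReal.toReal_ofReal (hk0 x)]
    have h3 := integral_rnDeriv_smul (f := f) hac
    rw [← h2, ← h1, ← h3]
    simp
  have comp : ∀ f : X → ℂ, MemLp f ∞ m → MemLp (fun x => f (S x)) ∞ m := by
    intro f hf
    have hb : ∀ᵐ x ∂m, ‖f x‖ₑ ≤ eLpNormEssSup f m := ae_le_eLpNormEssSup
    refine ⟨hf.1.comp_quasiMeasurePreserving hS, ?_⟩
    rw [eLpNorm_exponent_top]
    refine lt_of_le_of_lt (essSup_le_of_ae_le _ (hS.ae hb)) ?_
    simpa using hf.2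
  have prod : ∀ (k : X → ℝ) (f : X → ℂ), Integrable k m → MemLp f ∞ m →
      Integrable (fun x => (k x : ℂ) * f x) m :=
    fun k f hk hf => hk.ofReal.mul_of_top_left hf
  have real : ∀ k : X → ℝ, Integrable k m →
      ∃ u : X → ℝ, Integrable u m ∧ ∀ f : X → ℂ, MemLp f ∞ m →
        ∫ x, (k x : ℂ) * f (S x) ∂m = ∫ x, (u x : ℂ) * f x ∂m := by
    intro k hk
    obtain ⟨u, hu, hu'⟩ := nonneg _ hk.pos_part (fun x => le_max_right _ _)
    obtain ⟨w, hw, hw'⟩ := nonneg _ hk.neg_part (fun x => le_max_right _ _)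
    refine ⟨fun x => u x - w x, hu.sub hw, fun f hf => ?_⟩
    have hfS := comp f hf
    calc ∫ x, (k x : ℂ) * f (S x) ∂m
        = ∫ x, ((max (k x) 0 : ℝ) : ℂ) * f (S x) - ((max (-k x) 0 : ℝ) : ℂ) * f (S x) ∂m := by
          refine integral_congr_ae (Eventually.of_forall fun x => ?_)
          have : k x = max (k x) 0 - max (-k x) 0 := (max_zero_sub_max_neg_zero_eq_self _).symm
          simp only
          rw [← sub_mul, ← Complex.ofReal_sub, ← this]
      _ = ∫ x, ((u x - w x : ℝ) : ℂ) * f x ∂m := by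
          rw [integral_sub (prod _ _ hk.pos_part hfS) (prod _ _ hk.neg_part hfS), hu' f hf, hw' f hf,
            ← integral_sub (prod _ _ hu hf) (prod _ _ hw hf)]
          simp [sub_mul]
  obtain ⟨u, hu, hu'⟩ := real _ hg.re
  obtain ⟨w, hw, hw'⟩ := real _ hg.im
  refine ⟨fun x => (u x : ℂ) + Complex.I * (w x : ℂ), hg,
    hu.ofReal.add (hw.ofReal.const_mul _), fun f hf => ?_⟩
  have hfS := comp f hf
  calc ∫ x, g x * f (S x) ∂m
      = ∫ x, ((RCLike.re (g x) : ℝ) : ℂ) * f (S x) +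
          Complex.I * (((RCLike.im (g x) : ℝ) : ℂ) * f (S x)) ∂m := by
        refine integral_congr_ae (Eventually.of_forall fun x => ?_)
        have : g x = ((g x).re : ℂ) + ((g x).im : ℂ) * Complex.I := (Complex.re_add_im _).symm
        simp only [RCLike.re_to_complex, RCLike.im_to_complex]
        conv_lhs => rw [this]
        ring
    _ = ∫ x, ((u x : ℂ) + Complex.I * (w x : ℂ)) * f x ∂m := by
        rw [integral_add (prod _ _ hg.re hfS) ((prod _ _ hg.im hfS).const_mul _), integral_const_mul, hu' f hf,
          hw' f hf, ← integral_const_mul, ← integral_add (prod _ _ hu hf)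
          ((prod _ _ hw hf).const_mul _)]
        simp [add_mul, mul_assoc]

open scoped Classical in
/-- A version of the transfer operator of `S` with respect to `m`. It is determined by the
duality relation up to `m`-null sets. -/
def transfer {X : Type*} [MeasurableSpace X] (m : Measure X) (S : X → X) (g : X → ℂ) : X → ℂ :=
  if h : ∃ u, IsTransferImage m S g u then h.choose else 0

/-- The defining duality relation of the transfer operator. -/
theorem isTransferImage_transfer {X : Type*} [MeasurableSpace X] {m : Measure X} [SigmaFinite m]
    {S : X → X} (hS : Measure.QuasiMeasurePreserving S m m) {g : X → ℂ} (hg : Integrable g m) :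
    IsTransferImage m S g (transfer m S g) := by
  have h := exists_isTransferImage hS hg
  rw [transfer, dif_pos h]
  exact h.choose_spec

/-- `ℒ_ω^n = ℒ_{ω_{n-1}} ∘ ⋯ ∘ ℒ_{ω_0}`. -/
def transferIter {X Y : Type*} [MeasurableSpace X] (m : Measure X) (T : Y → X → X)
    (ω : ℤ → Y) : ℕ → (X → ℂ) → (X → ℂ)
  | 0, g => g
  | n + 1, g => transfer m (T (ω n)) (transferIter m T ω n g)

/-- The normalized operator `L_ω g = ℒ_ω (g h_ω) / h_{σω}`. -/
def normTransfer {X Y : Type*} [MeasurableSpace X] (m : Measure X) (T : Y → X → X)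
    (h : (ℤ → Y) × X → ℝ) (ω : ℤ → Y) (g : X → ℂ) : X → ℂ :=
  fun x => transfer m (T (ω 0)) (fun z => g z * (h (ω, z) : ℂ)) x / (h (shift 1 ω, x) : ℂ)

/-- `L_ω^n = L_{σ^{n-1}ω} ∘ ⋯ ∘ L_{σω} ∘ L_ω`. -/
def normTransferIter {X Y : Type*} [MeasurableSpace X] (m : Measure X) (T : Y → X → X)
    (h : (ℤ → Y) × X → ℝ) (ω : ℤ → Y) : ℕ → (X → ℂ) → (X → ℂ)
  | 0, g => g
  | n + 1, g => normTransfer m T h (shift n ω) (normTransferIter m T h ω n g)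

/-! ### The skew product and the standing assumption -/

/-- The skew product `τ(ω, x) = (σω, T_{ω₀} x)`. -/
def skew {X Y : Type*} (T : Y → X → X) (p : (ℤ → Y) × X) : (ℤ → Y) × X :=
  (shift 1 p.1, T (p.1 0) p.2)

/-- The measure `dμ = h dm dℙ` on `Ω × X`. -/
def skewMeasure {X Y : Type*} [MeasurableSpace X] [MeasurableSpace Y] (P : Measure (ℤ → Y))
    (m : Measure X) (h : (ℤ → Y) × X → ℝ) : Measure ((ℤ → Y) × X) :=
  (P.prod m).withDensity (fun p => ENNReal.ofReal (h p))

/-- The random variable `K` is tempered. -/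
def IsTempered {Y : Type*} [MeasurableSpace Y] (P : Measure (ℤ → Y)) (K : (ℤ → Y) → ℝ) : Prop :=
  ∀ᵐ ω ∂P, Tendsto (fun n : ℕ => (n : ℝ)⁻¹ * Real.log (K (shift n ω))) atTop (𝓝 0)

/-- The standing assumption on the random maps: an equivariant family of densities, and
exponential convergence of the iterates of the random transfer operators in the BV norm.
Functions in the range of the transfer operators are only determined up to `m`-null sets; a bound
on their BV norm means that some version satisfies it. -/
structure IsExpandingOnAverage {X Y : Type*} [MeasurableSpace X] [MeasurableSpace Y]
    (P : Measure (ℤ → Y)) (m : Measure X) (v : (X → ℂ) → ℝ≥0∞) (T : Y → X → X)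
    (h : (ℤ → Y) × X → ℝ) (K : (ℤ → Y) → ℝ) (lam : ℝ) : Prop where
  measurable_h : Measurable h
  h_nonneg : ∀ p, 0 ≤ h p
  invariant : MeasurePreserving (skew T) (skewMeasure P m h) (skewMeasure P m h)
  isProbability : IsProbabilityMeasure (skewMeasure P m h)
  bv_h : ∀ᵐ ω ∂P, bvNorm m v (fun x => (h (ω, x) : ℂ)) < ∞
  integral_h : ∀ᵐ ω ∂P, ∫ x, h (ω, x) ∂m = 1
  h_pos : ∀ᵐ ω ∂P, ∀ᵐ x ∂m, 0 < h (ω, x)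
  equivariant : ∀ᵐ ω ∂P, transfer m (T (ω 0)) (fun x => (h (ω, x) : ℂ))
    =ᵐ[m] fun x => (h (shift 1 ω, x) : ℂ)
  measurable_K : Measurable K
  one_le_K : ∀ ω, 1 ≤ K ω
  tempered : IsTempered P K
  /-- `K` varies slowly along orbits, at an exponential rate less than `lam / 3`. -/
  slowly_varying : ∃ ε : ℝ, 0 < ε ∧ ε < lam / 3 ∧ ∀ᵐ ω ∂P, ∀ n : ℤ,
    K ω * Real.exp (-ε * |(n : ℝ)|) ≤ K (shift n ω) ∧
      K (shift n ω) ≤ K ω * Real.exp (ε * |(n : ℝ)|)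
  lam_pos : 0 < lam
  exp_transfer : ∀ᵐ ω ∂P, ∀ n : ℕ, ∃ u : X → ℂ, u =ᵐ[m] transferIter m T ω n (fun _ => 1) ∧
    bvNorm m v (fun x => u x - (h (shift n ω, x) : ℂ)) ≤
      ENNReal.ofReal (K ω * Real.exp (-lam * n))
  variation_comp : ∀ᵐ ω ∂P, ∀ g : X → ℂ, AEStronglyMeasurable g m →
    v (fun x => g (T (ω 0) x)) ≤ v g * ENNReal.ofReal (K ω)
  exp_normTransfer : ∀ᵐ ω ∂P, ∀ n : ℕ, ∀ g : X → ℂ, AEStronglyMeasurable g m →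
    bvNorm m v g < ∞ →
    ∃ u : X → ℂ, u =ᵐ[m] normTransferIter m T h ω n g ∧
      bvNorm m v (fun x => u x - ∫ z, g z * (h (ω, z) : ℂ) ∂m) ≤
        ENNReal.ofReal (K ω) * bvNorm m v g * ENNReal.ofReal (Real.exp (-lam * n))

/-! ### Observables -/

/-- The observable `(ω, x) ↦ φ_{ω₀}(x)` on `Ω × X`. -/
def observable {X Y : Type*} (φ : Y → X → ℝ) (p : (ℤ → Y) × X) : ℝ := φ (p.1 0) p.2

/-- `‖φ‖_K = esssup_ω K(ω) ‖φ_ω‖_BV`. -/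
def scaledNorm {X Y : Type*} [MeasurableSpace X] [MeasurableSpace Y] (P : Measure (ℤ → Y))
    (m : Measure X) (v : (X → ℂ) → ℝ≥0∞) (K : (ℤ → Y) → ℝ) (φ : Y → X → ℝ) : ℝ≥0∞ :=
  essSup (fun ω => ENNReal.ofReal (K ω) * bvNorm m v (fun x => (φ (ω 0) x : ℂ))) P

/-- `S_n = ∑_{j<n} φ ∘ τ^j`. -/
def partialSum {X Y : Type*} (T : Y → X → X) (φ : Y → X → ℝ) (n : ℕ) : (ℤ → Y) × X → ℝ :=
  birkhoffSum (skew T) (observable φ) n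

end

end RandomMaps

-- The proof separates dynamics from probability. All that the limit theorems need is a
-- decorrelation estimate: `e^{itS_N}` is nearly independent of a function of the orbit after time
-- `N + k`, with an error that is small in `k`, uniform in `N` and of order `t`.
--
-- This estimate has two sources. On a fibre, duality turns a correlation into an integral against
-- `L_ω^n g - μ_ω(g)`, which is exponentially small in BV. A naive bound for the BV norm of
-- `e^{itS_N}` deteriorates with `N`; instead the product of the factors `e^{itφ∘τ^j}` is
-- telescoped, each new factor contributes an error of size `|t| K β ≤ |t| M`, and the later maps
-- contract that error geometrically (`IsGoodPoint.exists_push_prod`). On the base, the fibrewise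
-- expectations are functions of `ω` which α-mixing does not control directly, because `μ_ω` depends
-- on the infinite past. Replacing `μ_ω` by the image of `m` under the last `l` maps makes the
-- dependence finite, at cost `K(σ^{-l}ω) e^{-λl}`. Since `K` varies slowly and the observable is
-- small where `K` is large, the cost is uniform in `ω` (`norm_integral_fibreExp_mul_sub_le`). With
-- a gap `k` split into about `k/4` for mixing and `3k/4` for approximation, the two sources
-- together give the rate `k (e^{-λk/6} + α_{k/4})`.
--
-- The probabilistic half works for any bounded centred observable. Summability of `j` times the
-- correlation at lag `j` gives the variance `s²` as a series and `E S_n² ≤ n s² + D`. If `s = 0`,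
-- the sums are bounded in `L²`, and a fixed point of the affine isometry `r ↦ r∘τ - φ` yields the
-- coboundary. If `s > 0`, one expands `e^{itS_{N+1}} - e^{itS_N}` backwards in blocks of length
-- `k`: each block either decouples by decorrelation or contributes another factor of size `|t| k
-- B`. Hence the characteristic functions satisfy a linear recurrence with delays, whose
-- coefficients sum to about `-s²t²/2`. Its solutions stay close to `e^{-N s²t²/2}`
-- (`norm_sub_pow_le_of_delayed_recurrence`), and a Gaussian smoothing inequality passes to
-- distribution functions.
--
-- Stretched exponential mixing beats every power, so `k = n^{1/p}` is allowed with `p` arbitrarily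
-- large. The outcome is the rate `n^{δ - 1/2}` for every `δ > 0`, which covers the stated exponent.
-- Every constant is chosen from the numerical data alone, before the system is introduced.

universe u

/-! ### Covariance inequalities for α-dependent σ-algebras. -/

namespace RandomMaps

section Covariance

variable {Ω : Type*} [mΩ : MeasurableSpace Ω]

/-- Layer cake: the integral of a `[0, 1]`-valued function is the integral over `t ∈ (0, 1]` of the
measures of its superlevel sets. The two measures need not have the same mass. -/
theorem abs_integral_sub_integral_le_of_forall_level {ν₁ ν₂ : Measure Ω} [IsFiniteMeasure ν₁]
    [IsFiniteMeasure ν₂] {g : Ω → ℝ} (hg : Measurable g) (h0 : ∀ x, 0 ≤ g x) (h1 : ∀ x, g x ≤ 1)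
    {c : ℝ} (h : ∀ t, |ν₁.real {x | t ≤ g x} - ν₂.real {x | t ≤ g x}| ≤ c) :
    |∫ x, g x ∂ν₁ - ∫ x, g x ∂ν₂| ≤ c := by
  have hi : ∀ ν : Measure Ω, IsFiniteMeasure ν → Integrable g ν := fun ν _ =>
    Integrable.of_bound hg.aestronglyMeasurable 1
      (Eventually.of_forall fun x => by rw [Real.norm_eq_abs, abs_of_nonneg (h0 x)]; exact h1 x)
  have key : ∀ ν : Measure Ω, IsFiniteMeasure ν →
      ∫ x, g x ∂ν = ∫ t in Set.Ioc (0 : ℝ) 1, ν.real {x | t ≤ g x} := fun ν hν =>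
    (hi ν hν).integral_eq_integral_Ioc_meas_le (Eventually.of_forall h0) (Eventually.of_forall h1)
  have hanti : ∀ ν : Measure Ω, IsFiniteMeasure ν →
      IntegrableOn (fun t : ℝ => ν.real {x | t ≤ g x}) (Set.Ioc 0 1) := by
    intro ν hν
    have : Antitone (fun t : ℝ => ν.real {x | t ≤ g x}) := fun s t hst =>
      measureReal_mono (fun x (hx : t ≤ g x) => hst.trans hx)
    exact (this.antitoneOn _).integrableOn_isCompact isCompact_Icc |>.mono_set
      Set.Ioc_subset_Icc_self
  rw [key ν₁ inferInstance, key ν₂ inferInstance,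
    ← integral_sub (hanti ν₁ inferInstance) (hanti ν₂ inferInstance), ← Real.norm_eq_abs]
  refine (norm_setIntegral_le_of_norm_le_const (C := c) (by simp) fun t _ => h t).trans ?_
  simp

end Covariance

section Covariance

variable {Ω : Type*} {𝒢 ℋ : MeasurableSpace Ω} [mΩ : MeasurableSpace Ω]

/-- The covariance inequality for `[0, 1]`-valued functions. -/
theorem abs_cov_le_of_unit_interval {P : Measure Ω} [IsProbabilityMeasure P]
    (h𝒢 : 𝒢 ≤ mΩ) (hℋ : ℋ ≤ mΩ) {a : ℝ}
    (ha : ∀ A B, MeasurableSet[𝒢] A → MeasurableSet[ℋ] B →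
      |P.real (A ∩ B) - P.real A * P.real B| ≤ a)
    {f g : Ω → ℝ} (hf : Measurable[𝒢] f) (hg : Measurable[ℋ] g) (hf0 : ∀ x, 0 ≤ f x)
    (hf1 : ∀ x, f x ≤ 1) (hg0 : ∀ x, 0 ≤ g x) (hg1 : ∀ x, g x ≤ 1) :
    |∫ x, f x * g x ∂P - (∫ x, f x ∂P) * ∫ x, g x ∂P| ≤ a := by
  have hfm : Measurable f := hf.mono h𝒢 le_rfl
  have hgm : Measurable g := hg.mono hℋ le_rfl
  have hfi : Integrable f P := Integrable.of_bound hfm.aestronglyMeasurable 1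
      (Eventually.of_forall fun x => by rw [Real.norm_eq_abs, abs_of_nonneg (hf0 x)]; exact hf1 x)
  -- One variable at a time: with `B` fixed, the layer cake in `f` compares `P` restricted to `B`
  -- with `P(B) P`. The layer cake in `g` then compares `f dP` with `(∫ f) P`, so no constant is
  -- lost.
  have step : ∀ B, MeasurableSet[ℋ] B →
      |∫ x in B, f x ∂P - P.real B * ∫ x, f x ∂P| ≤ a := by
    intro B hB
    have hBm := hℋ _ hB
    have hPB : IsFiniteMeasure (P B • P) := ⟨by simp⟩
    have := abs_integral_sub_integral_le_of_forall_level (ν₁ := P.restrict B)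
      (ν₂ := P B • P) hfm hf0 hf1 (c := a) (fun t => by
        have hA : MeasurableSet[𝒢] {x | t ≤ f x} := hf measurableSet_Ici
        have h1 := ha _ _ hA hB
        rw [measureReal_restrict_apply (h𝒢 _ hA)]
        simpa [measureReal_def, mul_comm] using h1)
    simpa [integral_smul_measure, measureReal_def] using this
  have hwd : IsFiniteMeasure (P.withDensity fun x => ENNReal.ofReal (f x)) :=
    isFiniteMeasure_withDensity_ofReal hfi.2
  have hint : ∀ u : Ω → ℝ, ∫ x, u x ∂(P.withDensity fun x => ENNReal.ofReal (f x))
      = ∫ x, f x * u x ∂P := by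
    intro u
    rw [integral_withDensity_eq_integral_toReal_smul hfm.ennreal_ofReal (by simp)]
    simp [ENNReal.toReal_ofReal (hf0 _)]
  have hfin : IsFiniteMeasure (ENNReal.ofReal (∫ x, f x ∂P) • P) :=
    ⟨by simp⟩
  have hfnn : 0 ≤ ∫ x, f x ∂P := integral_nonneg hf0
  have := abs_integral_sub_integral_le_of_forall_level
    (ν₁ := P.withDensity fun x => ENNReal.ofReal (f x))
      (ν₂ := ENNReal.ofReal (∫ x, f x ∂P) • P) hgm hg0 hg1 (c := a) (fun t => by
        have hB : MeasurableSet[ℋ] {x | t ≤ g x} := hg measurableSet_Ici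
        have h1 := step _ hB
        have h2 : (P.withDensity fun x => ENNReal.ofReal (f x)).real {x | t ≤ g x} =
            ∫ x in {x | t ≤ g x}, f x ∂P := by
          rw [measureReal_def, withDensity_apply _ (hℋ _ hB),
            integral_eq_lintegral_of_nonneg_ae (Eventually.of_forall hf0)
              hfm.aestronglyMeasurable.restrict]
        rw [h2]
        simpa [measureReal_def, mul_comm, ENNReal.toReal_ofReal hfnn] using h1)
  rw [hint, integral_smul_measure, ENNReal.toReal_ofReal hfnn] at this
  simpa using this

/-- Covariance ignores additive constants, so the affine maps onto `[0, 1]` reduce to the previous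
case; the factor `4pq` undoes the scaling by `2p` and `2q`. -/
theorem abs_cov_le_of_bounded {P : Measure Ω} [IsProbabilityMeasure P]
    (h𝒢 : 𝒢 ≤ mΩ) (hℋ : ℋ ≤ mΩ) {a : ℝ}
    (ha : ∀ A B, MeasurableSet[𝒢] A → MeasurableSet[ℋ] B →
      |P.real (A ∩ B) - P.real A * P.real B| ≤ a)
    {f g : Ω → ℝ} (hf : Measurable[𝒢] f) (hg : Measurable[ℋ] g) {p q : ℝ} (hp : 0 < p)
    (hq : 0 < q) (hfp : ∀ x, |f x| ≤ p) (hgq : ∀ x, |g x| ≤ q) :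
    |∫ x, f x * g x ∂P - (∫ x, f x ∂P) * ∫ x, g x ∂P| ≤ 4 * p * q * a := by
  have hfm : Measurable f := hf.mono h𝒢 le_rfl
  have hgm : Measurable g := hg.mono hℋ le_rfl
  have hfi : Integrable f P := Integrable.of_bound hfm.aestronglyMeasurable p
      (Eventually.of_forall hfp)
  have hgi : Integrable g P := Integrable.of_bound hgm.aestronglyMeasurable q
      (Eventually.of_forall hgq)
  have hfgi : Integrable (fun x => f x * g x) P :=
    hfi.mul_bdd hgm.aestronglyMeasurable (Eventually.of_forall hgq)
  have key := abs_cov_le_of_unit_interval (P := P) h𝒢 hℋ ha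
    (f := fun x => (f x + p) / (2 * p)) (g := fun x => (g x + q) / (2 * q))
    ((hf.add_const p).div_const _) ((hg.add_const q).div_const _)
    (fun x => div_nonneg (by linarith [neg_le_of_abs_le (hfp x)]) (by positivity))
    (fun x => by rw [div_le_one (by positivity)]; linarith [le_of_abs_le (hfp x)])
    (fun x => div_nonneg (by linarith [neg_le_of_abs_le (hgq x)]) (by positivity))
    (fun x => by rw [div_le_one (by positivity)]; linarith [le_of_abs_le (hgq x)])
  have e1 : ∫ x, (f x + p) / (2 * p) ∂P = (∫ x, f x ∂P + p) / (2 * p) := by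
    rw [integral_div, integral_add hfi (by simp)]; simp
  have e2 : ∫ x, (g x + q) / (2 * q) ∂P = (∫ x, g x ∂P + q) / (2 * q) := by
    rw [integral_div, integral_add hgi (by simp)]; simp
  have e3 : ∫ x, (f x + p) / (2 * p) * ((g x + q) / (2 * q)) ∂P
      = (∫ x, f x * g x ∂P + q * ∫ x, f x ∂P + p * ∫ x, g x ∂P + p * q) / (4 * p * q) := by
    have : ∀ x, (f x + p) / (2 * p) * ((g x + q) / (2 * q))
        = (f x * g x + q * f x + p * g x + p * q) / (4 * p * q) := fun x => by
      field_simp; ring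
    simp_rw [this]
    have i1 : Integrable (fun x => f x * g x + q * f x) P := hfgi.add (hfi.const_mul q)
    have i2 : Integrable (fun x => f x * g x + q * f x + p * g x) P := i1.add (hgi.const_mul p)
    rw [integral_div, integral_add i2 (integrable_const _), integral_add i1 (hgi.const_mul p),
      integral_add hfgi (hfi.const_mul q), integral_const_mul, integral_const_mul]
    simp
  rw [e1, e2, e3] at key
  have e4 : (∫ x, f x * g x ∂P + q * ∫ x, f x ∂P + p * ∫ x, g x ∂P + p * q) / (4 * p * q)
      - (∫ x, f x ∂P + p) / (2 * p) * ((∫ x, g x ∂P + q) / (2 * q))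
      = (∫ x, f x * g x ∂P - (∫ x, f x ∂P) * ∫ x, g x ∂P) / (4 * p * q) := by
    field_simp; ring
  rw [e4, abs_div, abs_of_pos (by positivity : 0 < 4 * p * q), div_le_iff₀ (by positivity)] at key
  linarith

/-- The covariance inequality for bounded complex functions. -/
theorem norm_cov_le_of_bounded {P : Measure Ω} [IsProbabilityMeasure P]
    (h𝒢 : 𝒢 ≤ mΩ) (hℋ : ℋ ≤ mΩ) {a : ℝ}
    (ha : ∀ A B, MeasurableSet[𝒢] A → MeasurableSet[ℋ] B →
      |P.real (A ∩ B) - P.real A * P.real B| ≤ a)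
    {f g : Ω → ℂ} (hf : Measurable[𝒢] f) (hg : Measurable[ℋ] g) {p q : ℝ} (hp : 0 < p)
    (hq : 0 < q) (hfp : ∀ x, ‖f x‖ ≤ p) (hgq : ∀ x, ‖g x‖ ≤ q) :
    ‖∫ x, f x * g x ∂P - (∫ x, f x ∂P) * ∫ x, g x ∂P‖ ≤ 16 * p * q * a := by
  have hfm : Measurable f := hf.mono h𝒢 le_rfl
  have hgm : Measurable g := hg.mono hℋ le_rfl
  have hfi : Integrable f P := Integrable.of_bound hfm.aestronglyMeasurable p
      (Eventually.of_forall hfp)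
  have hgi : Integrable g P := Integrable.of_bound hgm.aestronglyMeasurable q
      (Eventually.of_forall hgq)
  have hfgi : Integrable (fun x => f x * g x) P :=
    hfi.mul_bdd hgm.aestronglyMeasurable (Eventually.of_forall hgq)
  have fr := Complex.measurable_re.comp hf
  have fi := Complex.measurable_im.comp hf
  have gr := Complex.measurable_re.comp hg
  have gi := Complex.measurable_im.comp hg
  have bfr : ∀ x, |(f x).re| ≤ p := fun x => (Complex.abs_re_le_norm _).trans (hfp x)
  have bfi : ∀ x, |(f x).im| ≤ p := fun x => (Complex.abs_im_le_norm _).trans (hfp x)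
  have bgr : ∀ x, |(g x).re| ≤ q := fun x => (Complex.abs_re_le_norm _).trans (hgq x)
  have bgi : ∀ x, |(g x).im| ≤ q := fun x => (Complex.abs_im_le_norm _).trans (hgq x)
  -- Four real covariances at `4pqa` each; the real and the imaginary part use two of them each,
  -- whence 16.
  have k1 := abs_cov_le_of_bounded h𝒢 hℋ ha fr gr hp hq bfr bgr
  have k2 := abs_cov_le_of_bounded h𝒢 hℋ ha fr gi hp hq bfr bgi
  have k3 := abs_cov_le_of_bounded h𝒢 hℋ ha fi gr hp hq bfi bgr
  have k4 := abs_cov_le_of_bounded h𝒢 hℋ ha fi gi hp hq bfi bgi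
  have ire : ∀ u : Ω → ℂ, Integrable u P → (∫ x, u x ∂P).re = ∫ x, (u x).re ∂P :=
    fun u hu => (integral_re hu).symm
  have iim : ∀ u : Ω → ℂ, Integrable u P → (∫ x, u x ∂P).im = ∫ x, (u x).im ∂P :=
    fun u hu => (integral_im hu).symm
  have jm : ∀ u w : Ω → ℝ, Measurable u → Measurable w → (∀ x, |u x| ≤ p) → (∀ x, |w x| ≤ q) →
      Integrable (fun x => u x * w x) P := fun u w hu hw bu bw =>
    (Integrable.of_bound hu.aestronglyMeasurable p (Eventually.of_forall bu)).mul_bdd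
      hw.aestronglyMeasurable (Eventually.of_forall bw)
  have fr' := Complex.measurable_re.comp hfm
  have fi' := Complex.measurable_im.comp hfm
  have gr' := Complex.measurable_re.comp hgm
  have gi' := Complex.measurable_im.comp hgm
  have j1 := jm _ _ fr' gr' bfr bgr
  have j2 := jm _ _ fr' gi' bfr bgi
  have j3 := jm _ _ fi' gr' bfi bgr
  have j4 := jm _ _ fi' gi' bfi bgi
  simp only [Function.comp_apply] at k1 k2 k3 k4 j1 j2 j3 j4
  refine (Complex.norm_le_abs_re_add_abs_im _).trans ?_
  rw [Complex.sub_re, Complex.sub_im, Complex.mul_re, Complex.mul_im, ire _ hfgi, iim _ hfgi,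
    ire _ hfi, iim _ hfi, ire _ hgi, iim _ hgi]
  simp only [Complex.mul_re, Complex.mul_im]
  rw [integral_sub j1 j4, integral_add j2 j3]
  rw [abs_le] at k1 k2 k3 k4
  have := abs_le.2 (show -(8 * p * q * a) ≤ ∫ x, (f x).re * (g x).re ∂P
      - ∫ x, (f x).im * (g x).im ∂P - ((∫ x, (f x).re ∂P) * (∫ x, (g x).re ∂P)
        - (∫ x, (f x).im ∂P) * ∫ x, (g x).im ∂P) ∧ _ ≤ 8 * p * q * a from
        ⟨by linarith [k1.1, k4.2], by linarith [k1.2, k4.1]⟩)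
  have := abs_le.2 (show -(8 * p * q * a) ≤ ∫ x, (f x).re * (g x).im ∂P
      + ∫ x, (f x).im * (g x).re ∂P - ((∫ x, (f x).re ∂P) * (∫ x, (g x).im ∂P)
        + (∫ x, (f x).im ∂P) * ∫ x, (g x).re ∂P) ∧ _ ≤ 8 * p * q * a from
        ⟨by linarith [k2.1, k3.1], by linarith [k2.2, k3.2]⟩)
  linarith

end Covariance

end RandomMaps

/-! ### A smoothing inequality with a Gaussian kernel. -/

namespace RandomMaps

section Smoothing

theorem gaussianPDFReal_le_one (x : ℝ) : gaussianPDFReal 0 1 x ≤ 1 := by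
  rw [gaussianPDFReal_def]
  have h1 : 1 ≤ √(2 * Real.pi * (1 : NNReal)) := by
    rw [Real.one_le_sqrt]; push_cast; nlinarith [Real.pi_gt_three]
  have h2 : Real.exp (-(x - 0) ^ 2 / (2 * (1 : NNReal))) ≤ 1 :=
    Real.exp_le_one_iff.2 (by push_cast; nlinarith [sq_nonneg x])
  calc _ ≤ 1 * 1 := mul_le_mul (inv_le_one_of_one_le₀ h1) h2 (Real.exp_pos _).le zero_le_one
    _ = 1 := one_mul 1

theorem integral_gaussianReal_le_integral {w : ℝ → ℝ} (hw : ∀ x, 0 ≤ w x) (hi : Integrable w) :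
    ∫ x, w x ∂gaussianReal 0 1 ≤ ∫ x, w x := by
  rw [integral_gaussianReal_eq_integral_smul one_ne_zero]
  refine integral_mono_of_nonneg (Eventually.of_forall fun x => ?_) hi
    (Eventually.of_forall fun x => ?_)
  · exact smul_nonneg (gaussianPDFReal_nonneg _ _ _) (hw x)
  · simpa using mul_le_mul_of_nonneg_right (gaussianPDFReal_le_one x) (hw x)

/-- The standard normal distribution function, as a function of the endpoint. -/
noncomputable def normalCDF (x : ℝ) : ℝ := (gaussianReal 0 1).real (Set.Iic x)

theorem normalCDF_nonneg (x : ℝ) : 0 ≤ normalCDF x := measureReal_nonneg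

theorem normalCDF_le_one (x : ℝ) : normalCDF x ≤ 1 := measureReal_le_one

theorem normalCDF_mono : Monotone normalCDF := fun _ _ h =>
  measureReal_mono (Set.Iic_subset_Iic.2 h)

theorem normalCDF_sub {x y : ℝ} (h : x ≤ y) :
    normalCDF y - normalCDF x = ∫ z in x..y, gaussianPDFReal 0 1 z := by
  have h1 : normalCDF y = normalCDF x + (gaussianReal 0 1).real (Set.Ioc x y) := by
    rw [normalCDF, normalCDF, ← measureReal_union (Set.Iic_disjoint_Ioc le_rfl) measurableSet_Ioc,
      Set.Iic_union_Ioc_eq_Iic h]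
  have h2 : (gaussianReal 0 1).real (Set.Ioc x y) = ∫ z in Set.Ioc x y, gaussianPDFReal 0 1 z := by
    rw [measureReal_def, gaussianReal_apply_eq_integral _ one_ne_zero, ENNReal.toReal_ofReal]
    exact integral_nonneg fun _ => gaussianPDFReal_nonneg _ _ _
  rw [h1, h2, intervalIntegral.integral_of_le h]; ring

theorem normalCDF_sub_le {x y : ℝ} (h : x ≤ y) : normalCDF y - normalCDF x ≤ y - x := by
  rw [normalCDF_sub h]
  calc ∫ z in x..y, gaussianPDFReal 0 1 z ≤ ∫ _ in x..y, (1 : ℝ) :=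
        intervalIntegral.integral_mono_on h (integrable_gaussianPDFReal _ _).intervalIntegrable
          intervalIntegrable_const fun z _ => gaussianPDFReal_le_one z
    _ = y - x := by simp

theorem gaussianReal_Ici_le {a : ℝ} (ha : 0 ≤ a) :
    (gaussianReal 0 1).real (Set.Ici a) ≤ Real.exp (-a ^ 2 / 2) := by
  have h := measure_ge_le_exp_mul_mgf (μ := gaussianReal 0 1) (X := id) (t := a) a ha
    (integrable_exp_mul_gaussianReal a)
  rw [mgf_id_gaussianReal, ← Real.exp_add] at h
  refine h.trans (Real.exp_le_exp.2 (le_of_eq ?_))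
  simp; ring

theorem gaussianReal_Iic_neg_le {a : ℝ} (ha : 0 ≤ a) :
    (gaussianReal 0 1).real (Set.Iic (-a)) ≤ Real.exp (-a ^ 2 / 2) := by
  have h := measure_le_le_exp_mul_mgf (μ := gaussianReal 0 1) (X := id) (t := -a) (-a)
    (by linarith) (integrable_exp_mul_gaussianReal (-a))
  rw [mgf_id_gaussianReal, ← Real.exp_add] at h
  refine h.trans (Real.exp_le_exp.2 (le_of_eq ?_))
  simp; ring

theorem one_sub_normalCDF_le {a : ℝ} (ha : 0 ≤ a) : 1 - normalCDF a ≤ Real.exp (-a ^ 2 / 2) := by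
  have : 1 - normalCDF a = (gaussianReal 0 1).real (Set.Ioi a) := by
    rw [normalCDF, ← Set.compl_Iic, probReal_compl_eq_one_sub measurableSet_Iic]
  rw [this]
  exact (measureReal_mono Set.Ioi_subset_Ici_self).trans (gaussianReal_Ici_le ha)

/-- The Gaussian is its own Fourier transform up to normalization. The frequency variable is thus
integrated against a probability measure, and every use of Fubini below is over finite measures. -/
theorem gaussianPDFReal_eq_integral_cos (y : ℝ) :
    gaussianPDFReal 0 1 y = (√(2 * Real.pi))⁻¹ * ∫ t, Real.cos (t * y) ∂gaussianReal 0 1 := by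
  have h := charFun_gaussianReal (μ := 0) (v := 1) y
  rw [charFun_apply_real] at h
  have h2 := congrArg Complex.re h
  have hint : Integrable (fun x : ℝ => Complex.exp (y * x * Complex.I)) (gaussianReal 0 1) := by
    refine Integrable.of_bound (by fun_prop) 1 (Eventually.of_forall fun x => ?_)
    rw [← Complex.ofReal_mul, Complex.norm_exp_ofReal_mul_I]
  have h3 := integral_re hint
  simp only [RCLike.re_to_complex] at h3
  rw [← h3] at h2
  have e1 : ∀ x : ℝ, (Complex.exp (y * x * Complex.I)).re = Real.cos (x * y) := fun x => by
    rw [← Complex.ofReal_mul, Complex.exp_ofReal_mul_I_re, mul_comm]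
  simp_rw [e1] at h2
  rw [h2, gaussianPDFReal_def]
  have e2 : Complex.exp (y * (0 : ℝ) * Complex.I - (1 : NNReal) * y ^ 2 / 2)
      = ((Real.exp (-y ^ 2 / 2) : ℝ) : ℂ) := by
    push_cast; congr 1; ring
  rw [e2, Complex.ofReal_re]
  simp

/-- The Fourier representation of the normal distribution function. -/
theorem normalCDF_eq_integral_sinc (z : ℝ) :
    normalCDF z = normalCDF 0 +
      (√(2 * Real.pi))⁻¹ * ∫ t, z * Real.sinc (t * z) ∂gaussianReal 0 1 := by
  have key : normalCDF z - normalCDF 0 = ∫ y in (0 : ℝ)..z, gaussianPDFReal 0 1 y := by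
    rcases le_total 0 z with h | h
    · exact normalCDF_sub h
    · rw [intervalIntegral.integral_symm, ← normalCDF_sub h]; ring
  have h2 : ∫ y in (0 : ℝ)..z, ∫ t, Real.cos (t * y) ∂gaussianReal 0 1
      = ∫ t, (∫ y in (0 : ℝ)..z, Real.cos (t * y)) ∂gaussianReal 0 1 := by
    have : IsFiniteMeasure (volume.restrict (Set.uIoc 0 z)) := ⟨by simp [Set.uIoc]⟩
    refine intervalIntegral_integral_swap ?_
    refine Integrable.of_bound (by fun_prop) 1 (Eventually.of_forall fun x => ?_)
    exact Real.abs_cos_le_one _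
  have h3 : ∀ t : ℝ, ∫ y in (0 : ℝ)..z, Real.cos (t * y) = z * Real.sinc (t * z) := by
    intro t
    rcases eq_or_ne t 0 with rfl | ht
    · simp
    rcases eq_or_ne z 0 with rfl | hz
    · simp
    rw [intervalIntegral.integral_comp_mul_left (fun y => Real.cos y) ht, integral_cos,
      Real.sinc_of_ne_zero (mul_ne_zero ht hz)]
    simp only [mul_zero, Real.sin_zero, sub_zero, smul_eq_mul]
    field_simp
  simp_rw [gaussianPDFReal_eq_integral_cos] at key
  rw [intervalIntegral.integral_const_mul, h2] at key
  simp_rw [h3] at key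
  linarith

theorem norm_charFun_le_two (ν κ : Measure ℝ) [IsProbabilityMeasure ν] [IsProbabilityMeasure κ]
    (θ : ℝ) : ‖charFun ν θ - charFun κ θ‖ ≤ 2 :=
  (norm_sub_le _ _).trans <| by
    rw [← one_add_one_eq_two]
    exact add_le_add (norm_charFun_le_one θ) (norm_charFun_le_one θ)

theorem integral_sin_eq_im_charFun (ν : Measure ℝ) [IsProbabilityMeasure ν] (x θ : ℝ) :
    ∫ y, Real.sin (θ * (x - y)) ∂ν = (Complex.exp (θ * x * Complex.I) * charFun ν (-θ)).im := by
  have hint : Integrable (fun y : ℝ => Complex.exp ((θ * (x - y) : ℝ) * Complex.I)) ν := by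
    refine Integrable.of_bound (by fun_prop) 1 (Eventually.of_forall fun y => ?_)
    rw [Complex.norm_exp_ofReal_mul_I]
  have h3 := integral_im hint
  simp only [RCLike.im_to_complex, Complex.exp_ofReal_mul_I_im] at h3
  rw [h3, charFun_apply_real, ← integral_const_mul]
  congr 2
  ext y
  rw [← Complex.exp_add]
  push_cast
  ring_nf

theorem abs_integral_sin_sub_le (ν κ : Measure ℝ) [IsProbabilityMeasure ν]
    [IsProbabilityMeasure κ] (x θ : ℝ) :
    |∫ y, Real.sin (θ * (x - y)) ∂ν - ∫ y, Real.sin (θ * (x - y)) ∂κ|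
      ≤ ‖charFun ν (-θ) - charFun κ (-θ)‖ := by
  rw [integral_sin_eq_im_charFun, integral_sin_eq_im_charFun, ← Complex.sub_im, ← mul_sub]
  refine (Complex.abs_im_le_norm _).trans ?_
  rw [norm_mul, ← Complex.ofReal_mul, Complex.norm_exp_ofReal_mul_I, one_mul]

/-- The left side is the distribution function at `x` of a `ν`-variable plus an independent normal
variable of standard deviation `ε`. Writing the kernel with `sinc` hides the singularity `1/t`, so a
finite first moment suffices for Fubini. -/
theorem integral_normalCDF_eq (ν : Measure ℝ) [IsProbabilityMeasure ν]
    (hν : Integrable (fun y => y) ν) (x ε : ℝ) :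
    ∫ y, normalCDF ((x - y) / ε) ∂ν = normalCDF 0 + (√(2 * Real.pi))⁻¹ *
      ∫ t, (∫ y, (x - y) / ε * Real.sinc (t * ((x - y) / ε)) ∂ν) ∂gaussianReal 0 1 := by
  have hI : Integrable (fun y => (x - y) / ε) ν := ((integrable_const x).sub hν).div_const ε
  have hII : Integrable (Function.uncurry fun (y : ℝ) (t : ℝ) =>
      (x - y) / ε * Real.sinc (t * ((x - y) / ε))) (ν.prod (gaussianReal 0 1)) := by
    have h1 : Integrable (fun p : ℝ × ℝ => (x - p.1) / ε) (ν.prod (gaussianReal 0 1)) :=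
      hI.comp_fst _
    have hc : Continuous (fun p : ℝ × ℝ => Real.sinc (p.2 * ((x - p.1) / ε))) :=
      Real.continuous_sinc.comp (by fun_prop)
    exact h1.mul_bdd (c := 1) hc.aestronglyMeasurable (Eventually.of_forall fun p => by
      rw [Real.norm_eq_abs]; exact Real.abs_sinc_le_one _)
  simp_rw [normalCDF_eq_integral_sinc (_ / ε)]
  have hIII : Integrable (fun y => ∫ t, (x - y) / ε * Real.sinc (t * ((x - y) / ε))
      ∂gaussianReal 0 1) ν := hII.integral_prod_left
  rw [integral_add (integrable_const _) (hIII.const_mul _), integral_const_mul,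
    integral_integral_swap hII]
  simp

/-- The smoothed distribution functions are close if the characteristic functions are. -/
theorem abs_integral_normalCDF_sub_le (ν : Measure ℝ) [IsProbabilityMeasure ν]
    (hν : Integrable (fun y => y) ν) (x : ℝ) {ε T A A' : ℝ} (hε : 0 < ε) (hT : 0 < T)
    (hA : 0 ≤ A) (hA' : 0 ≤ A')
    (h : ∀ θ, |θ| ≤ T → ‖charFun ν θ - charFun (gaussianReal 0 1) θ‖
      ≤ |θ| * (A * (1 + θ ^ 2)⁻¹ + A')) :
    |∫ y, normalCDF ((x - y) / ε) ∂ν - ∫ y, normalCDF ((x - y) / ε) ∂gaussianReal 0 1|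
      ≤ A * Real.pi + A' / ε + 4 / (ε * T) * Real.exp (-(ε * T) ^ 2 / 2) := by
  have hγ : Integrable (fun y : ℝ => y) (gaussianReal 0 1) := 
    memLp_one_iff_integrable.1 (memLp_id_gaussianReal (μ := 0) (v := 1) 1)
  rw [integral_normalCDF_eq ν hν, integral_normalCDF_eq _ hγ]
  set D : ℝ → ℝ := fun t => ∫ y, (x - y) / ε * Real.sinc (t * ((x - y) / ε)) ∂ν -
    ∫ y, (x - y) / ε * Real.sinc (t * ((x - y) / ε)) ∂gaussianReal 0 1 with hD
  have hmeas : ∀ κ : Measure ℝ, IsProbabilityMeasure κ → Integrable (fun y : ℝ => y) κ →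
      Integrable (fun t => ∫ y, (x - y) / ε * Real.sinc (t * ((x - y) / ε)) ∂κ)
        (gaussianReal 0 1) := by
    intro κ _ hκ
    have hI : Integrable (fun y => (x - y) / ε) κ := ((integrable_const x).sub hκ).div_const ε
    have hc : Continuous (fun p : ℝ × ℝ => Real.sinc (p.2 * ((x - p.1) / ε))) :=
      Real.continuous_sinc.comp (by fun_prop)
    have : Integrable (fun p : ℝ × ℝ =>
        (x - p.1) / ε * Real.sinc (p.2 * ((x - p.1) / ε))) (κ.prod (gaussianReal 0 1)) :=
      (hI.comp_fst _).mul_bdd (c := 1) hc.aestronglyMeasurable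
        (Eventually.of_forall fun p => by
          rw [Real.norm_eq_abs]; exact Real.abs_sinc_le_one _)
    exact this.integral_prod_right
  have hDi : Integrable D (gaussianReal 0 1) := (hmeas ν inferInstance hν).sub
    (hmeas _ inferInstance hγ)
  have hsplit : ∀ κ : Measure ℝ, ∀ t : ℝ, t ≠ 0 →
      ∫ y, (x - y) / ε * Real.sinc (t * ((x - y) / ε)) ∂κ
        = (∫ y, Real.sin (t / ε * (x - y)) ∂κ) / t := by
    intro κ t ht
    rw [← integral_div]
    congr 1; ext y
    rcases eq_or_ne (x - y) 0 with h0 | h0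
    · simp [h0]
    rw [Real.sinc_of_ne_zero (by positivity)]
    rw [show t / ε * (x - y) = t * ((x - y) / ε) by ring]
    field_simp
  set tail : ℝ → ℝ := (Set.Iic (-(ε * T)) ∪ Set.Ici (ε * T)).indicator
    (fun _ => 2 / (ε * T)) with htail
  have hεT : 0 < ε * T := mul_pos hε hT
  have htail0 : ∀ t, 0 ≤ tail t := fun t =>
    Set.indicator_nonneg (fun _ _ => by positivity) t
  -- For `|t| ≤ εT` the factor `|θ|` in the hypothesis cancels the `1/t` of the kernel. For larger
  -- `t` the difference of characteristic functions is at most 2, and only the Gaussian mass of `|t|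
  -- ≥ εT` matters.
  have hbound : ∀ t, t ≠ 0 → |D t| ≤ ε⁻¹ * (A * (1 + (t / ε) ^ 2)⁻¹) + A' / ε + tail t := by
    intro t ht
    have hDt : D t = (∫ y, Real.sin (t / ε * (x - y)) ∂ν
        - ∫ y, Real.sin (t / ε * (x - y)) ∂gaussianReal 0 1) / t := by
      rw [hD]; simp only; rw [hsplit _ t ht, hsplit _ t ht]; ring
    rw [hDt, abs_div]
    have h1 := abs_integral_sin_sub_le ν (gaussianReal 0 1) x (t / ε)
    have ht' : 0 < |t| := abs_pos.2 ht
    rw [div_le_iff₀ ht']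
    refine h1.trans ?_
    by_cases hc : |t / ε| ≤ T
    · have h2 := h (-(t / ε)) (by rwa [abs_neg])
      rw [abs_neg, abs_div, abs_of_pos hε, neg_sq] at h2
      refine h2.trans ?_
      have e : |t| / ε * (A * (1 + (t / ε) ^ 2)⁻¹ + A')
          = (ε⁻¹ * (A * (1 + (t / ε) ^ 2)⁻¹) + A' / ε) * |t| := by ring
      rw [e]
      exact mul_le_mul_of_nonneg_right (by linarith [htail0 t]) ht'.le
    · have hlt : ε * T < |t| := by
        rw [abs_div, abs_of_pos hε, not_le, lt_div_iff₀ hε] at hc; linarith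
      have hmem : t ∈ Set.Iic (-(ε * T)) ∪ Set.Ici (ε * T) := by
        rcases lt_abs.1 hlt with h' | h'
        · exact Or.inr h'.le
        · exact Or.inl (by simp; linarith)
      have h3 : tail t = 2 / (ε * T) := Set.indicator_of_mem hmem _
      refine (norm_charFun_le_two _ _ _).trans ?_
      rw [h3]
      have : 2 ≤ 2 / (ε * T) * |t| := by
        rw [div_mul_eq_mul_div, le_div_iff₀ hεT]; linarith
      have h5 : 0 ≤ (ε⁻¹ * (A * (1 + (t / ε) ^ 2)⁻¹) + A' / ε) * |t| := by positivity
      linarith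
  have hcauchy : Integrable (fun t : ℝ => ε⁻¹ * (A * (1 + (t / ε) ^ 2)⁻¹)) :=
    (((integrable_inv_one_add_sq).comp_div hε.ne').const_mul A).const_mul _
  have hcauchy0 : ∀ t : ℝ, 0 ≤ ε⁻¹ * (A * (1 + (t / ε) ^ 2)⁻¹) := fun t => by positivity
  have hcauchyγ : Integrable (fun t : ℝ => ε⁻¹ * (A * (1 + (t / ε) ^ 2)⁻¹)) (gaussianReal 0 1) := by
    refine Integrable.of_bound (by fun_prop) (ε⁻¹ * A) (Eventually.of_forall fun t => ?_)
    rw [Real.norm_of_nonneg (hcauchy0 t)]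
    have : (1 + (t / ε) ^ 2)⁻¹ ≤ 1 := inv_le_one_of_one_le₀ (by nlinarith [sq_nonneg (t / ε)])
    have h4 : A * (1 + (t / ε) ^ 2)⁻¹ ≤ A * 1 := mul_le_mul_of_nonneg_left this hA
    rw [mul_one] at h4
    exact mul_le_mul_of_nonneg_left h4 (by positivity)
  have hms : MeasurableSet (Set.Iic (-(ε * T)) ∪ Set.Ici (ε * T)) :=
    measurableSet_Iic.union measurableSet_Ici
  have htailγ : Integrable tail (gaussianReal 0 1) := (integrable_const _).indicator hms
  have hae : ∀ᵐ t ∂gaussianReal 0 1, t ≠ 0 := by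
    have := nullSingletonClass_gaussianReal (μ := 0) (v := 1) one_ne_zero
    rw [ae_iff]; simp
  -- The normal density is at most 1, so Lebesgue measure may replace it; the substitution `u = t/ε`
  -- removes `ε` and leaves the Cauchy integral `π`.
  have i1 : ∫ t, ε⁻¹ * (A * (1 + (t / ε) ^ 2)⁻¹) ∂gaussianReal 0 1 ≤ A * Real.pi := by
    refine (integral_gaussianReal_le_integral hcauchy0 hcauchy).trans (le_of_eq ?_)
    rw [integral_const_mul, integral_const_mul,
      Measure.integral_comp_div (fun u : ℝ => (1 + u ^ 2)⁻¹) ε, integral_univ_inv_one_add_sq,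
      abs_of_pos hε, smul_eq_mul]
    field_simp
  have i2 : ∫ t, tail t ∂gaussianReal 0 1 ≤ 4 / (ε * T) * Real.exp (-(ε * T) ^ 2 / 2) := by
    rw [htail, integral_indicator hms, setIntegral_const, smul_eq_mul]
    have := (measureReal_union_le (μ := gaussianReal 0 1) (Set.Iic (-(ε * T)))
      (Set.Ici (ε * T))).trans
      (add_le_add (gaussianReal_Iic_neg_le hεT.le) (gaussianReal_Ici_le hεT.le))
    calc _ ≤ (Real.exp (-(ε * T) ^ 2 / 2) + Real.exp (-(ε * T) ^ 2 / 2)) * (2 / (ε * T)) := by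
          gcongr
      _ = _ := by ring
  have i3 : |∫ t, D t ∂gaussianReal 0 1| ≤
      A * Real.pi + A' / ε + 4 / (ε * T) * Real.exp (-(ε * T) ^ 2 / 2) := by
    calc |∫ t, D t ∂gaussianReal 0 1| ≤ ∫ t, |D t| ∂gaussianReal 0 1 :=
          abs_integral_le_integral_abs
      _ ≤ ∫ t, (ε⁻¹ * (A * (1 + (t / ε) ^ 2)⁻¹) + A' / ε + tail t) ∂gaussianReal 0 1 :=
          integral_mono_ae hDi.abs ((hcauchyγ.add (integrable_const _)).add htailγ)
            (hae.mono fun t ht => hbound t ht)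
      _ ≤ _ := by
          have j1 : Integrable (fun t => ε⁻¹ * (A * (1 + (t / ε) ^ 2)⁻¹) + A' / ε)
            (gaussianReal 0 1) := hcauchyγ.add (integrable_const _)
          rw [integral_add j1 htailγ, integral_add hcauchyγ (integrable_const _)]
          simp only [integral_const, probReal_univ, one_smul]
          linarith
  have hs : (√(2 * Real.pi))⁻¹ ≤ 1 := by
    refine inv_le_one_of_one_le₀ (Real.one_le_sqrt.2 ?_)
    nlinarith [Real.pi_gt_three]
  have e : normalCDF 0 + (√(2 * Real.pi))⁻¹ *
      ∫ t, (∫ y, (x - y) / ε * Real.sinc (t * ((x - y) / ε)) ∂ν) ∂gaussianReal 0 1 -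
      (normalCDF 0 + (√(2 * Real.pi))⁻¹ * ∫ t, (∫ y, (x - y) / ε *
        Real.sinc (t * ((x - y) / ε)) ∂gaussianReal 0 1) ∂gaussianReal 0 1)
      = (√(2 * Real.pi))⁻¹ * ∫ t, D t ∂gaussianReal 0 1 := by
    rw [hD, integral_sub (hmeas ν inferInstance hν) (hmeas _ inferInstance hγ)]; ring
  rw [e, abs_mul, abs_of_nonneg (by positivity)]
  calc _ ≤ 1 * |∫ t, D t ∂gaussianReal 0 1| := by gcongr
    _ ≤ _ := by rw [one_mul]; exact i3

/-- A smoothing inequality: a bound for the distance of distribution functions in terms of the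
distance of characteristic functions. -/
theorem abs_measureReal_Iic_sub_normalCDF_le (ν : Measure ℝ) [IsProbabilityMeasure ν]
    (hν : Integrable (fun y => y) ν) (x : ℝ) {ε T A A' a : ℝ} (hε : 0 < ε) (hT : 0 < T)
    (ha : 0 ≤ a) (hA : 0 ≤ A) (hA' : 0 ≤ A')
    (h : ∀ θ, |θ| ≤ T → ‖charFun ν θ - charFun (gaussianReal 0 1) θ‖
      ≤ |θ| * (A * (1 + θ ^ 2)⁻¹ + A')) :
    |ν.real (Set.Iic x) - normalCDF x| ≤ 2 * (ε * a) + 2 * Real.exp (-a ^ 2 / 2) +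
      (A * Real.pi + A' / ε + 4 / (ε * T) * Real.exp (-(ε * T) ^ 2 / 2)) := by
  set δ := A * Real.pi + A' / ε + 4 / (ε * T) * Real.exp (-(ε * T) ^ 2 / 2)
  set r := Real.exp (-a ^ 2 / 2)
  have hmeas : Measurable normalCDF := normalCDF_mono.measurable
  have hint : ∀ κ : Measure ℝ, IsProbabilityMeasure κ → ∀ z : ℝ,
      Integrable (fun y => normalCDF ((z - y) / ε)) κ := fun κ _ z =>
    Integrable.of_bound (hmeas.comp (by fun_prop)).aestronglyMeasurable 1
      (Eventually.of_forall fun y => by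
        rw [Real.norm_of_nonneg (normalCDF_nonneg _)]; exact normalCDF_le_one _)
  -- The smoothing noise exceeds `εa` with probability at most `r`. Shifting the endpoint by `εa`
  -- therefore compares a distribution function with its smoothed version.
  have hup : ∀ κ : Measure ℝ, IsProbabilityMeasure κ → ∀ z : ℝ,
      κ.real (Set.Iic z) ≤ ∫ y, normalCDF ((z + ε * a - y) / ε) ∂κ + r := by
    intro κ _ z
    have hi : ∫ y, (Set.Iic z).indicator (fun _ => (1 : ℝ)) y ∂κ = κ.real (Set.Iic z) := by
      rw [integral_indicator measurableSet_Iic]; simp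
    rw [← hi]
    have : ∫ y, normalCDF ((z + ε * a - y) / ε) ∂κ + r
        = ∫ y, (normalCDF ((z + ε * a - y) / ε) + r) ∂κ := by
      rw [integral_add (hint κ inferInstance _) (integrable_const _)]; simp
    rw [this]
    refine integral_mono ((integrable_const _).indicator measurableSet_Iic)
      ((hint κ inferInstance _).add (integrable_const _)) fun y => ?_
    by_cases hy : y ∈ Set.Iic z
    · simp only [Set.indicator_of_mem hy]
      have h1 : a ≤ (z + ε * a - y) / ε := by
        rw [le_div_iff₀ hε]; linarith [Set.mem_Iic.1 hy]
      linarith [normalCDF_mono h1, one_sub_normalCDF_le ha]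
    · simp only [Set.indicator_of_notMem hy]
      exact add_nonneg (normalCDF_nonneg _) (Real.exp_pos _).le
  have hdown : ∀ κ : Measure ℝ, IsProbabilityMeasure κ → ∀ z : ℝ,
      ∫ y, normalCDF ((z - ε * a - y) / ε) ∂κ ≤ κ.real (Set.Iic z) + r := by
    intro κ _ z
    have hi : ∫ y, ((Set.Iic z).indicator (fun _ => (1 : ℝ)) y + r) ∂κ
        = κ.real (Set.Iic z) + r := by
      rw [integral_add ((integrable_const _).indicator measurableSet_Iic) (integrable_const _),
        integral_indicator measurableSet_Iic]; simp
    rw [← hi]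
    refine integral_mono (hint κ inferInstance _)
      (((integrable_const _).indicator measurableSet_Iic).add (integrable_const _)) fun y => ?_
    by_cases hy : y ∈ Set.Iic z
    · simp only [Set.indicator_of_mem hy]
      linarith [normalCDF_le_one ((z - ε * a - y) / ε), Real.exp_pos (-a ^ 2 / 2)]
    · simp only [Set.indicator_of_notMem hy]
      have h1 : (z - ε * a - y) / ε ≤ -a := by
        rw [div_le_iff₀ hε]; simp only [Set.mem_Iic, not_le] at hy; linarith
      have := (normalCDF_mono h1).trans (gaussianReal_Iic_neg_le ha)
      linarith
  have hεa : 0 ≤ ε * a := by positivity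
  have hc : ∀ z, |∫ y, normalCDF ((z - y) / ε) ∂ν - ∫ y, normalCDF ((z - y) / ε) ∂gaussianReal 0 1|
      ≤ δ := fun z => abs_integral_normalCDF_sub_le ν hν z hε hT hA hA' h
  -- The chain: unsmoothed `ν` at `x`, smoothed `ν` at `x + εa`, smoothed normal there, unsmoothed
  -- normal at `x + 2εa`. The normal distribution function has slope at most 1, which gives `2εa`;
  -- the lower bound is symmetric.
  have u1 := hup ν inferInstance x
  have u2 := le_of_abs_le (hc (x + ε * a))
  have u3 := hdown (gaussianReal 0 1) inferInstance (x + ε * a + ε * a)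
  rw [add_sub_cancel_right] at u3
  have u4 := normalCDF_sub_le (show x ≤ x + ε * a + ε * a by linarith)
  have d1 := hdown ν inferInstance x
  have d2 := neg_le_of_abs_le (hc (x - ε * a))
  have d3 := hup (gaussianReal 0 1) inferInstance (x - ε * a - ε * a)
  rw [sub_add_cancel] at d3
  have d4 := normalCDF_sub_le (show x - ε * a - ε * a ≤ x by linarith)
  unfold normalCDF at u4 d4 ⊢
  rw [abs_le]
  constructor <;> linarith

end Smoothing

end RandomMaps

/-! ### Linear recurrences with delays. -/

namespace RandomMaps

section Recurrence

theorem norm_sub_le_mul_of_forall_norm_succ_sub_le {ψ : ℕ → ℂ} {D : ℝ} {i j : ℕ} (hij : i ≤ j)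
    (h : ∀ l, i ≤ l → l < j → ‖ψ (l + 1) - ψ l‖ ≤ D) : ‖ψ j - ψ i‖ ≤ ((j - i : ℕ) : ℝ) * D := by
  induction j, hij using Nat.le_induction with
  | base => simp
  | succ j hij ih =>
    have h1 := ih fun l hl hlj => h l hl (hlj.trans j.lt_succ_self)
    have h2 := h j hij j.lt_succ_self
    have e : ψ (j + 1) - ψ i = (ψ (j + 1) - ψ j) + (ψ j - ψ i) := by ring
    rw [e, Nat.succ_sub hij]
    push_cast
    linarith [norm_add_le (ψ (j + 1) - ψ j) (ψ j - ψ i)]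

/-- One step of a delayed linear recurrence is close to multiplication by `Λ`. -/
theorem norm_succ_sub_mul_le_of_delayed_recurrence {ψ a : ℕ → ℂ} {R k : ℕ} {Λ A th τ : ℝ}
    (hrec : ∀ N, R * k ≤ N →
      ‖ψ (N + 1) - ψ N - ∑ m ∈ Finset.range R, a m * ψ (N - (m + 1) * k)‖ ≤ τ)
    (hA : ∑ m ∈ Finset.range R, ‖a m‖ ≤ A) (hth : ‖1 + ∑ m ∈ Finset.range R, a m - Λ‖ ≤ th)
    (hAP : A * (R * k) ≤ 1) {N : ℕ} (hN : 2 * (R * k) ≤ N) {x : ℝ}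
    (hx : ∀ j, N - 2 * (R * k) ≤ j → j ≤ N → ‖ψ j‖ ≤ x) :
    ‖ψ (N + 1) - Λ * ψ N‖ ≤ (th + A ^ 2 * (R * k)) * x + 2 * τ := by
  have hA0 : 0 ≤ A := (Finset.sum_nonneg fun _ _ => norm_nonneg _).trans hA
  have hx0 : 0 ≤ x := (norm_nonneg _).trans (hx N (by omega) le_rfl)
  have hτ0 : 0 ≤ τ := (norm_nonneg _).trans (hrec N (by omega))
  have hdelay : ∀ m, m < R → (m + 1) * k ≤ R * k := fun m hm => Nat.mul_le_mul_right k hm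
  -- Inside the delay window the sequence itself moves slowly, by the same recurrence. Replacing a
  -- delayed value by `ψ N` thus costs only second order in `A`; bounding these increments reaches
  -- back a second window, hence `2 * (R * k)` in the hypotheses.
  have hdiff : ∀ l, N - R * k ≤ l → l < N → ‖ψ (l + 1) - ψ l‖ ≤ A * x + τ := by
    intro l hl hlN
    have h1 := hrec l (by omega)
    have h2 : ‖∑ m ∈ Finset.range R, a m * ψ (l - (m + 1) * k)‖ ≤ A * x := by
      refine (norm_sum_le _ _).trans (le_trans ?_ (mul_le_mul_of_nonneg_right hA hx0))
      rw [Finset.sum_mul]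
      refine Finset.sum_le_sum fun m hm => ?_
      rw [norm_mul]
      have := hdelay m (Finset.mem_range.1 hm)
      exact mul_le_mul_of_nonneg_left (hx _ (by omega) (by omega)) (norm_nonneg _)
    have e : ψ (l + 1) - ψ l
        = (ψ (l + 1) - ψ l - ∑ m ∈ Finset.range R, a m * ψ (l - (m + 1) * k))
          + ∑ m ∈ Finset.range R, a m * ψ (l - (m + 1) * k) := by ring
    rw [e]
    exact (norm_add_le _ _).trans (by linarith)
  have h3 : ‖∑ m ∈ Finset.range R, a m * (ψ (N - (m + 1) * k) - ψ N)‖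
      ≤ A * ((R * k) * (A * x + τ)) := by
    refine (norm_sum_le _ _).trans
      (le_trans ?_ (mul_le_mul_of_nonneg_right hA (by positivity)))
    rw [Finset.sum_mul]
    refine Finset.sum_le_sum fun m hm => ?_
    rw [norm_mul]
    have hm' := hdelay m (Finset.mem_range.1 hm)
    refine mul_le_mul_of_nonneg_left ?_ (norm_nonneg _)
    rw [norm_sub_rev]
    refine (norm_sub_le_mul_of_forall_norm_succ_sub_le (D := A * x + τ) (by omega)
      fun l hl hlN => hdiff l (by omega) hlN).trans ?_
    refine mul_le_mul_of_nonneg_right ?_ (by positivity)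
    have : N - (N - (m + 1) * k) ≤ R * k := by omega
    exact_mod_cast this
  have e : ψ (N + 1) - Λ * ψ N
      = (ψ (N + 1) - ψ N - ∑ m ∈ Finset.range R, a m * ψ (N - (m + 1) * k))
        + (1 + ∑ m ∈ Finset.range R, a m - Λ) * ψ N
        + ∑ m ∈ Finset.range R, a m * (ψ (N - (m + 1) * k) - ψ N) := by
    simp_rw [mul_sub]
    rw [Finset.sum_sub_distrib, ← Finset.sum_mul]
    ring
  rw [e]
  have h4 : ‖(1 + ∑ m ∈ Finset.range R, a m - Λ) * ψ N‖ ≤ th * x := by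
    rw [norm_mul]
    exact mul_le_mul hth (hx N (by omega) le_rfl) (norm_nonneg _) ((norm_nonneg _).trans hth)
  have h5 := hrec N (by omega)
  have h6 : A * ((R * k) * (A * x + τ)) = A ^ 2 * (R * k) * x + A * (R * k) * τ := by ring
  have h7 : A * (R * k) * τ ≤ 1 * τ := mul_le_mul_of_nonneg_right hAP hτ0
  refine (norm_add₃_le).trans ?_
  linarith

/-- Solutions of a delayed linear recurrence are close to a geometric sequence. -/
theorem norm_sub_pow_le_of_delayed_recurrence {ψ a : ℕ → ℂ} {R k : ℕ} {Λ w A th b τ : ℝ}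
    (hψ : ∀ N, ‖ψ N‖ ≤ 1)
    (hrec : ∀ N, R * k ≤ N →
      ‖ψ (N + 1) - ψ N - ∑ m ∈ Finset.range R, a m * ψ (N - (m + 1) * k)‖ ≤ τ)
    (hA : ∑ m ∈ Finset.range R, ‖a m‖ ≤ A) (hth : ‖1 + ∑ m ∈ Finset.range R, a m - Λ‖ ≤ th)
    (hAP : A * (R * k) ≤ 1) (hΛ : 0 ≤ Λ)
    (hw : Λ + 2 * (th + A ^ 2 * (R * k)) ≤ w) (hw1 : w ≤ 1) (hw2 : 1 / 2 ≤ w)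
    (hwP : 1 / 2 ≤ w ^ (2 * (R * k)))
    (hb : ∀ N, N ≤ 2 * (R * k) → ‖ψ N - (Λ : ℂ) ^ N‖ ≤ b) (N : ℕ) :
    ‖ψ N - (Λ : ℂ) ^ N‖ ≤
      (2 * b + 8 * (th + A ^ 2 * (R * k)) * N) * w ^ N + 4 * (N : ℝ) ^ 2 * τ := by
  set ϑ := th + A ^ 2 * (R * k) with hϑ
  have hw0 : 0 ≤ w := by linarith
  have hth0 : 0 ≤ th := (norm_nonneg _).trans hth
  have hϑ0 : 0 ≤ ϑ := by positivity
  have hτ0 : 0 ≤ τ := (norm_nonneg _).trans (hrec _ le_rfl)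
  have hb0 : 0 ≤ b := (norm_nonneg _).trans (hb 0 (by omega))
  have hpow : ∀ j, j ≤ 2 * (R * k) → 1 / 2 ≤ w ^ j := fun j hj =>
    hwP.trans (pow_le_pow_of_le_one hw0 hw1 hj)
  have hpowN : ∀ N j, N ≤ j + 2 * (R * k) → w ^ j ≤ 2 * w ^ N := by
    intro N j hj
    have h1 := hwP
    have h2 : w ^ (j + 2 * (R * k)) ≤ w ^ N := pow_le_pow_of_le_one hw0 hw1 hj
    rw [pow_add] at h2
    nlinarith [pow_nonneg hw0 j]
  -- An a priori bound with the worse ratio `w`: the gap `Λ + 2ϑ ≤ w` absorbs the feedback term `ϑ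
  -- x`, where passing to the maximum over a window only costs a factor 2 because `w ^ (2 * (R * k))
  -- ≥ 1/2`.
  have hsize : ∀ N : ℕ, ‖ψ N‖ ≤ 2 * w ^ N + 2 * N * τ := by
    intro N
    induction N using Nat.strong_induction_on with
    | _ N ih =>
      by_cases hN : N ≤ 2 * (R * k)
      · have := hpow N hN
        have h3 : 0 ≤ 2 * (N : ℝ) * τ := by positivity
        linarith [hψ N]
      · obtain ⟨N, rfl⟩ : ∃ N', N = N' + 1 := ⟨N - 1, by omega⟩
        have h1 := norm_succ_sub_mul_le_of_delayed_recurrence hrec hA hth hAP (N := N) (by omega)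
          (x := 4 * w ^ N + 2 * N * τ) (fun j hj hjN => by
            have := ih j (by omega)
            have h4 := hpowN N j (by omega)
            have h5 : (j : ℝ) * τ ≤ N * τ := by gcongr
            linarith)
        have h2 := ih N (by omega)
        have e : ψ (N + 1) = (ψ (N + 1) - Λ * ψ N) + Λ * ψ N := by ring
        have h3 : ‖(Λ : ℂ) * ψ N‖ ≤ Λ * (2 * w ^ N + 2 * N * τ) := by
          rw [norm_mul, Complex.norm_real, Real.norm_of_nonneg hΛ]
          gcongr
        rw [e]
        refine (norm_add_le _ _).trans ?_
        have h4 : (Λ + 2 * ϑ) * (2 * w ^ N) ≤ w * (2 * w ^ N) := by gcongr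
        have h5 : (Λ + ϑ) * (2 * N * τ) ≤ 1 * (2 * N * τ) := by
          refine mul_le_mul_of_nonneg_right (by linarith) (by positivity)
        rw [pow_succ]
        push_cast
        nlinarith
  -- The deviation from `Λ ^ N` is driven by `ϑ ‖ψ‖`, now known to decay like `w ^ N`. Summing the
  -- sources gives the factor `N` in front of `w ^ N` and `N²` in front of `τ`.
  induction N using Nat.strong_induction_on with
  | _ N ih =>
    by_cases hN : N ≤ 2 * (R * k)
    · have h1 := hb N hN
      have h2 := hpow N hN
      have h3 : b ≤ 2 * b * w ^ N := by nlinarith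
      have h4 : 0 ≤ 8 * ϑ * N * w ^ N + 4 * (N : ℝ) ^ 2 * τ := by positivity
      linarith
    · obtain ⟨N, rfl⟩ : ∃ N', N = N' + 1 := ⟨N - 1, by omega⟩
      have h1 := norm_succ_sub_mul_le_of_delayed_recurrence hrec hA hth hAP (N := N) (by omega)
        (x := 4 * w ^ N + 2 * N * τ) (fun j hj hjN => by
          have := hsize j
          have h4 := hpowN N j (by omega)
          have h5 : (j : ℝ) * τ ≤ N * τ := by gcongr
          linarith)
      have h2 := ih N (by omega)
      have e : ψ (N + 1) - (Λ : ℂ) ^ (N + 1)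
          = (ψ (N + 1) - Λ * ψ N) + Λ * (ψ N - (Λ : ℂ) ^ N) := by ring
      have h3 : ‖(Λ : ℂ) * (ψ N - (Λ : ℂ) ^ N)‖
          ≤ w * ((2 * b + 8 * ϑ * N) * w ^ N) + 1 * (4 * (N : ℝ) ^ 2 * τ) := by
        rw [norm_mul, Complex.norm_real, Real.norm_of_nonneg hΛ]
        have hΛw : Λ ≤ w := by linarith
        calc Λ * ‖ψ N - (Λ : ℂ) ^ N‖
            ≤ Λ * ((2 * b + 8 * ϑ * N) * w ^ N + 4 * (N : ℝ) ^ 2 * τ) := by gcongr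
          _ = Λ * ((2 * b + 8 * ϑ * N) * w ^ N) + Λ * (4 * (N : ℝ) ^ 2 * τ) := by ring
          _ ≤ _ := by gcongr; linarith
      rw [e]
      refine (norm_add_le _ _).trans ?_
      have h4 : 4 * ϑ * w ^ N ≤ 8 * ϑ * (w ^ N * w) := by
        have : w ^ N ≤ 2 * (w ^ N * w) := by nlinarith [pow_nonneg hw0 N]
        nlinarith
      have h5 : ϑ * (2 * N * τ) ≤ 1 * (2 * N * τ) :=
        mul_le_mul_of_nonneg_right (by linarith) (by positivity)
      have h6 : 0 ≤ (N : ℝ) * τ := by positivity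
      rw [pow_succ]
      push_cast
      nlinarith

end Recurrence

end RandomMaps

/-! ### Block expansion of characteristic functions of Birkhoff sums. -/

namespace RandomMaps

section Cis

/-- `cis x = e^{ix}`. -/
noncomputable def cis (x : ℝ) : ℂ := Complex.exp (Complex.I * x)

theorem norm_cis (x : ℝ) : ‖cis x‖ = 1 := Complex.norm_exp_I_mul_ofReal x

theorem cis_zero : cis 0 = 1 := by simp [cis]

theorem cis_add (x y : ℝ) : cis (x + y) = cis x * cis y := by
  rw [cis, cis, cis, ← Complex.exp_add]; push_cast; ring_nf

theorem continuous_cis : Continuous cis := by unfold cis; fun_prop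

theorem measurable_cis : Measurable cis := continuous_cis.measurable

theorem norm_cis_sub_one_le (x : ℝ) : ‖cis x - 1‖ ≤ |x| := Real.norm_exp_I_mul_ofReal_sub_one_le

theorem norm_cis_sub_one_le_two (x : ℝ) : ‖cis x - 1‖ ≤ 2 :=
  (norm_sub_le _ _).trans (by rw [norm_cis, norm_one]; norm_num)

theorem norm_cis_sub_one_sub_le (x : ℝ) : ‖cis x - 1 - Complex.I * x‖ ≤ 3 * x ^ 2 := by
  have hn : ‖Complex.I * (x : ℂ)‖ = |x| := by simp
  rcases le_total |x| 1 with h | h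
  · have := Complex.norm_exp_sub_one_sub_id_le (x := Complex.I * x) (by rwa [hn])
    rw [hn, sq_abs] at this
    exact this.trans (by nlinarith [sq_nonneg x])
  · refine (norm_sub_le _ _).trans ?_
    rw [hn]
    have h1 := norm_cis_sub_one_le_two x
    have h2 : |x| ≤ x ^ 2 := by rw [← sq_abs]; nlinarith
    have h3 : 1 ≤ x ^ 2 := by rw [← sq_abs]; nlinarith
    linarith

theorem norm_cis_sub_taylor_two_le {x : ℝ} (hx : |x| ≤ 1) :
    ‖cis x - 1 - Complex.I * x + (x : ℂ) ^ 2 / 2‖ ≤ 3 * |x| ^ 3 := by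
  have h := Complex.norm_exp_sub_sum_le_norm_mul_exp (Complex.I * x) 3
  have hn : ‖Complex.I * (x : ℂ)‖ = |x| := by simp
  rw [hn] at h
  have e : Complex.exp (Complex.I * x) - ∑ m ∈ Finset.range 3, (Complex.I * x) ^ m / m.factorial
      = cis x - 1 - Complex.I * x + (x : ℂ) ^ 2 / 2 := by
    simp [Finset.sum_range_succ, cis, mul_pow]; ring
  rw [e] at h
  have h3 : Real.exp |x| ≤ 3 :=
    (Real.exp_le_exp.2 hx).trans (by linarith [Real.exp_one_lt_d9])
  calc _ ≤ |x| ^ 3 * Real.exp |x| := h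
    _ ≤ |x| ^ 3 * 3 := by gcongr
    _ = _ := by ring

end Cis

section Expansion

variable {Ω : Type*} {τ : Ω → Ω} {φ : Ω → ℝ} {B t : ℝ}

/-- The product of `e^{itφ ∘ τ^{mk}} - 1` with the factors `e^{itS_k ∘ τ^{lk}} - 1`, `l < m`. -/
noncomputable def blockProd (τ : Ω → Ω) (φ : Ω → ℝ) (t : ℝ) (k : ℕ) : ℕ → Ω → ℂ
  | 0, x => cis (t * φ x) - 1
  | m + 1, x => (cis (t * birkhoffSum τ φ k x) - 1) * blockProd τ φ t k m (τ^[k] x)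

theorem abs_birkhoffSum_le (hB : ∀ x, |φ x| ≤ B) (n : ℕ) (x : Ω) :
    |birkhoffSum τ φ n x| ≤ n * B := by
  refine (Finset.abs_sum_le_sum_abs _ _).trans
    ((Finset.sum_le_card_nsmul _ _ B fun _ _ => hB _).trans (by simp))

theorem norm_cis_birkhoffSum_sub_one_le (hB : ∀ x, |φ x| ≤ B) (k : ℕ) (x : Ω) :
    ‖cis (t * birkhoffSum τ φ k x) - 1‖ ≤ |t| * k * B := by
  refine (norm_cis_sub_one_le _).trans ?_
  rw [abs_mul, mul_assoc]
  exact mul_le_mul_of_nonneg_left (abs_birkhoffSum_le hB k x) (abs_nonneg t)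

theorem norm_blockProd_le (hB : ∀ x, |φ x| ≤ B) (k m : ℕ) (x : Ω) :
    ‖blockProd τ φ t k m x‖ ≤ (|t| * k * B) ^ m * (|t| * B) := by
  have hB0 : 0 ≤ B := (abs_nonneg _).trans (hB x)
  induction m generalizing x with
  | zero =>
    simp only [blockProd, pow_zero, one_mul]
    refine (norm_cis_sub_one_le _).trans ?_
    rw [abs_mul]
    exact mul_le_mul_of_nonneg_left (hB x) (abs_nonneg t)
  | succ m ih =>
    rw [blockProd, norm_mul, pow_succ', mul_assoc]
    exact mul_le_mul (norm_cis_birkhoffSum_sub_one_le hB k x) (ih _) (norm_nonneg _) (by positivity)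

/-- A bound for `blockProd` by the first block. -/
theorem norm_blockProd_le_sum (k : ℕ) (hk : 1 ≤ k) (m : ℕ) (x : Ω) :
    ‖blockProd τ φ t k m x‖ ≤ |t| * 2 ^ m * ∑ i ∈ Finset.range k, |φ (τ^[i] x)| := by
  -- Only the first block is linearized and the remaining factors are bounded by 2. Linearity in
  -- `|φ|` over the first `k` steps is the form in which the weight `K` can be cancelled later on.
  have h2 : ∀ m x, ‖blockProd τ φ t k m x‖ ≤ 2 ^ (m + 1) := by
    intro m
    induction m with
    | zero => intro x; simpa [blockProd] using norm_cis_sub_one_le_two _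
    | succ m ih =>
      intro x
      rw [blockProd, norm_mul, pow_succ']
      exact mul_le_mul (norm_cis_sub_one_le_two _) (ih _) (norm_nonneg _) (by norm_num)
  cases m with
  | zero =>
    rw [blockProd, pow_zero, mul_one]
    refine (norm_cis_sub_one_le _).trans ?_
    rw [abs_mul]
    refine mul_le_mul_of_nonneg_left ?_ (abs_nonneg t)
    exact Finset.single_le_sum (f := fun i => |φ (τ^[i] x)|) (fun _ _ => abs_nonneg _)
      (Finset.mem_range.2 hk)
  | succ m =>
    rw [blockProd, norm_mul]
    have h1 : ‖cis (t * birkhoffSum τ φ k x) - 1‖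
        ≤ |t| * ∑ i ∈ Finset.range k, |φ (τ^[i] x)| := by
      refine (norm_cis_sub_one_le _).trans ?_
      rw [abs_mul]
      exact mul_le_mul_of_nonneg_left (Finset.abs_sum_le_sum_abs _ _) (abs_nonneg t)
    calc _ ≤ (|t| * ∑ i ∈ Finset.range k, |φ (τ^[i] x)|) * 2 ^ (m + 1) :=
          mul_le_mul h1 (h2 _ _) (norm_nonneg _) ((norm_nonneg _).trans h1)
      _ = _ := by ring

variable [MeasurableSpace Ω] {μ : Measure Ω}

/-- The characteristic function `E e^{itS_n}` of the Birkhoff sum `S_n`. -/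
noncomputable def sumCharFun (μ : Measure Ω) (τ : Ω → Ω) (φ : Ω → ℝ) (t : ℝ) (n : ℕ) : ℂ :=
  ∫ x, cis (t * birkhoffSum τ φ n x) ∂μ

/-- The asymptotic variance, truncated at lag `k`. -/
noncomputable def lagVariance (μ : Measure Ω) (τ : Ω → Ω) (φ : Ω → ℝ) (k : ℕ) : ℝ :=
  ∫ x, φ x ^ 2 ∂μ + 2 * ∑ j ∈ Finset.range k, ∫ x, φ x * φ (τ^[j + 1] x) ∂μ

/-- A bounded centred observable of a measure preserving system. -/
structure IsBoundedCentered (μ : Measure Ω) (τ : Ω → Ω) (φ : Ω → ℝ) (B : ℝ) : Prop where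
  measurePreserving : MeasurePreserving τ μ μ
  measurable : Measurable φ
  bound : ∀ x, |φ x| ≤ B
  integral_eq_zero : ∫ x, φ x ∂μ = 0

theorem measurable_birkhoffSum (hτ : Measurable τ) (hφ : Measurable φ) (n : ℕ) :
    Measurable (birkhoffSum τ φ n) := by
  induction n with
  | zero => rw [birkhoffSum_zero']; exact measurable_zero
  | succ n ih =>
    have : birkhoffSum τ φ (n + 1) = fun x => birkhoffSum τ φ n x + φ (τ^[n] x) := by
      ext x; exact birkhoffSum_succ _ _ _ _
    rw [this]
    exact ih.add (hφ.comp (hτ.iterate n))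

theorem measurable_blockProd (hτ : Measurable τ) (hφ : Measurable φ) (t : ℝ) (k m : ℕ) :
    Measurable (blockProd τ φ t k m) := by
  induction m with
  | zero =>
    exact (measurable_cis.comp (hφ.const_mul t)).sub_const 1
  | succ m ih =>
    exact ((measurable_cis.comp ((measurable_birkhoffSum hτ hφ k).const_mul t)).sub_const 1).mul
      (ih.comp (hτ.iterate k))

theorem IsBoundedCentered.integral_comp_iterate (h : IsBoundedCentered μ τ φ B) {E : Type*}
    [NormedAddCommGroup E] [NormedSpace ℝ E] {g : Ω → E}
    (hg : AEStronglyMeasurable g μ) (n : ℕ) : ∫ x, g (τ^[n] x) ∂μ = ∫ x, g x ∂μ := by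
  have := h.measurePreserving.iterate n
  rw [← integral_map this.measurable.aemeasurable (by rwa [this.map_eq]), this.map_eq]

variable [IsProbabilityMeasure μ]

theorem IsBoundedCentered.nonneg (h : IsBoundedCentered μ τ φ B) : 0 ≤ B := by
  obtain ⟨x⟩ := nonempty_of_isProbabilityMeasure μ
  exact (abs_nonneg _).trans (h.bound x)

theorem IsBoundedCentered.integrable (h : IsBoundedCentered μ τ φ B) : Integrable φ μ :=
  Integrable.of_bound h.measurable.aestronglyMeasurable B (Eventually.of_forall h.bound)

theorem IsBoundedCentered.integrable_birkhoffSum (h : IsBoundedCentered μ τ φ B) (n : ℕ) :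
    Integrable (birkhoffSum τ φ n) μ :=
  Integrable.of_bound (measurable_birkhoffSum h.measurePreserving.measurable h.measurable
    n).aestronglyMeasurable (n * B) (Eventually.of_forall (abs_birkhoffSum_le h.bound n))

theorem IsBoundedCentered.integral_birkhoffSum (h : IsBoundedCentered μ τ φ B) (n : ℕ) :
    ∫ x, birkhoffSum τ φ n x ∂μ = 0 := by
  have : ∀ j, Integrable (fun x => φ (τ^[j] x)) μ := fun j =>
    (h.measurePreserving.iterate j).integrable_comp_of_integrable h.integrable
  simp only [birkhoffSum]
  rw [integral_finsetSum _ fun j _ => this j]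
  refine Finset.sum_eq_zero fun j _ => ?_
  rw [h.integral_comp_iterate h.measurable.aestronglyMeasurable, h.integral_eq_zero]

theorem IsBoundedCentered.integral_birkhoffSum_mul (h : IsBoundedCentered μ τ φ B) (n : ℕ) :
    ∫ x, birkhoffSum τ φ n x * φ (τ^[n] x) ∂μ
      = ∑ j ∈ Finset.range n, ∫ x, φ x * φ (τ^[j + 1] x) ∂μ := by
  have hm : ∀ j, Measurable fun x => φ (τ^[j] x) := fun j =>
    h.measurable.comp (h.measurePreserving.measurable.iterate j)
  have hi : ∀ j, Integrable (fun x => φ (τ^[j] x) * φ (τ^[n] x)) μ := fun j =>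
    (Integrable.of_bound (hm j).aestronglyMeasurable B
      (Eventually.of_forall fun x => h.bound _)).mul_bdd (hm n).aestronglyMeasurable
      (Eventually.of_forall fun x => h.bound _)
  simp only [birkhoffSum, Finset.sum_mul]
  rw [integral_finsetSum _ fun j _ => hi j, ← Finset.sum_range_reflect]
  refine Finset.sum_congr rfl fun j hj => ?_
  have hj' := Finset.mem_range.1 hj
  rw [← h.integral_comp_iterate (g := fun x => φ x * φ (τ^[j + 1] x))
    (h.measurable.mul (hm _)).aestronglyMeasurable (n - 1 - j)]
  congr 1; ext x
  rw [← Function.iterate_add_apply]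
  congr 3
  omega

/-- The increments of the variances of the Birkhoff sums. -/
theorem IsBoundedCentered.integral_sq_birkhoffSum_succ (h : IsBoundedCentered μ τ φ B) (n : ℕ) :
    ∫ x, birkhoffSum τ φ (n + 1) x ^ 2 ∂μ
      = ∫ x, birkhoffSum τ φ n x ^ 2 ∂μ + lagVariance μ τ φ n := by
  have hτ := h.measurePreserving.measurable
  have hS := measurable_birkhoffSum hτ h.measurable n
  have hm : Measurable fun x => φ (τ^[n] x) := h.measurable.comp (hτ.iterate n)
  have hSi := h.integrable_birkhoffSum n
  have hb : ∀ x, ‖φ (τ^[n] x)‖ ≤ B := fun x => h.bound _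
  have i1 : Integrable (fun x => birkhoffSum τ φ n x ^ 2) μ := by
    simp_rw [sq]
    exact hSi.mul_bdd hS.aestronglyMeasurable
      (Eventually.of_forall (abs_birkhoffSum_le h.bound n))
  have i2 : Integrable (fun x => birkhoffSum τ φ n x * φ (τ^[n] x)) μ :=
    hSi.mul_bdd hm.aestronglyMeasurable (Eventually.of_forall hb)
  have i3 : Integrable (fun x => φ (τ^[n] x) ^ 2) μ := by
    simp_rw [sq]
    exact (Integrable.of_bound hm.aestronglyMeasurable B (Eventually.of_forall hb)).mul_bdd
      hm.aestronglyMeasurable (Eventually.of_forall hb)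
  have e : ∀ x, birkhoffSum τ φ (n + 1) x ^ 2 = birkhoffSum τ φ n x ^ 2
      + 2 * (birkhoffSum τ φ n x * φ (τ^[n] x)) + φ (τ^[n] x) ^ 2 := fun x => by
    rw [birkhoffSum_succ]; ring
  simp_rw [e]
  have i4 : Integrable (fun x => birkhoffSum τ φ n x ^ 2
      + 2 * (birkhoffSum τ φ n x * φ (τ^[n] x))) μ := i1.add (i2.const_mul 2)
  rw [integral_add i4 i3, integral_add i1 (i2.const_mul 2), integral_const_mul,
    h.integral_birkhoffSum_mul, lagVariance,
    h.integral_comp_iterate (g := fun x => φ x ^ 2) (h.measurable.pow_const 2).aestronglyMeasurable]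
  ring

theorem IsBoundedCentered.integral_sq_birkhoffSum (h : IsBoundedCentered μ τ φ B) (n : ℕ) :
    ∫ x, birkhoffSum τ φ n x ^ 2 ∂μ = ∑ i ∈ Finset.range n, lagVariance μ τ φ i := by
  induction n with
  | zero => simp
  | succ n ih => rw [h.integral_sq_birkhoffSum_succ, ih, Finset.sum_range_succ]

theorem IsBoundedCentered.integrable_cis (h : IsBoundedCentered μ τ φ B) (t : ℝ) (n : ℕ) :
    Integrable (fun x => cis (t * birkhoffSum τ φ n x)) μ :=
  Integrable.of_bound (measurable_cis.comp ((measurable_birkhoffSum h.measurePreserving.measurable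
    h.measurable n).const_mul t)).aestronglyMeasurable 1
    (Eventually.of_forall fun _ => (norm_cis _).le)

theorem norm_sumCharFun_le_one (t : ℝ) (n : ℕ) : ‖sumCharFun μ τ φ t n‖ ≤ 1 := by
  refine (norm_integral_le_of_norm_le_const (C := 1)
    (Eventually.of_forall fun _ => (norm_cis _).le)).trans (by simp)

/-- The linear Taylor term integrates to zero. This controls the initial values of the recurrence,
and the whole sequence when the sums are bounded in `L²`. -/
theorem IsBoundedCentered.norm_sumCharFun_sub_one_le (h : IsBoundedCentered μ τ φ B) (t : ℝ)
    (n : ℕ) : ‖sumCharFun μ τ φ t n - 1‖ ≤ 3 * t ^ 2 * ∫ x, birkhoffSum τ φ n x ^ 2 ∂μ := by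
  have hS := measurable_birkhoffSum h.measurePreserving.measurable h.measurable n
  have hSi := h.integrable_birkhoffSum n
  have i1 : Integrable (fun x => birkhoffSum τ φ n x ^ 2) μ := by
    simp_rw [sq]
    exact hSi.mul_bdd hS.aestronglyMeasurable
      (Eventually.of_forall (abs_birkhoffSum_le h.bound n))
  have hlin : Integrable (fun x => Complex.I * ((t * birkhoffSum τ φ n x : ℝ) : ℂ)) μ :=
    ((hSi.const_mul t).ofReal).const_mul _
  have hz : ∫ x, Complex.I * ((t * birkhoffSum τ φ n x : ℝ) : ℂ) ∂μ = 0 := by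
    rw [integral_const_mul, integral_complex_ofReal, integral_const_mul, h.integral_birkhoffSum]
    simp
  have i2 : Integrable (fun x => cis (t * birkhoffSum τ φ n x) - 1) μ :=
    (h.integrable_cis t n).sub (integrable_const _)
  have e : sumCharFun μ τ φ t n - 1 = ∫ x, (cis (t * birkhoffSum τ φ n x) - 1
      - Complex.I * ((t * birkhoffSum τ φ n x : ℝ) : ℂ)) ∂μ := by
    rw [integral_sub i2 hlin, hz, integral_sub (h.integrable_cis t n) (integrable_const _)]
    simp [sumCharFun]
  rw [e, ← integral_const_mul]
  refine norm_integral_le_of_norm_le (i1.const_mul _) (Eventually.of_forall fun x => ?_)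
  refine (norm_cis_sub_one_sub_le _).trans (le_of_eq ?_)
  ring

theorem IsBoundedCentered.integrable_cis_mul_blockProd (h : IsBoundedCentered μ τ φ B) (t : ℝ)
    (k m N N' : ℕ) : Integrable (fun x => cis (t * birkhoffSum τ φ N x) *
      blockProd τ φ t k m (τ^[N'] x)) μ :=
  (h.integrable_cis t N).mul_bdd ((measurable_blockProd h.measurePreserving.measurable
    h.measurable t k m).comp (h.measurePreserving.measurable.iterate N')).aestronglyMeasurable
    (Eventually.of_forall fun _ => norm_blockProd_le h.bound k m _)

/-- The delayed recurrence for the characteristic functions of Birkhoff sums. -/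
theorem IsBoundedCentered.norm_sumCharFun_recurrence_le (h : IsBoundedCentered μ τ φ B)
    {t : ℝ} {k : ℕ} {ρ : ℕ → ℝ}
    (hdec : ∀ N m, ‖∫ x, cis (t * birkhoffSum τ φ N x) * blockProd τ φ t k m (τ^[N + k] x) ∂μ
      - sumCharFun μ τ φ t N * ∫ x, blockProd τ φ t k m x ∂μ‖ ≤ ρ m) (R : ℕ) {N : ℕ}
    (hN : R * k ≤ N) :
    ‖sumCharFun μ τ φ t (N + 1) - sumCharFun μ τ φ t N
      - ∑ m ∈ Finset.range R, (∫ x, blockProd τ φ t k m x ∂μ) *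
        sumCharFun μ τ φ t (N - (m + 1) * k)‖ ≤
      ∑ m ∈ Finset.range R, ρ m + (|t| * k * B) ^ R * (|t| * B) := by
  set Q : ℕ → ℕ → ℂ := fun m N =>
    ∫ x, cis (t * birkhoffSum τ φ N x) * blockProd τ φ t k m (τ^[N] x) ∂μ with hQ
  have hQ0 : ∀ N, Q 0 N = sumCharFun μ τ φ t (N + 1) - sumCharFun μ τ φ t N := by
    intro N
    rw [sumCharFun, sumCharFun, ← integral_sub (h.integrable_cis t _) (h.integrable_cis t _)]
    refine integral_congr_ae (Eventually.of_forall fun x => ?_)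
    simp only [blockProd, birkhoffSum_succ, mul_add, cis_add]
    ring
  -- The splitting `e^{itS_{N+k}} = e^{itS_N} + e^{itS_N} (e^{itS_k∘τ^N} - 1)`. In the first term a
  -- gap of length `k` precedes the block product, so `hdec` decouples it; the second term moves one
  -- more small factor into the block product.
  have hQs : ∀ m N, Q m (N + k) = ∫ x, cis (t * birkhoffSum τ φ N x) *
      blockProd τ φ t k m (τ^[N + k] x) ∂μ + Q (m + 1) N := by
    intro m N
    rw [hQ]
    simp only
    rw [← integral_add (h.integrable_cis_mul_blockProd t k m N (N + k))
      (h.integrable_cis_mul_blockProd t k (m + 1) N N)]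
    refine integral_congr_ae (Eventually.of_forall fun x => ?_)
    simp only [blockProd, birkhoffSum_add, mul_add, cis_add]
    rw [show τ^[k] (τ^[N] x) = τ^[N + k] x by rw [add_comm, Function.iterate_add_apply]]
    ring
  have hstep : ∀ R N, R * k ≤ N → ‖Q 0 N - ∑ m ∈ Finset.range R,
      (∫ x, blockProd τ φ t k m x ∂μ) * sumCharFun μ τ φ t (N - (m + 1) * k) - Q R (N - R * k)‖
      ≤ ∑ m ∈ Finset.range R, ρ m := by
    intro R
    induction R with
    | zero => intro N _; simp
    | succ R ih =>
      intro N hN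
      have hle : R * k ≤ N := (Nat.mul_le_mul_right k R.le_succ).trans hN
      have h1 := ih N hle
      have hNk : N - R * k = (N - (R + 1) * k) + k := by
        rw [Nat.succ_mul] at hN ⊢; omega
      have h3 := hdec (N - (R + 1) * k) R
      rw [Finset.sum_range_succ, Finset.sum_range_succ]
      refine le_trans (le_of_eq ?_) ((norm_add_le _ _).trans (add_le_add h1 h3))
      rw [hNk, hQs]
      congr 1
      ring
  have h1 := hstep R N hN
  have h2 : ‖Q R (N - R * k)‖ ≤ (|t| * k * B) ^ R * (|t| * B) := by
    refine (norm_integral_le_of_norm_le_const (C := (|t| * k * B) ^ R * (|t| * B))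
      (Eventually.of_forall fun _ => ?_)).trans (by simp)
    rw [norm_mul, norm_cis, one_mul]
    exact norm_blockProd_le h.bound k R _
  rw [← hQ0]
  set z := Q 0 N - ∑ m ∈ Finset.range R,
      (∫ x, blockProd τ φ t k m x ∂μ) * sumCharFun μ τ φ t (N - (m + 1) * k)
  calc ‖z‖ = ‖(z - Q R (N - R * k)) + Q R (N - R * k)‖ := by rw [sub_add_cancel]
    _ ≤ _ := (norm_add_le _ _).trans (add_le_add h1 h2)

theorem IsBoundedCentered.norm_integral_blockProd_le (h : IsBoundedCentered μ τ φ B)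
    (t : ℝ) (k m : ℕ) :
    ‖∫ x, blockProd τ φ t k m x ∂μ‖ ≤ (|t| * k * B) ^ m * (|t| * B) :=
  (norm_integral_le_of_norm_le_const (Eventually.of_forall fun x =>
    norm_blockProd_le h.bound k m x)).trans (by simp)

theorem IsBoundedCentered.norm_integral_blockProd_zero_le (h : IsBoundedCentered μ τ φ B)
    {t : ℝ} (ht : |t| * B ≤ 1) :
    ‖∫ x, blockProd τ φ t k 0 x ∂μ + ((t ^ 2 / 2 * ∫ x, φ x ^ 2 ∂μ : ℝ) : ℂ)‖
      ≤ 3 * |t| ^ 3 * B ^ 3 := by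
  have hB0 := h.nonneg
  have i1 : Integrable (fun x => φ x ^ 2) μ := by
    simp_rw [sq]
    exact h.integrable.mul_bdd h.measurable.aestronglyMeasurable (Eventually.of_forall h.bound)
  have i2 : Integrable (fun x => cis (t * φ x) - 1) μ :=
    (Integrable.of_bound (measurable_cis.comp (h.measurable.const_mul t)).aestronglyMeasurable 1
    (Eventually.of_forall fun _ => (norm_cis _).le)).sub (integrable_const _)
  have i3 : Integrable (fun x => Complex.I * ((t * φ x : ℝ) : ℂ)) μ :=
    ((h.integrable.const_mul t).ofReal).const_mul _
  have i4 : Integrable (fun x => ((t * φ x : ℝ) : ℂ) ^ 2 / 2) μ := by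
    have : (fun x => ((t * φ x : ℝ) : ℂ) ^ 2 / 2)
        = fun x => ((t ^ 2 / 2 * φ x ^ 2 : ℝ) : ℂ) := by ext x; push_cast; ring
    rw [this]
    exact (i1.const_mul _).ofReal
  have hz : ∫ x, Complex.I * ((t * φ x : ℝ) : ℂ) ∂μ = 0 := by
    rw [integral_const_mul, integral_complex_ofReal, integral_const_mul, h.integral_eq_zero]
    simp
  have hq : ∫ x, ((t * φ x : ℝ) : ℂ) ^ 2 / 2 ∂μ = ((t ^ 2 / 2 * ∫ x, φ x ^ 2 ∂μ : ℝ) : ℂ) := by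
    rw [← integral_const_mul, ← integral_complex_ofReal]
    congr 1; ext x; push_cast; ring
  have i5 : Integrable (fun x => cis (t * φ x) - 1 - Complex.I * ((t * φ x : ℝ) : ℂ)) μ :=
    i2.sub i3
  have e : ∫ x, blockProd τ φ t k 0 x ∂μ + ((t ^ 2 / 2 * ∫ x, φ x ^ 2 ∂μ : ℝ) : ℂ)
      = ∫ x, (cis (t * φ x) - 1 - Complex.I * ((t * φ x : ℝ) : ℂ)
        + ((t * φ x : ℝ) : ℂ) ^ 2 / 2) ∂μ := by
    rw [integral_add i5 i4, integral_sub i2 i3, hz, hq, sub_zero]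
    rfl
  rw [e]
  refine (norm_integral_le_of_norm_le_const (C := 3 * |t| ^ 3 * B ^ 3)
    (Eventually.of_forall fun x => ?_)).trans (by simp)
  have hx : |t * φ x| ≤ |t| * B := by
    rw [abs_mul]; exact mul_le_mul_of_nonneg_left (h.bound x) (abs_nonneg t)
  refine (norm_cis_sub_taylor_two_le (hx.trans ht)).trans ?_
  calc 3 * |t * φ x| ^ 3 ≤ 3 * (|t| * B) ^ 3 := by gcongr
    _ = _ := by ring

/-- To leading order `(e^{ip} - 1)(e^{iq} - 1)` is `-pq` with `p = tS_k` and `q = tφ∘τ^k`, and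
`E[S_k · φ∘τ^k]` is the sum of the correlations at lags `1, …, k`. -/
theorem IsBoundedCentered.norm_integral_blockProd_one_le (h : IsBoundedCentered μ τ φ B)
    {t : ℝ} {k : ℕ} (hk : 1 ≤ k) :
    ‖∫ x, blockProd τ φ t k 1 x ∂μ +
      ((t ^ 2 * ∑ j ∈ Finset.range k, ∫ x, φ x * φ (τ^[j + 1] x) ∂μ : ℝ) : ℂ)‖
      ≤ 6 * |t| ^ 3 * k ^ 2 * B ^ 3 := by
  have hB0 := h.nonneg
  have hτ := h.measurePreserving.measurable
  have hm : Measurable fun x => φ (τ^[k] x) := h.measurable.comp (hτ.iterate k)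
  rw [← h.integral_birkhoffSum_mul, ← integral_const_mul, ← integral_complex_ofReal]
  have i1 : Integrable (fun x => ((t ^ 2 * (birkhoffSum τ φ k x * φ (τ^[k] x)) : ℝ) : ℂ)) μ :=
    (((h.integrable_birkhoffSum k).mul_bdd hm.aestronglyMeasurable
      (Eventually.of_forall fun x => h.bound _)).const_mul _).ofReal
  have i2 : Integrable (blockProd τ φ t k 1) μ :=
    Integrable.of_bound (measurable_blockProd hτ h.measurable t k 1).aestronglyMeasurable _
      (Eventually.of_forall fun x => norm_blockProd_le h.bound k 1 x)
  rw [← integral_add i2 i1]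
  refine (norm_integral_le_of_norm_le_const (C := 6 * |t| ^ 3 * k ^ 2 * B ^ 3)
    (Eventually.of_forall fun x => ?_)).trans (by simp)
  set p := t * birkhoffSum τ φ k x with hp
  set q := t * φ (τ^[k] x) with hq
  have hpb : |p| ≤ |t| * (k * B) := by
    rw [hp, abs_mul]
    exact mul_le_mul_of_nonneg_left (abs_birkhoffSum_le h.bound k x) (abs_nonneg t)
  have hqb : |q| ≤ |t| * B := by
    rw [hq, abs_mul]; exact mul_le_mul_of_nonneg_left (h.bound _) (abs_nonneg t)
  have e : blockProd τ φ t k 1 x + ((t ^ 2 * (birkhoffSum τ φ k x * φ (τ^[k] x)) : ℝ) : ℂ)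
      = (cis p - 1 - Complex.I * p) * (cis q - 1) + Complex.I * p * (cis q - 1 - Complex.I * q) := by
    have : (t ^ 2 * (birkhoffSum τ φ k x * φ (τ^[k] x)) : ℝ) = p * q := by rw [hp, hq]; ring
    rw [this]
    simp only [blockProd]
    push_cast
    linear_combination ((p : ℂ) * q) * Complex.I_sq
  rw [e]
  refine (norm_add_le _ _).trans ?_
  rw [norm_mul, norm_mul, norm_mul, Complex.norm_I, one_mul, Complex.norm_real, Real.norm_eq_abs]
  have h1 := norm_cis_sub_one_sub_le p
  have h2 := norm_cis_sub_one_le q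
  have h3 := norm_cis_sub_one_sub_le q
  rw [← sq_abs] at h1 h3
  have hk1 : (1 : ℝ) ≤ k := by exact_mod_cast hk
  calc _ ≤ 3 * |p| ^ 2 * |q| + |p| * (3 * |q| ^ 2) := by gcongr
    _ ≤ 3 * (|t| * (k * B)) ^ 2 * (|t| * B) + |t| * (k * B) * (3 * (|t| * B) ^ 2) := by gcongr
    _ = 3 * |t| ^ 3 * B ^ 3 * (k ^ 2 + k) := by ring
    _ ≤ 3 * |t| ^ 3 * B ^ 3 * (k ^ 2 + k ^ 2) := by
        gcongr
        nlinarith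
    _ = _ := by ring

theorem IsBoundedCentered.sum_norm_integral_blockProd_tail_le (h : IsBoundedCentered μ τ φ B)
    {t : ℝ} {k : ℕ} (ht : |t| * k * B ≤ 1 / 2) (R : ℕ) :
    ∑ m ∈ Finset.range R, ‖∫ x, blockProd τ φ t k (m + 2) x ∂μ‖
      ≤ 2 * |t| ^ 3 * k ^ 2 * B ^ 3 := by
  have hB0 := h.nonneg
  have h0 : 0 ≤ |t| * k * B := by positivity
  calc _ ≤ ∑ m ∈ Finset.range R, (1 / 2) ^ m * ((|t| * k * B) ^ 2 * (|t| * B)) := by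
        refine Finset.sum_le_sum fun m _ => (h.norm_integral_blockProd_le t k (m + 2)).trans ?_
        rw [pow_add, mul_assoc]
        gcongr
    _ ≤ 2 * ((|t| * k * B) ^ 2 * (|t| * B)) := by
        rw [← Finset.sum_mul]
        refine mul_le_mul_of_nonneg_right ?_ (by positivity)
        refine (Summable.sum_le_tsum _ (fun _ _ => by positivity) summable_geometric_two).trans ?_
        rw [tsum_geometric_two]
    _ = _ := by ring

/-- The coefficient `m = 0` supplies `E φ²`, the coefficient `m = 1` the correlations up to lag `k`,
and all others have at least three small factors. The constant 11 is `3 + 6 + 2` from these three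
groups. The absolute sum is what bounds the movement within a delay window. -/
theorem IsBoundedCentered.coefficient_bounds (h : IsBoundedCentered μ τ φ B)
    {t : ℝ} {k : ℕ} (hk : 1 ≤ k) (ht : |t| * k * B ≤ 1 / 2) (R : ℕ) :
    ‖∑ m ∈ Finset.range (R + 2), ∫ x, blockProd τ φ t k m x ∂μ
      + ((t ^ 2 / 2 * lagVariance μ τ φ k : ℝ) : ℂ)‖ ≤ 11 * |t| ^ 3 * k ^ 2 * B ^ 3 ∧
    ∑ m ∈ Finset.range (R + 2), ‖∫ x, blockProd τ φ t k m x ∂μ‖ ≤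
      t ^ 2 * (∫ x, φ x ^ 2 ∂μ + |lagVariance μ τ φ k|) + 11 * |t| ^ 3 * k ^ 2 * B ^ 3 := by
  have hB0 := h.nonneg
  have hk1 : (1 : ℝ) ≤ k := by exact_mod_cast hk
  have ht1 : |t| * B ≤ 1 := by
    have : |t| * B ≤ |t| * k * B := by
      rw [mul_right_comm]; exact le_mul_of_one_le_right (by positivity) hk1
    linarith
  have h0 := h.norm_integral_blockProd_zero_le (k := k) ht1
  have h1 := h.norm_integral_blockProd_one_le (t := t) hk
  have h2 := h.sum_norm_integral_blockProd_tail_le ht R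
  have h0' : 3 * |t| ^ 3 * B ^ 3 ≤ 3 * |t| ^ 3 * k ^ 2 * B ^ 3 := by
    have : (1 : ℝ) ≤ k ^ 2 := by nlinarith
    calc 3 * |t| ^ 3 * B ^ 3 = 3 * |t| ^ 3 * 1 * B ^ 3 := by ring
      _ ≤ _ := by gcongr
  set a : ℕ → ℂ := fun m => ∫ x, blockProd τ φ t k m x ∂μ
  set c := ∫ x, φ x ^ 2 ∂μ with hc
  set d := ∑ j ∈ Finset.range k, ∫ x, φ x * φ (τ^[j + 1] x) ∂μ with hd
  have hV : lagVariance μ τ φ k = c + 2 * d := rfl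
  have hc0 : 0 ≤ c := integral_nonneg fun x => sq_nonneg _
  have ea : ∑ m ∈ Finset.range (R + 2), a m = ∑ m ∈ Finset.range R, a (m + 2) + a 1 + a 0 := by
    rw [Finset.sum_range_succ', Finset.sum_range_succ']
  have ea' : ∑ m ∈ Finset.range (R + 2), ‖a m‖
      = ∑ m ∈ Finset.range R, ‖a (m + 2)‖ + ‖a 1‖ + ‖a 0‖ := by
    rw [Finset.sum_range_succ', Finset.sum_range_succ']
  constructor
  · rw [ea, hV]
    have e : ∑ m ∈ Finset.range R, a (m + 2) + a 1 + a 0 + ((t ^ 2 / 2 * (c + 2 * d) : ℝ) : ℂ)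
        = ∑ m ∈ Finset.range R, a (m + 2) + (a 1 + ((t ^ 2 * d : ℝ) : ℂ))
          + (a 0 + ((t ^ 2 / 2 * c : ℝ) : ℂ)) := by push_cast; ring
    rw [e]
    have h3 := norm_sum_le (Finset.range R) fun m => a (m + 2)
    refine norm_add₃_le.trans ?_
    linarith
  · rw [ea']
    have h4 : ‖a 0‖ ≤ 3 * |t| ^ 3 * B ^ 3 + t ^ 2 / 2 * c := by
      have := norm_sub_le (a 0 + ((t ^ 2 / 2 * c : ℝ) : ℂ)) ((t ^ 2 / 2 * c : ℝ) : ℂ)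
      rw [add_sub_cancel_right, Complex.norm_real, Real.norm_of_nonneg (by positivity)] at this
      linarith
    have h5 : ‖a 1‖ ≤ 6 * |t| ^ 3 * k ^ 2 * B ^ 3 + t ^ 2 * |d| := by
      have := norm_sub_le (a 1 + ((t ^ 2 * d : ℝ) : ℂ)) ((t ^ 2 * d : ℝ) : ℂ)
      rw [add_sub_cancel_right, Complex.norm_real, Real.norm_eq_abs, abs_mul,
        abs_of_nonneg (sq_nonneg t)] at this
      linarith
    have h6 : t ^ 2 / 2 * c + t ^ 2 * |d| ≤ t ^ 2 * (c + |lagVariance μ τ φ k|) := by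
      have : 2 * |d| ≤ |lagVariance μ τ φ k| + c := by
        have h7 : 2 * d = lagVariance μ τ φ k - c := by rw [hV]; ring
        have h8 : 2 * |d| = |2 * d| := by rw [abs_mul]; norm_num
        rw [h8, h7]
        have h11 := norm_sub_le (lagVariance μ τ φ k) c
        simp only [Real.norm_eq_abs] at h11
        rwa [abs_of_nonneg hc0] at h11
      have h9 : t ^ 2 * |d| ≤ t ^ 2 * ((|lagVariance μ τ φ k| + c) / 2) := by
        gcongr; linarith
      have h10 : 0 ≤ t ^ 2 * |lagVariance μ τ φ k| := by positivity
      linarith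
    linarith

end Expansion

end RandomMaps

/-! ### Gaussian approximation of characteristic functions. -/

namespace RandomMaps

section CharFunEstimate

variable {Ω : Type*} {τ : Ω → Ω} {φ : Ω → ℝ} {B : ℝ} [MeasurableSpace Ω] {μ : Measure Ω}

/-- The sequence `ρ` decays faster than any power. -/
def DecaysFast (ρ : ℕ → ℝ) : Prop := ∀ p : ℕ, ∃ C, 0 ≤ C ∧ ∀ k : ℕ, 1 ≤ k → ρ k ≤ C / (k : ℝ) ^ p

theorem IsBoundedCentered.integral_sq_le [IsProbabilityMeasure μ]
    (h : IsBoundedCentered μ τ φ B) : ∫ x, φ x ^ 2 ∂μ ≤ B ^ 2 := by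
  have := norm_integral_le_of_norm_le_const (μ := μ) (f := fun x => φ x ^ 2) (C := B ^ 2)
    (Eventually.of_forall fun x => by
      rw [Real.norm_of_nonneg (sq_nonneg _), ← sq_abs]
      exact pow_le_pow_left₀ (abs_nonneg _) (h.bound x) 2)
  exact (le_abs_self _).trans (this.trans (by simp))

/-- Of the two extra powers of decay, both go into the telescoping majorant `1/l - 1/(l+1)`, which
leaves `k^{-p}` for the tail. -/
theorem abs_lagVariance_sub_le {C : ℝ} {ρ : ℕ → ℝ} (hC : 0 ≤ C) {p : ℕ}
    (hρ : ∀ k : ℕ, 1 ≤ k → ρ k ≤ C / (k : ℝ) ^ (p + 2))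
    (hcorr : ∀ j, 1 ≤ j → |∫ x, φ x * φ (τ^[j] x) ∂μ| ≤ ρ j) {k l : ℕ} (hk : 1 ≤ k) (hkl : k ≤ l) :
    |lagVariance μ τ φ l - lagVariance μ τ φ k| ≤ 2 * C / (k : ℝ) ^ p := by
  have hk0 : (0 : ℝ) < k := by exact_mod_cast hk
  have key : |lagVariance μ τ φ l - lagVariance μ τ φ k| ≤
      2 * C / (k : ℝ) ^ p * ((k : ℝ)⁻¹ - (l : ℝ)⁻¹) := by
    induction l, hkl using Nat.le_induction with
    | base => simp
    | succ l hkl ih =>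
      have hl0 : (0 : ℝ) < l := hk0.trans_le (by exact_mod_cast hkl)
      have e : lagVariance μ τ φ (l + 1) - lagVariance μ τ φ k
          = (lagVariance μ τ φ l - lagVariance μ τ φ k)
            + 2 * ∫ x, φ x * φ (τ^[l + 1] x) ∂μ := by
        simp only [lagVariance, Finset.sum_range_succ]; ring
      rw [e]
      refine (abs_add_le _ _).trans ?_
      have h1 : |2 * ∫ x, φ x * φ (τ^[l + 1] x) ∂μ| ≤ 2 * (C / ((l + 1 : ℕ) : ℝ) ^ (p + 2)) := by
        rw [abs_mul, abs_two]
        exact mul_le_mul_of_nonneg_left ((hcorr _ (by omega)).trans (hρ _ (by omega))) two_pos.le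
      have h2 : C / ((l + 1 : ℕ) : ℝ) ^ (p + 2) ≤ C / (k : ℝ) ^ p * ((l : ℝ)⁻¹ - ((l + 1 : ℕ) : ℝ)⁻¹) := by
        have h3 : (l : ℝ)⁻¹ - ((l + 1 : ℕ) : ℝ)⁻¹ = 1 / (l * (l + 1)) := by
          push_cast; field_simp; ring
        rw [h3, div_mul_div_comm, mul_one]
        have hkl' : (k : ℝ) ≤ l := by exact_mod_cast hkl
        have h4 : (k : ℝ) ^ p * (l * (l + 1)) ≤ ((l + 1 : ℕ) : ℝ) ^ (p + 2) := by
          rw [pow_add]; push_cast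
          have : (k : ℝ) ^ p ≤ ((l : ℝ) + 1) ^ p := pow_le_pow_left₀ hk0.le (by linarith) p
          gcongr
          nlinarith
        exact div_le_div_of_nonneg_left hC (by positivity) h4
      have h5 : 2 * C / (k : ℝ) ^ p = 2 * (C / (k : ℝ) ^ p) := by ring
      rw [h5] at ih ⊢
      linarith
  refine key.trans ?_
  have h1 : (k : ℝ)⁻¹ ≤ 1 := inv_le_one_of_one_le₀ (by exact_mod_cast hk)
  have h2 : 0 ≤ (l : ℝ)⁻¹ := by positivity
  have : 0 ≤ 2 * C / (k : ℝ) ^ p := by positivity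
  calc _ ≤ 2 * C / (k : ℝ) ^ p * 1 := by gcongr; linarith
    _ = _ := mul_one _

theorem IsBoundedCentered.abs_lagVariance_le [IsProbabilityMeasure μ]
    (h : IsBoundedCentered μ τ φ B) {C : ℝ} {ρ : ℕ → ℝ} (hC : 0 ≤ C)
    (hρ : ∀ k : ℕ, 1 ≤ k → ρ k ≤ C / (k : ℝ) ^ 2)
    (hcorr : ∀ j, 1 ≤ j → |∫ x, φ x * φ (τ^[j] x) ∂μ| ≤ ρ j) (k : ℕ) :
    |lagVariance μ τ φ k| ≤ B ^ 2 + 4 * C := by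
  have h0 : |∫ x, φ x ^ 2 ∂μ| ≤ B ^ 2 := by
    rw [abs_of_nonneg (integral_nonneg fun _ => sq_nonneg _)]; exact h.integral_sq_le
  rcases Nat.eq_zero_or_pos k with rfl | hk
  · simp only [lagVariance, Finset.range_zero, Finset.sum_empty, mul_zero, add_zero]
    linarith
  · have h1 := abs_lagVariance_sub_le (p := 0) (l := k) hC hρ hcorr le_rfl hk
    have h2 : |lagVariance μ τ φ 1| ≤ B ^ 2 + 2 * C := by
      simp only [lagVariance, Finset.sum_range_one]
      have h3 := (hcorr 1 le_rfl).trans (hρ 1 le_rfl)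
      have h4 := abs_add_le (∫ x, φ x ^ 2 ∂μ) (2 * ∫ x, φ x * φ (τ^[0 + 1] x) ∂μ)
      rw [abs_mul, abs_two] at h4
      simp at h3 h4 ⊢
      linarith
    have h5 := abs_add_le (lagVariance μ τ φ k - lagVariance μ τ φ 1) (lagVariance μ τ φ 1)
    rw [sub_add_cancel] at h5
    simp at h1
    linarith

/-- This is the gap between the true ratio `Λ = e^{-2y}` and the sacrificed ratio `w = e^{-y}`, with
`y = s²t²/4`; the error `ϑ` of the recurrence has to fit into it. -/
theorem exp_neg_two_mul_add_le {y : ℝ} (hy : 0 ≤ y) (hy1 : y ≤ 1 / 4) :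
    Real.exp (-(2 * y)) + y / 2 ≤ Real.exp (-y) := by
  have h1 : Real.exp (-(2 * y)) = Real.exp (-y) ^ 2 := by rw [← Real.exp_nat_mul]; congr 1; push_cast; ring
  have h2 : 1 - y ≤ Real.exp (-y) := by linarith [Real.add_one_le_exp (-y)]
  have h3 : Real.exp (-y) * (1 + y) ≤ 1 := by
    have := Real.add_one_le_exp y
    calc Real.exp (-y) * (1 + y) ≤ Real.exp (-y) * Real.exp y := by gcongr; linarith
      _ = 1 := by rw [← Real.exp_add]; simp
  rw [h1]
  have h4 : y * (3 / 4) ≤ 1 - Real.exp (-y) := by nlinarith [Real.exp_pos (-y)]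
  nlinarith [Real.exp_pos (-y)]

set_option maxHeartbeats 400000 in
/-- The characteristic function of `S_N` is close to that of a normal distribution. -/
theorem IsBoundedCentered.norm_sumCharFun_sub_exp_le [IsProbabilityMeasure μ]
    (h : IsBoundedCentered μ τ φ B) {L s t r tail : ℝ} {k R : ℕ} (hk : 1 ≤ k)
    (htk : |t| * k * B ≤ 1 / 2)
    (hdec : ∀ N m, ‖∫ x, cis (t * birkhoffSum τ φ N x) * blockProd τ φ t k m (τ^[N + k] x) ∂μ
      - sumCharFun μ τ φ t N * ∫ x, blockProd τ φ t k m x ∂μ‖ ≤ |t| * 2 ^ m * r)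
    (hB : B ^ 2 ≤ L) (hL : ∀ j, |lagVariance μ τ φ j| ≤ L)
    (htail : |lagVariance μ τ φ k - s ^ 2| ≤ tail) (hs : s ^ 2 ≤ L)
    {A th P : ℝ} (hA : A = 2 * L * t ^ 2 + 11 * |t| ^ 3 * k ^ 2 * B ^ 3)
    (hth : th = t ^ 2 / 2 * tail + 11 * |t| ^ 3 * k ^ 2 * B ^ 3 + (s ^ 2 * t ^ 2 / 2) ^ 2)
    (hP : P = ((R + 2 : ℕ) : ℝ) * k) (hAP : A * P ≤ 1)
    (hw : 2 * (th + A ^ 2 * P) ≤ s ^ 2 * t ^ 2 / 8) (hLt : 2 * (L * t ^ 2 * P) ≤ 1) (N : ℕ) :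
    ‖sumCharFun μ τ φ t N - (Real.exp (-(N * (s ^ 2 * t ^ 2 / 2))) : ℂ)‖ ≤
      (2 * (7 * P * L * t ^ 2) + 8 * (th + A ^ 2 * P) * N) * Real.exp (-(N * (s ^ 2 * t ^ 2 / 4)))
      + 4 * (N : ℝ) ^ 2 * (|t| * 2 ^ (R + 2) * r + (|t| * k * B) ^ (R + 2) * (|t| * B)) := by
  have hB0 := h.nonneg
  have hL0 : 0 ≤ L := (abs_nonneg _).trans (hL 0)
  have hk1 : (1 : ℝ) ≤ k := by exact_mod_cast hk
  have hP1 : 1 ≤ P := by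
    rw [hP]; push_cast
    nlinarith [show (0 : ℝ) ≤ R from Nat.cast_nonneg R]
  set y := s ^ 2 * t ^ 2 / 4 with hy
  have hy0 : 0 ≤ y := by positivity
  have hyL : 4 * y ≤ L * t ^ 2 := by
    rw [hy]; nlinarith [sq_nonneg t]
  have hyP : 2 * (4 * y * P) ≤ 1 := by nlinarith
  have hy1 : y ≤ 1 / 4 := by nlinarith
  have hyy : s ^ 2 * t ^ 2 / 2 = 2 * y := by rw [hy]; ring
  rw [hyy] at hth ⊢
  obtain ⟨c1, c2⟩ := h.coefficient_bounds hk htk R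
  have hrec := fun N hN => h.norm_sumCharFun_recurrence_le (ρ := fun m => |t| * 2 ^ m * r) hdec
    (R + 2) (N := N) hN
  have hr0 : 0 ≤ |t| * r := by simpa using (norm_nonneg _).trans (hdec 0 0)
  have hsum2 : ∑ m ∈ Finset.range (R + 2), |t| * 2 ^ m * r ≤ |t| * 2 ^ (R + 2) * r := by
    have : ∑ m ∈ Finset.range (R + 2), |t| * 2 ^ m * r
        = (∑ m ∈ Finset.range (R + 2), (2 : ℝ) ^ m) * (|t| * r) := by
      rw [Finset.sum_mul]; exact Finset.sum_congr rfl fun _ _ => by ring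
    rw [this, geom_sum_eq (by norm_num)]
    norm_num
    nlinarith [pow_pos (two_pos : (0 : ℝ) < 2) (R + 2)]
  have hPc : (((R + 2 : ℕ) : ℝ) * (k : ℝ)) = P := hP.symm
  have hΛ : (Real.exp (-(N * (2 * y))) : ℂ) = ((Real.exp (-(2 * y)) : ℝ) : ℂ) ^ N := by
    rw [← Complex.ofReal_pow, ← Real.exp_nat_mul, mul_neg]
  have hwN : Real.exp (-(N * y)) = Real.exp (-y) ^ N := by
    rw [← Real.exp_nat_mul]; ring_nf
  have hPnat : 1 ≤ (R + 2) * k := by nlinarith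
  have hmain := norm_sub_pow_le_of_delayed_recurrence (ψ := sumCharFun μ τ φ t)
    (a := fun m => ∫ x, blockProd τ φ t k m x ∂μ) (R := R + 2) (k := k)
    (Λ := Real.exp (-(2 * y))) (w := Real.exp (-y)) (A := A) (th := th) (b := 7 * P * L * t ^ 2)
    (τ := |t| * 2 ^ (R + 2) * r + (|t| * k * B) ^ (R + 2) * (|t| * B))
    (norm_sumCharFun_le_one t) (fun N hN => (hrec N hN).trans (by gcongr)) ?_ ?_ ?_
    (Real.exp_pos _).le ?_ ?_ ?_ ?_ ?_ N
  · rw [hPc] at hmain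
    rw [hΛ, hwN]
    exact hmain
  · refine c2.trans ?_
    rw [hA]
    have h1 := h.integral_sq_le
    have h2 := hL k
    have : t ^ 2 * (∫ x, φ x ^ 2 ∂μ + |lagVariance μ τ φ k|) ≤ t ^ 2 * (L + L) := by
      gcongr; linarith
    linarith
  -- Three errors make up `th`: the third-order remainder of the coefficients, the truncation of the
  -- variance at lag `k`, and the quadratic remainder of the exponential.
  · have h1 : |Real.exp (-(2 * y)) - 1 - (-(2 * y))| ≤ (-(2 * y)) ^ 2 :=
      Real.abs_exp_sub_one_sub_id_le (by rw [abs_neg, abs_of_nonneg (by positivity)]; linarith)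
    have e : 1 + ∑ m ∈ Finset.range (R + 2), ∫ x, blockProd τ φ t k m x ∂μ
        - ((Real.exp (-(2 * y)) : ℝ) : ℂ)
        = (∑ m ∈ Finset.range (R + 2), ∫ x, blockProd τ φ t k m x ∂μ
          + ((t ^ 2 / 2 * lagVariance μ τ φ k : ℝ) : ℂ))
          - ((t ^ 2 / 2 * (lagVariance μ τ φ k - s ^ 2) : ℝ) : ℂ)
          - ((Real.exp (-(2 * y)) - 1 - (-(2 * y)) : ℝ) : ℂ) := by
      rw [hy]; push_cast; ring
    rw [e, hth]
    refine (norm_sub_le _ _).trans ?_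
    have h2 := norm_sub_le (∑ m ∈ Finset.range (R + 2), ∫ x, blockProd τ φ t k m x ∂μ
          + ((t ^ 2 / 2 * lagVariance μ τ φ k : ℝ) : ℂ))
          ((t ^ 2 / 2 * (lagVariance μ τ φ k - s ^ 2) : ℝ) : ℂ)
    rw [Complex.norm_real, Real.norm_eq_abs, abs_mul, abs_of_nonneg (by positivity)] at h2
    rw [Complex.norm_real, Real.norm_eq_abs]
    have h3 : t ^ 2 / 2 * |lagVariance μ τ φ k - s ^ 2| ≤ t ^ 2 / 2 * tail := by gcongr
    linarith
  · rwa [hPc]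
  · rw [hPc]
    have := exp_neg_two_mul_add_le hy0 hy1
    have h3 : s ^ 2 * t ^ 2 / 8 = y / 2 := by rw [hy]; ring
    linarith
  · exact Real.exp_le_one_iff.2 (by linarith)
  · have := Real.add_one_le_exp (-y); linarith
  · rw [← Real.exp_nat_mul]
    have := Real.add_one_le_exp (((2 * ((R + 2) * k) : ℕ) : ℝ) * -y)
    have e : ((2 * ((R + 2) * k) : ℕ) : ℝ) = 2 * P := by rw [hP]; push_cast; ring
    rw [e] at this ⊢
    nlinarith
  -- Over the initial window both quantities are close to 1: the characteristic function within
  -- `6PLt²` by the variance bound, the exponential within `PLt²`, whence 7.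
  · intro N hN
    have hNP : (N : ℝ) ≤ 2 * P := by
      rw [hP]; exact_mod_cast hN
    have h1 := h.norm_sumCharFun_sub_one_le t N
    rw [h.integral_sq_birkhoffSum] at h1
    have h2 : ∑ i ∈ Finset.range N, lagVariance μ τ φ i ≤ 2 * P * L := by
      calc _ ≤ ∑ i ∈ Finset.range N, L := Finset.sum_le_sum fun i _ => le_of_abs_le (hL i)
        _ = N * L := by simp
        _ ≤ _ := by gcongr
    have h3 : ‖(1 : ℂ) - ((Real.exp (-(2 * y)) : ℝ) : ℂ) ^ N‖ ≤ P * L * t ^ 2 := by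
      rw [← Complex.ofReal_pow, ← Complex.ofReal_one, ← Complex.ofReal_sub, Complex.norm_real,
        ← Real.exp_nat_mul, Real.norm_of_nonneg]
      · have := Real.add_one_le_exp ((N : ℝ) * -(2 * y))
        have h5 : (N : ℝ) * (2 * y) ≤ 2 * P * (2 * y) := by gcongr
        nlinarith
      · have : Real.exp ((N : ℝ) * -(2 * y)) ≤ 1 := Real.exp_le_one_iff.2 (by
          have : 0 ≤ (N : ℝ) * (2 * y) := by positivity
          linarith)
        linarith
    have e : sumCharFun μ τ φ t N - ((Real.exp (-(2 * y)) : ℝ) : ℂ) ^ N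
        = (sumCharFun μ τ φ t N - 1) + (1 - ((Real.exp (-(2 * y)) : ℝ) : ℂ) ^ N) := by ring
    rw [e]
    refine (norm_add_le _ _).trans ?_
    have h4 : 3 * t ^ 2 * ∑ i ∈ Finset.range N, lagVariance μ τ φ i
        ≤ 3 * t ^ 2 * (2 * P * L) := by gcongr
    linarith

end CharFunEstimate

end RandomMaps

/-! ### Uniform constants for the characteristic function estimate. -/

namespace RandomMaps


section UniformEstimate

/-- A bounded centred observable with decay of correlations at rate `ρ`, in a form suited to the
recurrence for the characteristic functions of its Birkhoff sums. -/
structure HasDecorrelation {Ω : Type u} [MeasurableSpace Ω] (μ : Measure Ω) (τ : Ω → Ω)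
    (φ : Ω → ℝ) (B t₀ : ℝ) (ρ : ℕ → ℝ) : Prop extends IsBoundedCentered μ τ φ B where
  corr : ∀ j, 1 ≤ j → |∫ x, φ x * φ (τ^[j] x) ∂μ| ≤ ρ j
  decorr : ∀ t : ℝ, |t| ≤ t₀ → ∀ k, 1 ≤ k → ∀ N m,
    ‖∫ x, cis (t * birkhoffSum τ φ N x) * blockProd τ φ t k m (τ^[N + k] x) ∂μ
      - sumCharFun μ τ φ t N * ∫ x, blockProd τ φ t k m x ∂μ‖ ≤ |t| * 2 ^ m * ρ k

set_option maxHeartbeats 1000000 in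
-- The constants depend only on `B`, `t₀`, `s₀`, `ρ` and `p`, since the system is quantified after
-- them. The restriction `|t| k³ ≤ 1` makes every error term of the recurrence small compared with
-- `s₀² t²` once `k` is large.
theorem exists_charFun_bound {B t₀ s₀ : ℝ} {ρ : ℕ → ℝ} (hB : 0 ≤ B) (ht₀ : 0 < t₀) (hs₀ : 0 < s₀)
    (hρ : DecaysFast ρ) {p : ℕ} (hp : 1 ≤ p) :
    ∃ C : ℝ, 0 < C ∧ ∃ k₀ : ℕ, 1 ≤ k₀ ∧ ∀ {Ω : Type u} [MeasurableSpace Ω] {μ : Measure Ω}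
      [IsProbabilityMeasure μ] {τ : Ω → Ω} {φ : Ω → ℝ}, HasDecorrelation μ τ φ B t₀ ρ →
      ∀ s : ℝ, s₀ ≤ s → Tendsto (lagVariance μ τ φ) atTop (𝓝 (s ^ 2)) →
      ∀ k : ℕ, k₀ ≤ k → ∀ n : ℕ, (n : ℝ) ≤ (k : ℝ) ^ p → ∀ t : ℝ, |t| * (k : ℝ) ^ 3 ≤ 1 →
      ‖sumCharFun μ τ φ t n - (Real.exp (-(n * (s ^ 2 * t ^ 2 / 2))) : ℂ)‖ ≤
        C * (t ^ 2 * k + n * t ^ 2 / (k : ℝ) ^ p + n * |t| ^ 3 * k ^ 2) *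
          Real.exp (-(n * (s ^ 2 * t ^ 2 / 4))) + C * |t| / (k : ℝ) ^ p := by
  obtain ⟨C2, hC2, hρ2⟩ := hρ 2
  obtain ⟨Cp, hCp, hρp⟩ := hρ (p + 2)
  obtain ⟨Cq, hCq, hρq⟩ := hρ (3 * p)
  set L := B ^ 2 + 4 * C2 with hL
  have hL0 : 0 ≤ L := by positivity
  -- Both the decorrelation error and the leftover `(|t| k B)^{R+2}` become of order `k^{-3p}`; the
  -- factor `n² ≤ k^{2p}` from the recurrence still leaves `k^{-p}`.
  set R := 3 * p with hR
  set a := 2 * L + 11 * B ^ 3 with ha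
  have ha0 : 0 ≤ a := by positivity
  set R2 : ℝ := ((R + 2 : ℕ) : ℝ) with hR2
  have hR20 : 0 ≤ R2 := Nat.cast_nonneg _
  set C1 := Cp + 11 * B ^ 3 + L ^ 2 + a ^ 2 * R2 with hC1
  have hC10 : 0 ≤ C1 := by positivity
  set C := 14 * R2 * L + 8 * C1 + 4 * (2 ^ (R + 2) * Cq + B ^ (R + 3)) + 1 with hC
  -- Among these summands, `a * R2` serves `hAP`, `32 * C1 / s₀ ^ 2` serves `hw`, `2 * L * R2`
  -- serves `hLt`, `2 * B` serves `htB` and `1 / t₀` serves `htt₀`.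
  set kb := 1 + a * R2 + 32 * C1 / s₀ ^ 2 + L + 2 * L * R2 + 2 * B + 1 / t₀ with hkb
  refine ⟨C, by positivity, ⌈kb⌉₊ + 1, by omega, ?_⟩
  intro Ω _ μ _ τ φ h s hs hlim k hk n hn t ht
  have hkb' : kb ≤ k := (Nat.le_ceil kb).trans (by exact_mod_cast (by omega : ⌈kb⌉₊ ≤ k))
  have q1 : 0 ≤ a * R2 := by positivity
  have q2 : 0 ≤ 32 * C1 / s₀ ^ 2 := by positivity
  have q3 : 0 ≤ 2 * L * R2 := by positivity
  have q4 : 0 ≤ 1 / t₀ := by positivity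
  have k1 : (1 : ℝ) ≤ k := by linarith
  have hk1 : 1 ≤ k := by exact_mod_cast k1
  have hk0 : (0 : ℝ) < k := by linarith
  set x := |t| with hx
  have hx0 : 0 ≤ x := abs_nonneg t
  have hxt : t ^ 2 = x ^ 2 := (sq_abs t).symm
  have hxk2 : x * k ^ 2 ≤ 1 / k := by
    rw [le_div_iff₀ hk0]; calc _ = x * (k : ℝ) ^ 3 := by ring
      _ ≤ 1 := ht
  have hinv1 : 1 / (k : ℝ) ≤ 1 := by rw [div_le_one hk0]; exact k1
  have hxk2' : x * k ^ 2 ≤ 1 := hxk2.trans hinv1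
  have hkk : (k : ℝ) ≤ k ^ 2 := le_self_pow₀ k1 two_ne_zero
  have hxk : x * k ≤ 1 / k := (mul_le_mul_of_nonneg_left hkk hx0).trans hxk2
  have hxk' : x ≤ 1 / k := (le_mul_of_one_le_right hx0 k1).trans hxk
  have hx1 : x ≤ 1 := hxk'.trans hinv1
  have hcorr2 := h.toIsBoundedCentered.abs_lagVariance_le hC2 hρ2 h.corr
  have hsL : s ^ 2 ≤ L := le_of_tendsto hlim (Eventually.of_forall fun j => le_of_abs_le (hcorr2 j))
  have htail : |lagVariance μ τ φ k - s ^ 2| ≤ 2 * Cp / (k : ℝ) ^ p := by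
    rw [abs_sub_comm]
    refine le_of_tendsto ((hlim.sub_const _).abs) ?_
    filter_upwards [eventually_ge_atTop k] with l hl
    exact abs_lagVariance_sub_le hCp hρp h.corr hk1 hl
  have htB : x * k * B ≤ 1 / 2 := by
    have : x * k * B ≤ 1 / k * B := by gcongr
    refine this.trans ?_
    rw [div_mul_eq_mul_div, one_mul, div_le_iff₀ hk0]; linarith
  have htt₀ : x ≤ t₀ := by
    refine hxk'.trans ?_
    rw [div_le_iff₀ hk0]
    have : 1 / t₀ ≤ k := by linarith
    rw [div_le_iff₀ ht₀] at this; linarith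
  set A := 2 * L * t ^ 2 + 11 * |t| ^ 3 * k ^ 2 * B ^ 3 with hA
  set th := t ^ 2 / 2 * (2 * Cp / (k : ℝ) ^ p) + 11 * |t| ^ 3 * k ^ 2 * B ^ 3
    + (s ^ 2 * t ^ 2 / 2) ^ 2 with hth
  set P := ((R + 2 : ℕ) : ℝ) * k with hP
  have hA0 : 0 ≤ A := by positivity
  have hAx : A ≤ a * x ^ 2 := by
    rw [hA, ha, hxt, ← hx]
    have : x ^ 3 * k ^ 2 ≤ x ^ 2 := by
      calc x ^ 3 * k ^ 2 = x ^ 2 * (x * k ^ 2) := by ring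
        _ ≤ x ^ 2 * 1 := by gcongr
        _ = x ^ 2 := mul_one _
    have h3 : 11 * B ^ 3 * (x ^ 3 * k ^ 2) ≤ 11 * B ^ 3 * x ^ 2 := by gcongr
    linarith
  have hx2k : x ^ 2 * k ≤ 1 / k := by
    calc x ^ 2 * k = x * (x * k) := by ring
      _ ≤ 1 * (1 / k) := by gcongr
      _ = _ := one_mul _
  have hAP : A * P ≤ 1 := by
    calc A * P ≤ a * x ^ 2 * (R2 * k) := by rw [hP]; gcongr
      _ = a * R2 * (x ^ 2 * k) := by ring
      _ ≤ a * R2 * (1 / k) := by gcongr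
      _ ≤ 1 := by rw [mul_one_div, div_le_one hk0]; linarith
  have hx4 : x ^ 4 * k ≤ x ^ 3 * k ^ 2 := by
    have h1 : x * k ≤ 1 * k ^ 2 := mul_le_mul hx1 hkk hk0.le zero_le_one
    calc x ^ 4 * k = x ^ 3 * (x * k) := by ring
      _ ≤ x ^ 3 * (1 * k ^ 2) := by gcongr
      _ = _ := by ring
  have hx4' : x ^ 4 ≤ x ^ 3 * k ^ 2 := 
    (le_mul_of_one_le_right (pow_nonneg hx0 4) k1).trans hx4
  have hϑ : th + A ^ 2 * P ≤ C1 * (x ^ 2 / (k : ℝ) ^ p + x ^ 3 * k ^ 2) := by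
    have e1 : t ^ 2 / 2 * (2 * Cp / (k : ℝ) ^ p) = Cp * (x ^ 2 / (k : ℝ) ^ p) := by
      rw [hxt]; ring
    have e2 : (s ^ 2 * t ^ 2 / 2) ^ 2 ≤ L ^ 2 * (x ^ 3 * k ^ 2) := by
      calc (s ^ 2 * t ^ 2 / 2) ^ 2 = (s ^ 2) ^ 2 * x ^ 4 / 4 := by rw [hxt]; ring
        _ ≤ L ^ 2 * x ^ 4 / 1 := by gcongr; norm_num
        _ = L ^ 2 * x ^ 4 := div_one _
        _ ≤ _ := by gcongr
    have e3 : A ^ 2 * P ≤ a ^ 2 * R2 * (x ^ 3 * k ^ 2) := by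
      calc A ^ 2 * P ≤ (a * x ^ 2) ^ 2 * (R2 * k) := by rw [hP]; gcongr
        _ = a ^ 2 * R2 * (x ^ 4 * k) := by ring
        _ ≤ _ := by gcongr
    have e4 : 0 ≤ x ^ 2 / (k : ℝ) ^ p := by positivity
    have e5 : 0 ≤ x ^ 3 * (k : ℝ) ^ 2 := by positivity
    have e6 : 0 ≤ (11 * B ^ 3 + L ^ 2 + a ^ 2 * R2) * (x ^ 2 / (k : ℝ) ^ p) := by positivity
    have e7 : 0 ≤ Cp * (x ^ 3 * (k : ℝ) ^ 2) := by positivity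
    rw [hth, e1, hC1, ← hx]
    linarith
  have hkp : (k : ℝ) ≤ (k : ℝ) ^ p := le_self_pow₀ k1 (by omega)
  have hϑ2 : th + A ^ 2 * P ≤ 2 * C1 * x ^ 2 / k := by
    have h1 : x ^ 2 / (k : ℝ) ^ p ≤ x ^ 2 / k := by gcongr
    have h2 : x ^ 3 * (k : ℝ) ^ 2 ≤ x ^ 2 / k := by
      calc x ^ 3 * (k : ℝ) ^ 2 = x ^ 2 * (x * k ^ 2) := by ring
        _ ≤ x ^ 2 * (1 / k) := by gcongr
        _ = _ := by ring
    calc _ ≤ C1 * (x ^ 2 / k + x ^ 2 / k) := hϑ.trans (by gcongr)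
      _ = _ := by ring
  have hw : 2 * (th + A ^ 2 * P) ≤ s ^ 2 * t ^ 2 / 8 := by
    have h1 : 32 * C1 / s₀ ^ 2 ≤ k := by linarith
    rw [div_le_iff₀ (by positivity)] at h1
    have h2 : s₀ ^ 2 ≤ s ^ 2 := by gcongr
    have h3 : 2 * C1 * x ^ 2 / k ≤ s₀ ^ 2 * x ^ 2 / 16 := by
      rw [div_le_div_iff₀ hk0 (by norm_num)]
      have h5 := mul_le_mul_of_nonneg_right h1 (sq_nonneg x)
      linarith
    rw [hxt]
    have h4 : s₀ ^ 2 * x ^ 2 ≤ s ^ 2 * x ^ 2 := by gcongr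
    linarith
  have hLt : 2 * (L * t ^ 2 * P) ≤ 1 := by
    calc 2 * (L * t ^ 2 * P) = 2 * L * R2 * (x ^ 2 * k) := by rw [hP, hxt]; ring
      _ ≤ 2 * L * R2 * (1 / k) := by gcongr
      _ ≤ 1 := by rw [mul_one_div, div_le_one hk0]; linarith
  have hmain := h.toIsBoundedCentered.norm_sumCharFun_sub_exp_le (R := R) (L := L) hk1 htB
    (h.decorr t htt₀ k hk1) (by linarith) hcorr2 htail hsL hA hth hP hAP hw hLt n
  refine hmain.trans (add_le_add ?_ ?_)
  · refine mul_le_mul_of_nonneg_right ?_ (Real.exp_pos _).le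
    have h1 : 2 * (7 * P * L * t ^ 2) = 14 * R2 * L * (t ^ 2 * k) := by rw [hP]; ring
    have h2 : 8 * (th + A ^ 2 * P) * n
        ≤ 8 * C1 * (n * t ^ 2 / (k : ℝ) ^ p + n * |t| ^ 3 * k ^ 2) := by
      calc _ ≤ 8 * (C1 * (x ^ 2 / (k : ℝ) ^ p + x ^ 3 * k ^ 2)) * n := by gcongr
        _ = _ := by rw [hxt]; ring
    have h3 : 0 ≤ t ^ 2 * k := by positivity
    have h4 : 0 ≤ n * t ^ 2 / (k : ℝ) ^ p + n * |t| ^ 3 * k ^ 2 := by positivity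
    have h5 : 14 * R2 * L ≤ C := by
      rw [hC]
      have : 0 ≤ 8 * C1 + 4 * (2 ^ (R + 2) * Cq + B ^ (R + 3)) := by positivity
      linarith
    have h6 : 8 * C1 ≤ C := by
      rw [hC]
      have : 0 ≤ 14 * R2 * L + 4 * (2 ^ (R + 2) * Cq + B ^ (R + 3)) := by positivity
      linarith
    have h7 := mul_le_mul_of_nonneg_right h5 h3
    have h8 := mul_le_mul_of_nonneg_right h6 h4
    rw [h1]
    linarith
  · have hkR : (x * k * B) ^ (R + 2) ≤ B ^ (R + 2) / (k : ℝ) ^ (3 * p) := by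
      calc (x * k * B) ^ (R + 2) = (x * k) ^ (R + 2) * B ^ (R + 2) := mul_pow _ _ _
        _ ≤ (1 / k) ^ (R + 2) * B ^ (R + 2) := by gcongr
        _ = B ^ (R + 2) / (k : ℝ) ^ (R + 2) := by rw [div_pow, one_pow]; ring
        _ ≤ B ^ (R + 2) / (k : ℝ) ^ (3 * p) := by
            gcongr
            omega
    have hn2 : (n : ℝ) ^ 2 ≤ (k : ℝ) ^ (2 * p) := by
      calc (n : ℝ) ^ 2 ≤ ((k : ℝ) ^ p) ^ 2 := by gcongr
        _ = _ := by rw [← pow_mul, mul_comm]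
    have h1 : x * 2 ^ (R + 2) * ρ k + (x * k * B) ^ (R + 2) * (x * B)
        ≤ x * (2 ^ (R + 2) * Cq + B ^ (R + 3)) / (k : ℝ) ^ (3 * p) := by
      calc _ ≤ x * 2 ^ (R + 2) * (Cq / (k : ℝ) ^ (3 * p))
            + B ^ (R + 2) / (k : ℝ) ^ (3 * p) * (x * B) := by
            gcongr
            exact hρq k hk1
        _ = _ := by ring
    have hpos : 0 ≤ x * (2 ^ (R + 2) * Cq + B ^ (R + 3)) / (k : ℝ) ^ (3 * p) := by positivity
    calc 4 * (n : ℝ) ^ 2 * (x * 2 ^ (R + 2) * ρ k + (x * k * B) ^ (R + 2) * (x * B))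
        ≤ 4 * (n : ℝ) ^ 2 *
          (x * (2 ^ (R + 2) * Cq + B ^ (R + 3)) / (k : ℝ) ^ (3 * p)) := by gcongr
      _ ≤ 4 * (k : ℝ) ^ (2 * p) *
          (x * (2 ^ (R + 2) * Cq + B ^ (R + 3)) / (k : ℝ) ^ (3 * p)) := by gcongr
      _ = 4 * (2 ^ (R + 2) * Cq + B ^ (R + 3)) * x / (k : ℝ) ^ p := by
          have e : (k : ℝ) ^ (3 * p) = (k : ℝ) ^ (2 * p) * (k : ℝ) ^ p := by
            rw [← pow_add]; congr 1; ring
          rw [e]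
          field_simp
      _ ≤ C * x / (k : ℝ) ^ p := by
          gcongr
          rw [hC]
          have : 0 ≤ 14 * R2 * L + 8 * C1 := by positivity
          linarith

end UniformEstimate

end RandomMaps

/-! ### Berry–Esseen bounds and convergence of characteristic functions. -/

namespace RandomMaps


section BerryEsseen

/-- Converts the polynomial-times-Gaussian error into the integrable profile `1/(1 + θ²)` required
by the smoothing inequality. -/
theorem poly_mul_exp_neg_le (x : ℝ) :
    (2 * x + x ^ 2) * Real.exp (-(x ^ 2 / 4)) ≤ 64 * (1 + x ^ 2)⁻¹ := by
  have h1 : 1 + x ^ 2 / 4 + (x ^ 2 / 4) ^ 2 / 2 ≤ Real.exp (x ^ 2 / 4) :=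
    Real.quadratic_le_exp_of_nonneg (by positivity)
  rw [Real.exp_neg, ← div_eq_mul_inv, ← div_eq_mul_inv, div_le_div_iff₀ (Real.exp_pos _)
    (by positivity)]
  have h2 : 2 * x + x ^ 2 ≤ 2 * (1 + x ^ 2) := by nlinarith [sq_nonneg (x - 1)]
  have h3 : (2 * x + x ^ 2) * (1 + x ^ 2) ≤ 2 * (1 + x ^ 2) * (1 + x ^ 2) := by gcongr
  nlinarith [sq_nonneg (x ^ 2)]

/-- The exponential series dominates `(c k²)^p`, and `k^{2p} ≥ k^p ≥ n`; Gaussian tails at height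
`k` are thus negligible. -/
theorem exp_neg_mul_sq_le_div {c k n : ℝ} {p : ℕ} (hc : 0 < c) (hk : 1 ≤ k) (hn : 0 < n)
    (hnk : n ≤ k ^ p) : Real.exp (-(c * k ^ 2)) ≤ p.factorial / c ^ p / n := by
  have hk0 : 0 < k := by linarith
  have h1 := Real.pow_div_factorial_le_exp (c * k ^ 2) (by positivity) p
  have h2 : c ^ p * n / p.factorial ≤ (c * k ^ 2) ^ p / p.factorial := by
    rw [mul_pow]
    gcongr
    exact hnk.trans (pow_le_pow_left₀ hk0.le (le_self_pow₀ hk two_ne_zero) p)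
  have h3 := h2.trans h1
  rw [Real.exp_neg, div_div, ← inv_div]
  exact inv_anti₀ (by positivity) h3

variable {Ω : Type*} [MeasurableSpace Ω] {μ : Measure Ω} {τ : Ω → Ω} {φ : Ω → ℝ} {B : ℝ}

theorem IsBoundedCentered.charFun_map [IsProbabilityMeasure μ] (h : IsBoundedCentered μ τ φ B)
    (n : ℕ) (c θ : ℝ) : charFun (μ.map fun x => c * birkhoffSum τ φ n x) θ
      = sumCharFun μ τ φ (θ * c) n := by
  have hm := (measurable_birkhoffSum h.measurePreserving.measurable h.measurable n).const_mul c
  rw [charFun_apply_real, integral_map hm.aemeasurable (by fun_prop), sumCharFun]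
  refine integral_congr_ae (Eventually.of_forall fun x => ?_)
  simp only [cis]
  congr 1
  push_cast
  ring

theorem charFun_gaussianReal_zero_one (θ : ℝ) :
    charFun (gaussianReal 0 1) θ = (Real.exp (-(θ ^ 2 / 2)) : ℂ) := by
  rw [charFun_gaussianReal]
  push_cast
  congr 1
  ring

set_option maxHeartbeats 1000000 in
/-- A Berry–Esseen estimate in terms of a free block length `k`. -/
theorem exists_blockLength_bound {B t₀ s₀ : ℝ} {ρ : ℕ → ℝ} (hB : 0 ≤ B) (ht₀ : 0 < t₀)
    (hs₀ : 0 < s₀) (hρ : DecaysFast ρ) {p : ℕ} (hp : 1 ≤ p) :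
    ∃ C : ℝ, 0 < C ∧ ∃ k₀ : ℕ, 1 ≤ k₀ ∧ ∀ {Ω : Type u} [MeasurableSpace Ω] {μ : Measure Ω}
      [IsProbabilityMeasure μ] {τ : Ω → Ω} {φ : Ω → ℝ}, HasDecorrelation μ τ φ B t₀ ρ →
      ∀ s : ℝ, s₀ ≤ s → Tendsto (lagVariance μ τ φ) atTop (𝓝 (s ^ 2)) →
      ∀ k : ℕ, k₀ ≤ k → ∀ n : ℕ, 1 ≤ n → (n : ℝ) ≤ (k : ℝ) ^ p → ∀ x : ℝ,
      |μ.real {z | birkhoffSum τ φ n z ≤ x * s * √(n : ℝ)} - normalCDF x| ≤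
        C * (k : ℝ) ^ 5 / √(n : ℝ) := by
  obtain ⟨C, hC, k₀, hk₀, hchar⟩ := exists_charFun_bound hB ht₀ hs₀ hρ hp
  set D : ℝ := 1 / s₀ ^ 2 + 1 / s₀ ^ 3 with hD
  have hD0 : 0 < D := by positivity
  set E1 : ℝ := p.factorial / (1 / 2) ^ p with hE1
  set E2 : ℝ := p.factorial / (s₀ ^ 2 / 2) ^ p with hE2
  have hE10 : 0 < E1 := by positivity
  have hE20 : 0 < E2 := by positivity
  refine ⟨2 + 2 * E1 + 64 * C * D * Real.pi + C / s₀ + 4 / s₀ * E2, by positivity, k₀, hk₀, ?_⟩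
  intro Ω _ μ _ τ φ h s hs hlim k hk n hn1 hn x
  have hs0 : 0 < s := hs₀.trans_le hs
  have hn0 : (1 : ℝ) ≤ n := by exact_mod_cast hn1
  have hk1 : (1 : ℝ) ≤ k := by exact_mod_cast hk₀.trans hk
  have hk0 : (0 : ℝ) < k := by linarith
  obtain ⟨q, hq⟩ : ∃ q : ℝ, q = √(n : ℝ) := ⟨_, rfl⟩
  have hqq : q ^ 2 = n := by rw [hq]; exact Real.sq_sqrt (by linarith)
  have hq1 : 1 ≤ q := by rw [hq]; exact Real.one_le_sqrt.2 hn0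
  have hq0 : 0 < q := by linarith
  have hqn : q ≤ n := by rw [← hqq]; nlinarith
  have hm : Measurable fun z => (s * q)⁻¹ * birkhoffSum τ φ n z :=
    (measurable_birkhoffSum h.measurePreserving.measurable h.measurable n).const_mul _
  have hprob : IsProbabilityMeasure (μ.map fun z => (s * q)⁻¹ * birkhoffSum τ φ n z) :=
    Measure.isProbabilityMeasure_map hm.aemeasurable
  have hint : Integrable (fun y : ℝ => y) (μ.map fun z => (s * q)⁻¹ * birkhoffSum τ φ n z) := by
    rw [integrable_map_measure (by fun_prop) hm.aemeasurable]
    exact (h.toIsBoundedCentered.integrable_birkhoffSum n).const_mul _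
  have hset : (μ.map fun z => (s * q)⁻¹ * birkhoffSum τ φ n z).real (Set.Iic x)
      = μ.real {z | birkhoffSum τ φ n z ≤ x * s * q} := by
    rw [map_measureReal_apply hm measurableSet_Iic]
    congr 1
    ext z
    simp only [Set.mem_preimage, Set.mem_Iic, Set.mem_ofPred_eq]
    rw [inv_mul_le_iff₀ (by positivity)]
    constructor <;> intro h' <;> linarith
  -- With `t = θ/(s√n)` this range is exactly `|t| k³ ≤ 1`.
  have hcf : ∀ θ : ℝ, |θ| ≤ s * q / k ^ 3 →
      ‖charFun (μ.map fun z => (s * q)⁻¹ * birkhoffSum τ φ n z) θ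
        - charFun (gaussianReal 0 1) θ‖
      ≤ |θ| * (64 * C * D * k ^ 2 / q * (1 + θ ^ 2)⁻¹ + C / (s₀ * n)) := by
    intro θ hθ
    rw [h.toIsBoundedCentered.charFun_map, charFun_gaussianReal_zero_one]
    obtain ⟨t, ht⟩ : ∃ t, t = θ * (s * q)⁻¹ := ⟨_, rfl⟩
    have habs : |t| = |θ| / (s * q) := by
      rw [ht, abs_mul, abs_of_pos (by positivity : 0 < (s * q)⁻¹)]; rfl
    have htk : |t| * (k : ℝ) ^ 3 ≤ 1 := by
      rw [habs, div_mul_eq_mul_div, div_le_one (by positivity)]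
      rwa [le_div_iff₀ (by positivity)] at hθ
    have hst : n * (s ^ 2 * t ^ 2) = θ ^ 2 := by
      rw [ht, ← hqq]; field_simp
    have key := hchar h s hs hlim k hk n hn t htk
    rw [show (n : ℝ) * (s ^ 2 * t ^ 2 / 2) = θ ^ 2 / 2 by rw [← hst]; ring,
      show (n : ℝ) * (s ^ 2 * t ^ 2 / 4) = |θ| ^ 2 / 4 by rw [sq_abs, ← hst]; ring] at key
    rw [← ht]
    refine key.trans ?_
    obtain ⟨y, hy⟩ : ∃ y, y = |θ| := ⟨_, rfl⟩
    rw [← hy] at habs ⊢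
    have hθy : θ ^ 2 = y ^ 2 := by rw [hy, sq_abs]
    have hy0 : 0 ≤ y := by rw [hy]; exact abs_nonneg _
    have ht2 : t ^ 2 = y ^ 2 / (s ^ 2 * n) := by
      rw [← sq_abs, habs, div_pow, mul_pow, hqq]
    have hs2 : 1 / s ^ 2 ≤ 1 / s₀ ^ 2 := by gcongr
    have hs3 : 1 / s ^ 3 ≤ 1 / s₀ ^ 3 := by gcongr
    have b1 : t ^ 2 * k ≤ 1 / s₀ ^ 2 * (k ^ 2 / q) * y ^ 2 := by
      calc t ^ 2 * k = 1 / s ^ 2 * (k / n) * y ^ 2 := by rw [ht2]; field_simp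
        _ ≤ 1 / s₀ ^ 2 * (k ^ 2 / q) * y ^ 2 := by
            have : (k : ℝ) / n ≤ k ^ 2 / q := by
              gcongr
              exact le_self_pow₀ hk1 two_ne_zero
            gcongr
    have b2 : n * t ^ 2 / (k : ℝ) ^ p ≤ 1 / s₀ ^ 2 * (k ^ 2 / q) * y ^ 2 := by
      calc n * t ^ 2 / (k : ℝ) ^ p = 1 / s ^ 2 * (1 / (k : ℝ) ^ p) * y ^ 2 := by
            rw [ht2]; field_simp
        _ ≤ 1 / s₀ ^ 2 * (k ^ 2 / q) * y ^ 2 := by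
            have : 1 / (k : ℝ) ^ p ≤ k ^ 2 / q := by
              refine div_le_div₀ (by positivity) (one_le_pow₀ hk1) hq0 (hqn.trans hn)
            gcongr
    have b3 : n * |t| ^ 3 * k ^ 2 ≤ 1 / s₀ ^ 3 * (k ^ 2 / q) * y ^ 3 := by
      calc n * |t| ^ 3 * k ^ 2 = 1 / s ^ 3 * (k ^ 2 / q) * y ^ 3 := by
            rw [habs, ← hqq]; field_simp
        _ ≤ _ := by gcongr
    have b4 : |t| / (k : ℝ) ^ p ≤ y * (1 / (s₀ * n)) := by
      calc |t| / (k : ℝ) ^ p = y * (1 / (s * q * (k : ℝ) ^ p)) := by rw [habs]; field_simp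
        _ ≤ _ := by
          have : s₀ * n ≤ s * q * (k : ℝ) ^ p := by
            calc s₀ * n ≤ s * n := by gcongr
              _ ≤ s * (1 * (k : ℝ) ^ p) := by rw [one_mul]; gcongr
              _ ≤ s * (q * (k : ℝ) ^ p) := by gcongr
              _ = _ := by ring
          gcongr
    have b5 : t ^ 2 * k + n * t ^ 2 / (k : ℝ) ^ p + n * |t| ^ 3 * k ^ 2
        ≤ D * (k ^ 2 / q) * y * (2 * y + y ^ 2) := by
      have c1 : 0 ≤ 1 / s₀ ^ 3 * (k ^ 2 / q) * (2 * y ^ 2) := by positivity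
      have c2 : 0 ≤ 1 / s₀ ^ 2 * (k ^ 2 / q) * y ^ 3 := by positivity
      rw [hD]
      linarith
    have b6 := poly_mul_exp_neg_le y
    calc _ ≤ C * (D * (k ^ 2 / q) * y * (2 * y + y ^ 2)) * Real.exp (-(y ^ 2 / 4))
          + C * (y * (1 / (s₀ * n))) := by
          rw [mul_div_assoc C]
          gcongr
      _ = C * D * (k ^ 2 / q) * y * ((2 * y + y ^ 2) * Real.exp (-(y ^ 2 / 4)))
          + C * (y * (1 / (s₀ * n))) := by ring
      _ ≤ C * D * (k ^ 2 / q) * y * (64 * (1 + y ^ 2)⁻¹) + C * (y * (1 / (s₀ * n))) := by gcongr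
      _ = _ := by rw [hθy]; ring
  -- The width `ε = k⁴/√n` is chosen so that `εT = sk`, which makes the Gaussian tail beyond `εT` at
  -- most of order `1/n`. The shift `εa` with `a = k` then gives the dominant term `k⁵/√n`.
  have hsmooth := abs_measureReal_Iic_sub_normalCDF_le
    (μ.map fun z => (s * q)⁻¹ * birkhoffSum τ φ n z) hint x (ε := k ^ 4 / q)
    (T := s * q / k ^ 3) (a := k) (by positivity) (by positivity) hk0.le (by positivity)
    (by positivity) hcf
  rw [hset] at hsmooth
  rw [← hq]
  refine hsmooth.trans ?_
  have hεT : (k : ℝ) ^ 4 / q * (s * q / k ^ 3) = s * k := by field_simp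
  rw [hεT]
  have hn' : (0 : ℝ) < n := by linarith
  have hk5 : (1 : ℝ) ≤ k ^ 5 := one_le_pow₀ hk1
  have hnq : 1 / (n : ℝ) ≤ k ^ 5 / q := div_le_div₀ (by positivity) hk5 hq0 hqn
  have f1 : 2 * ((k : ℝ) ^ 4 / q * k) = 2 * (k ^ 5 / q) := by ring
  have f2 : Real.exp (-(k : ℝ) ^ 2 / 2) ≤ E1 * (k ^ 5 / q) := by
    have := exp_neg_mul_sq_le_div (c := 1 / 2) (by norm_num) hk1 hn' hn
    rw [show -(k : ℝ) ^ 2 / 2 = -(1 / 2 * (k : ℝ) ^ 2) by ring]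
    refine this.trans ?_
    rw [← hE1, div_eq_mul_one_div]
    gcongr
  have f3 : 64 * C * D * k ^ 2 / q * Real.pi ≤ 64 * C * D * Real.pi * (k ^ 5 / q) := by
    calc _ = 64 * C * D * Real.pi * (k ^ 2 / q) := by ring
      _ ≤ _ := by
        gcongr
        norm_num
  have f4 : C / (s₀ * n) / (k ^ 4 / q) ≤ C / s₀ * (k ^ 5 / q) := by
    calc C / (s₀ * n) / (k ^ 4 / q) = C / s₀ * (1 / q / k ^ 4) := by
          rw [← hqq]; field_simp
      _ ≤ C / s₀ * (k ^ 5 / q) := by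
          have this1 : 1 / q / (k : ℝ) ^ 4 ≤ 1 / q :=
            div_le_self (by positivity) (one_le_pow₀ hk1)
          have this2 : 1 / q ≤ (k : ℝ) ^ 5 / q := by gcongr
          exact mul_le_mul_of_nonneg_left (this1.trans this2) (by positivity)
  have f5 : 4 / (s * k) * Real.exp (-(s * k) ^ 2 / 2) ≤ 4 / s₀ * E2 * (k ^ 5 / q) := by
    have h1 : Real.exp (-(s * k) ^ 2 / 2) ≤ E2 * (k ^ 5 / q) := by
      have := exp_neg_mul_sq_le_div (c := s₀ ^ 2 / 2) (by positivity) hk1 hn' hn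
      have h2 : Real.exp (-(s * k) ^ 2 / 2) ≤ Real.exp (-(s₀ ^ 2 / 2 * (k : ℝ) ^ 2)) := by
        apply Real.exp_le_exp.2
        have : s₀ ^ 2 * (k : ℝ) ^ 2 ≤ s ^ 2 * (k : ℝ) ^ 2 := by gcongr
        linarith
      refine h2.trans (this.trans ?_)
      rw [← hE2, div_eq_mul_one_div]
      gcongr
    have h2 : 4 / (s * k) ≤ 4 / s₀ := by
      gcongr
      calc s₀ ≤ s := hs
        _ ≤ s * k := le_mul_of_one_le_right hs0.le hk1
    calc _ ≤ 4 / s₀ * (E2 * (k ^ 5 / q)) := by gcongr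
      _ = _ := by ring
  have f6 : (2 + 2 * E1 + 64 * C * D * Real.pi + C / s₀ + 4 / s₀ * E2) * (k : ℝ) ^ 5 / q
      = 2 * (k ^ 5 / q) + 2 * (E1 * (k ^ 5 / q)) + (64 * C * D * Real.pi * (k ^ 5 / q)
        + C / s₀ * (k ^ 5 / q) + 4 / s₀ * E2 * (k ^ 5 / q)) := by ring
  rw [f6, f1]
  linarith

/-- The Berry–Esseen theorem for observables with fast decay of correlations. -/
theorem exists_berryEsseen_bound {B t₀ s₀ δ : ℝ} {ρ : ℕ → ℝ} (hB : 0 ≤ B) (ht₀ : 0 < t₀)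
    (hs₀ : 0 < s₀) (hδ : 0 < δ) (hρ : DecaysFast ρ) :
    ∃ C : ℝ, 0 < C ∧ ∀ {Ω : Type u} [MeasurableSpace Ω] {μ : Measure Ω}
      [IsProbabilityMeasure μ] {τ : Ω → Ω} {φ : Ω → ℝ}, HasDecorrelation μ τ φ B t₀ ρ →
      ∀ s : ℝ, s₀ ≤ s → Tendsto (lagVariance μ τ φ) atTop (𝓝 (s ^ 2)) →
      ∀ n : ℕ, 1 ≤ n → ∀ x : ℝ,
      |μ.real {z | birkhoffSum τ φ n z ≤ x * s * √(n : ℝ)} - normalCDF x| ≤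
        C * (n : ℝ) ^ (δ - 1 / 2) := by
  -- With `k` of order `n^{1/p}` the loss `k⁵` is of order `n^{5/p} ≤ n^δ`.
  obtain ⟨p, hp, hpδ⟩ : ∃ p : ℕ, 1 ≤ p ∧ 5 / (p : ℝ) ≤ δ := by
    refine ⟨⌈5 / δ⌉₊ + 1, by omega, ?_⟩
    have h1 := Nat.le_ceil (5 / δ)
    rw [div_le_iff₀ hδ] at h1
    push_cast
    rw [div_le_iff₀ (by positivity)]
    nlinarith
  obtain ⟨C, hC, k₀, hk₀, hmain⟩ := exists_blockLength_bound hB ht₀ hs₀ hρ hp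
  refine ⟨C * ((k₀ : ℝ) + 2) ^ 5, by positivity, ?_⟩
  intro Ω _ μ _ τ φ h s hs hlim n hn x
  have hn0 : (1 : ℝ) ≤ n := by exact_mod_cast hn
  have hnpos : (0 : ℝ) < n := by linarith
  have hp0 : (0 : ℝ) < p := by exact_mod_cast hp
  obtain ⟨r, hr⟩ : ∃ r : ℝ, r = (n : ℝ) ^ (1 / (p : ℝ)) := ⟨_, rfl⟩
  have hr1 : 1 ≤ r := by rw [hr]; exact Real.one_le_rpow hn0 (by positivity)
  have hrp : r ^ p = n := by
    rw [hr, one_div, Real.rpow_inv_natCast_pow hnpos.le (by omega)]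
  set k := k₀ + ⌈r⌉₊ with hk
  have hrk : r ≤ k := (Nat.le_ceil r).trans (by rw [hk]; push_cast; linarith [Nat.cast_nonneg (α := ℝ) k₀])
  have hkr : (k : ℝ) ≤ (k₀ + 2) * r := by
    have := (Nat.ceil_lt_add_one (by linarith : 0 ≤ r)).le
    rw [hk]; push_cast
    nlinarith [Nat.cast_nonneg (α := ℝ) k₀]
  refine (hmain h s hs hlim k (by omega) n hn ?_ x).trans ?_
  · rw [← hrp]; exact pow_le_pow_left₀ (by linarith) hrk p
  · have h5 : r ^ 5 ≤ (n : ℝ) ^ δ := by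
      rw [hr, ← Real.rpow_natCast, ← Real.rpow_mul hnpos.le]
      refine Real.rpow_le_rpow_of_exponent_le hn0 (le_trans (le_of_eq ?_) hpδ)
      push_cast; ring
    have h6 : (k : ℝ) ^ 5 ≤ ((k₀ : ℝ) + 2) ^ 5 * (n : ℝ) ^ δ := by
      calc (k : ℝ) ^ 5 ≤ (((k₀ : ℝ) + 2) * r) ^ 5 := by gcongr
        _ = ((k₀ : ℝ) + 2) ^ 5 * r ^ 5 := mul_pow _ _ _
        _ ≤ _ := by gcongr
    rw [Real.rpow_sub hnpos, ← Real.sqrt_eq_rpow]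
    calc C * (k : ℝ) ^ 5 / √(n : ℝ) ≤ C * (((k₀ : ℝ) + 2) ^ 5 * (n : ℝ) ^ δ) / √(n : ℝ) := by
          gcongr
      _ = _ := by ring

/-- The characteristic functions of the normalized sums converge. -/
theorem HasDecorrelation.tendsto_sumCharFun {Ω : Type u} [MeasurableSpace Ω] {μ : Measure Ω}
    [IsProbabilityMeasure μ] {τ : Ω → Ω} {φ : Ω → ℝ} {B t₀ s : ℝ} {ρ : ℕ → ℝ} (ht₀ : 0 < t₀)
    (hρ : DecaysFast ρ) (h : HasDecorrelation μ τ φ B t₀ ρ) (hs : 0 < s)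
    (hlim : Tendsto (lagVariance μ τ φ) atTop (𝓝 (s ^ 2))) (θ : ℝ) :
    Tendsto (fun n : ℕ => sumCharFun μ τ φ (θ * (√(n : ℝ))⁻¹) n) atTop
      (𝓝 (Real.exp (-(s ^ 2 * θ ^ 2 / 2)) : ℂ)) := by
  -- For fixed `θ` and `t = θ/√n`, block lengths of order `n^{1/8}` keep `|t| k³` below 1 eventually
  -- and make all error terms `O(1/k)`.
  obtain ⟨C, hC, k₀, hk₀, hchar⟩ := exists_charFun_bound h.toIsBoundedCentered.nonneg ht₀ hs hρ
    (p := 8) (by norm_num)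
  rw [tendsto_iff_norm_sub_tendsto_zero]
  obtain ⟨k, hk⟩ : ∃ k : ℕ → ℕ, k = fun n : ℕ => ⌈(n : ℝ) ^ (1 / 8 : ℝ)⌉₊ := ⟨_, rfl⟩
  have hle : ∀ n : ℕ, (n : ℝ) ^ (1 / 8 : ℝ) ≤ k n := fun n => by rw [hk]; exact Nat.le_ceil _
  have hpow : Tendsto (fun n : ℕ => (n : ℝ) ^ (1 / 8 : ℝ)) atTop atTop :=
    (tendsto_rpow_atTop (by norm_num)).comp tendsto_natCast_atTop_atTop
  have hktop : Tendsto k atTop atTop := by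
    rw [← tendsto_natCast_atTop_iff (R := ℝ)]
    exact tendsto_atTop_mono hle hpow
  have hkinv : Tendsto (fun n => ((k n : ℝ))⁻¹) atTop (𝓝 0) :=
    tendsto_inv_atTop_zero.comp (tendsto_natCast_atTop_iff.2 hktop)
  have hbound : Tendsto (fun n => C * (16 * θ ^ 2 + θ ^ 2 + 16 * |θ| ^ 3 + |θ|) * ((k n : ℝ))⁻¹)
      atTop (𝓝 0) := by simpa using hkinv.const_mul _
  refine squeeze_zero' (Eventually.of_forall fun _ => norm_nonneg _) ?_ hbound
  have hev : ∀ᶠ n : ℕ in atTop, 8 * |θ| ≤ (n : ℝ) ^ (1 / 8 : ℝ) := hpow.eventually_ge_atTop _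
  filter_upwards [hktop.eventually_ge_atTop k₀, eventually_ge_atTop 1, hev] with n hkn hn1 hθ
  have hn0 : (1 : ℝ) ≤ n := by exact_mod_cast hn1
  obtain ⟨r, hr⟩ : ∃ r : ℝ, r = (n : ℝ) ^ (1 / 8 : ℝ) := ⟨_, rfl⟩
  have hr1 : 1 ≤ r := by rw [hr]; exact Real.one_le_rpow hn0 (by norm_num)
  have hr8 : r ^ 8 = n := by
    rw [hr, ← Real.rpow_natCast, ← Real.rpow_mul (by linarith)]; norm_num
  have hsq : √(n : ℝ) = r ^ 4 := by
    rw [← hr8, show r ^ 8 = (r ^ 4) ^ 2 by ring, Real.sqrt_sq (by positivity)]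
  have hkr : r ≤ k n := hr ▸ hle n
  have hkr2 : (k n : ℝ) ≤ 2 * r := by
    have h1 : k n = ⌈r⌉₊ := by rw [hk, hr]
    have := (Nat.ceil_lt_add_one (by linarith : 0 ≤ r)).le
    rw [h1]; linarith
  have hr0 : 0 < r := by linarith
  have hK0 : (0 : ℝ) < k n := by linarith
  rw [hsq]
  have habs : |θ * (r ^ 4)⁻¹| = |θ| / r ^ 4 := by
    rw [abs_mul, abs_of_pos (by positivity : 0 < (r ^ 4)⁻¹)]; rfl
  have key := hchar h s le_rfl hlim (k n) hkn n (by rw [← hr8]; gcongr) (θ * (r ^ 4)⁻¹) (by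
    rw [habs]
    rw [← hr] at hθ
    calc |θ| / r ^ 4 * (k n : ℝ) ^ 3 ≤ |θ| / r ^ 4 * (2 * r) ^ 3 := by gcongr
      _ = 8 * |θ| / r := by field_simp; ring
      _ ≤ 1 := by rw [div_le_one hr0]; exact hθ)
  have e1 : (n : ℝ) * (s ^ 2 * (θ * (r ^ 4)⁻¹) ^ 2 / 2) = s ^ 2 * θ ^ 2 / 2 := by
    rw [← hr8]; field_simp
  rw [e1, habs] at key
  refine key.trans ?_
  have hexp : Real.exp (-(n * (s ^ 2 * (θ * (r ^ 4)⁻¹) ^ 2 / 4))) ≤ 1 :=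
    Real.exp_le_one_iff.2 (by
      have : 0 ≤ (n : ℝ) * (s ^ 2 * (θ * (r ^ 4)⁻¹) ^ 2 / 4) := by positivity
      linarith)
  have i1 : 1 / r ≤ 2 * (k n : ℝ)⁻¹ := by
    rw [← div_eq_mul_inv, div_le_div_iff₀ hr0 hK0]; linarith
  have i0 : (1 : ℝ) / (k n : ℝ) ^ 8 ≤ (k n : ℝ)⁻¹ := by
    rw [one_div]
    exact inv_anti₀ hK0 (le_self_pow₀ (by linarith) (by norm_num))
  have g1 : (θ * (r ^ 4)⁻¹) ^ 2 * k n ≤ θ ^ 2 * (16 * (k n : ℝ)⁻¹) := by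
    calc (θ * (r ^ 4)⁻¹) ^ 2 * k n ≤ (θ * (r ^ 4)⁻¹) ^ 2 * (2 * r) := by gcongr
      _ = θ ^ 2 * (2 * (1 / r ^ 7)) := by field_simp
      _ ≤ θ ^ 2 * (2 * (1 / r)) := by
          gcongr
          exact le_self_pow₀ hr1 (by norm_num)
      _ ≤ θ ^ 2 * (16 * (k n : ℝ)⁻¹) := by
          gcongr θ ^ 2 * ?_
          have : 0 ≤ (k n : ℝ)⁻¹ := by positivity
          linarith
  have g2 : n * (θ * (r ^ 4)⁻¹) ^ 2 / (k n : ℝ) ^ 8 ≤ θ ^ 2 * (k n : ℝ)⁻¹ := by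
    calc n * (θ * (r ^ 4)⁻¹) ^ 2 / (k n : ℝ) ^ 8 = θ ^ 2 * (1 / (k n : ℝ) ^ 8) := by
          rw [← hr8]; field_simp
      _ ≤ _ := by gcongr
  have g3 : n * (|θ| / r ^ 4) ^ 3 * (k n : ℝ) ^ 2 ≤ |θ| ^ 3 * (16 * (k n : ℝ)⁻¹) := by
    calc n * (|θ| / r ^ 4) ^ 3 * (k n : ℝ) ^ 2 ≤ n * (|θ| / r ^ 4) ^ 3 * (2 * r) ^ 2 := by gcongr
      _ = |θ| ^ 3 * (4 * (1 / r ^ 2)) := by rw [← hr8]; field_simp; ring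
      _ ≤ |θ| ^ 3 * (4 * (1 / r)) := by
          gcongr
          exact le_self_pow₀ hr1 (by norm_num)
      _ ≤ _ := by
          gcongr |θ| ^ 3 * ?_
          have : 0 ≤ (k n : ℝ)⁻¹ := by positivity
          linarith
  have g4 : C * (|θ| / r ^ 4) / (k n : ℝ) ^ 8 ≤ C * (|θ| * (k n : ℝ)⁻¹) := by
    calc C * (|θ| / r ^ 4) / (k n : ℝ) ^ 8 = C * (|θ| / r ^ 4 * (1 / (k n : ℝ) ^ 8)) := by ring
      _ ≤ C * (|θ| * (k n : ℝ)⁻¹) := by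
          gcongr
          exact div_le_self (abs_nonneg _) (one_le_pow₀ hr1)
  calc _ ≤ C * (θ ^ 2 * (16 * (k n : ℝ)⁻¹) + θ ^ 2 * (k n : ℝ)⁻¹
        + |θ| ^ 3 * (16 * (k n : ℝ)⁻¹)) * 1 + C * (|θ| * (k n : ℝ)⁻¹) := by gcongr
    _ = _ := by ring

end BerryEsseen

end RandomMaps

/-! ### Asymptotic variance and coboundaries. -/

namespace RandomMaps

section AsymptoticCentre

variable {H : Type*} [NormedAddCommGroup H] [InnerProductSpace ℝ H]

theorem norm_midpoint_sub_sq (c d x : H) :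
    ‖(1 / 2 : ℝ) • (c + d) - x‖ ^ 2
      = (‖c - x‖ ^ 2 + ‖d - x‖ ^ 2) / 2 - ‖c - d‖ ^ 2 / 4 := by
  have h1 : (1 / 2 : ℝ) • (c + d) - x = (1 / 2 : ℝ) • ((c - x) + (d - x)) := by
    module
  have h2 := parallelogram_law_with_norm ℝ (c - x) (d - x)
  rw [sub_sub_sub_cancel_right] at h2
  rw [h1, norm_smul, mul_pow]
  norm_num
  nlinarith

/-- A nonexpansive map of a Hilbert space with a bounded orbit has a fixed point. -/
theorem exists_fixedPoint_of_bounded_orbit [CompleteSpace H] {A : H → H} (hA : ∀ x y, ‖A x - A y‖ ≤ ‖x - y‖)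
    {x : ℕ → H} (hx : ∀ n, x (n + 1) = A (x n)) {b : ℝ} (hb : ∀ n, ‖x n‖ ≤ b) :
    ∃ c, A c = c := by
  -- The fixed point is the asymptotic centre of the orbit: `E` collects the squared radii of balls
  -- which eventually contain it.
  set E : Set ℝ := {R | ∃ c : H, ∀ᶠ n in atTop, ‖c - x n‖ ^ 2 ≤ R} with hE
  have hEne : E.Nonempty := ⟨b ^ 2, 0, Eventually.of_forall fun n => by
    rw [zero_sub, norm_neg]
    exact pow_le_pow_left₀ (norm_nonneg _) (hb n) 2⟩
  have hEbdd : BddBelow E := by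
    refine ⟨0, ?_⟩
    rintro R ⟨c, hc⟩
    obtain ⟨n, hn⟩ := hc.exists
    exact (sq_nonneg _).trans hn
  set R₀ := sInf E with hR₀
  -- By the parallelogram law the midpoint of two nearly optimal centres gains `‖c - d‖²/4`, which
  -- the minimality of `R₀` limits.
  have hclose : ∀ c d : H, ∀ δ ε : ℝ, (∀ᶠ n in atTop, ‖c - x n‖ ^ 2 ≤ R₀ + δ) →
      (∀ᶠ n in atTop, ‖d - x n‖ ^ 2 ≤ R₀ + ε) → ‖c - d‖ ^ 2 ≤ 2 * (δ + ε) := by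
    intro c d δ ε hc hd
    have : R₀ + (δ + ε) / 2 - ‖c - d‖ ^ 2 / 4 ∈ E := by
      refine ⟨(1 / 2 : ℝ) • (c + d), ?_⟩
      filter_upwards [hc, hd] with n h1 h2
      rw [norm_midpoint_sub_sq]
      linarith
    have := csInf_le hEbdd this
    rw [← hR₀] at this
    linarith
  have hex : ∀ j : ℕ, ∃ c : H, ∀ᶠ n in atTop, ‖c - x n‖ ^ 2 ≤ R₀ + 1 / ((j : ℝ) + 1) := by
    intro j
    obtain ⟨R, ⟨c, hc⟩, hR⟩ := Real.lt_sInf_add_pos hEne (Nat.one_div_pos_of_nat (n := j) (α := ℝ))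
    exact ⟨c, hc.mono fun n hn => hn.trans hR.le⟩
  choose c hc using hex
  -- A nonexpansive map carries the orbit to its own shift, so `A (c j)` is as good a centre as `c
  -- j` and hence close to it.
  have hAc : ∀ j, ∀ᶠ n in atTop, ‖A (c j) - x n‖ ^ 2 ≤ R₀ + 1 / ((j : ℝ) + 1) := by
    intro j
    obtain ⟨N, hN⟩ := eventually_atTop.1 (hc j)
    refine eventually_atTop.2 ⟨N + 1, fun n hn => ?_⟩
    obtain ⟨n, rfl⟩ : ∃ k, n = k + 1 := ⟨n - 1, by omega⟩
    rw [hx]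
    exact (pow_le_pow_left₀ (norm_nonneg _) (hA _ _) 2).trans (hN n (by omega))
  have hlim : Tendsto (fun j : ℕ => 1 / ((j : ℝ) + 1)) atTop (𝓝 0) :=
    tendsto_one_div_add_atTop_nhds_zero_nat
  have hcauchy : CauchySeq c := by
    refine Metric.cauchySeq_iff'.2 fun ε hε => ?_
    obtain ⟨N, hN⟩ := (hlim.eventually (gt_mem_nhds (show 0 < ε ^ 2 / 4 by positivity))).exists
    refine ⟨N, fun n hn => ?_⟩
    have h1 := hclose _ _ _ _ (hc n) (hc N)
    have h2 : 1 / ((n : ℝ) + 1) ≤ 1 / ((N : ℝ) + 1) := by gcongr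
    rw [dist_eq_norm]
    exact lt_of_pow_lt_pow_left₀ 2 hε.le (by linarith)
  obtain ⟨z, hz⟩ := cauchySeq_tendsto_of_complete hcauchy
  have hAcont : Continuous A :=
    (LipschitzWith.of_dist_le_mul (K := 1) fun a b => by simpa [dist_eq_norm] using hA a b).continuous
  have hd : Tendsto (fun j => ‖A (c j) - c j‖ ^ 2) atTop (𝓝 (‖A z - z‖ ^ 2)) :=
    ((((hAcont.tendsto z).comp hz).sub hz).norm).pow 2
  have h0 : ‖A z - z‖ ^ 2 ≤ 0 := by
    have hl : Tendsto (fun j : ℕ => 2 * (1 / ((j : ℝ) + 1) + 1 / ((j : ℝ) + 1))) atTop (𝓝 0) := by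
      simpa using (hlim.add hlim).const_mul 2
    exact le_of_tendsto_of_tendsto' hd hl fun j => hclose _ _ _ _ (hAc j) (hc j)
  refine ⟨z, ?_⟩
  have : ‖A z - z‖ = 0 := by
    have := sq_nonneg ‖A z - z‖
    exact pow_eq_zero_iff two_ne_zero |>.1 (by linarith)
  exact sub_eq_zero.1 (norm_eq_zero.1 this)

end AsymptoticCentre

section Variance

variable {Ω : Type*} [MeasurableSpace Ω] {μ : Measure Ω} {τ : Ω → Ω} {φ : Ω → ℝ}
  {B : ℝ}

theorem toReal_eLpNorm_two {f : Ω → ℝ} (hf : AEStronglyMeasurable f μ) :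
    (eLpNorm f 2 μ).toReal = √(∫ x, f x ^ 2 ∂μ) := by
  rw [toReal_eLpNorm hf]
  rw [lpNorm_eq_integral_norm_rpow_toReal (by norm_num) (by norm_num) hf]
  rw [Real.sqrt_eq_rpow]
  norm_num

/-- The normalized sums of a coboundary tend to zero in `L²`. -/
theorem tendsto_eLpNorm_of_coboundary (hτ : MeasurePreserving τ μ μ) {r : Ω → ℝ}
    (hr : MemLp r 2 μ) (hφ : φ =ᵐ[μ] fun x => r (τ x) - r x) :
    Tendsto (fun n : ℕ => (√(n : ℝ))⁻¹ * (eLpNorm (birkhoffSum τ φ n) 2 μ).toReal) atTop (𝓝 0) := by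
  have hS : ∀ n, birkhoffSum τ φ n =ᵐ[μ] (r ∘ τ^[n]) - r := by
    intro n
    induction n with
    | zero => exact Eventually.of_forall fun x => by simp
    | succ n ih =>
      have h2 := hτ.quasiMeasurePreserving.ae_eq_comp ih
      filter_upwards [hφ, h2] with x e1 e2
      rw [birkhoffSum_succ', e1]
      simp only [Function.comp, Pi.sub_apply] at e2 ⊢
      rw [e2, Function.iterate_succ_apply]
      ring
  have hb : ∀ n, (eLpNorm (birkhoffSum τ φ n) 2 μ).toReal ≤ 2 * (eLpNorm r 2 μ).toReal := by
    intro n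
    have h1 : eLpNorm (birkhoffSum τ φ n) 2 μ ≤ eLpNorm r 2 μ + eLpNorm r 2 μ := by
      rw [eLpNorm_congr_ae (hS n)]
      refine (eLpNorm_sub_le (hr.1.comp_measurePreserving (hτ.iterate n)) hr.1
        (by norm_num)).trans ?_
      rw [eLpNorm_comp_measurePreserving hr.1 (hτ.iterate n)]
    have h2 := ENNReal.toReal_mono (by simp [hr.2.ne]) h1
    rw [ENNReal.toReal_add hr.2.ne hr.2.ne] at h2
    linarith
  have hl : Tendsto (fun n : ℕ => (√(n : ℝ))⁻¹ * (2 * (eLpNorm r 2 μ).toReal)) atTop (𝓝 0) := by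
    have : Tendsto (fun n : ℕ => (√(n : ℝ))⁻¹) atTop (𝓝 0) :=
      tendsto_inv_atTop_zero.comp (Real.tendsto_sqrt_atTop.comp tendsto_natCast_atTop_atTop)
    simpa using this.mul_const (2 * (eLpNorm r 2 μ).toReal)
  exact squeeze_zero (fun n => by positivity)
    (fun n => mul_le_mul_of_nonneg_left (hb n) (by positivity)) hl

variable [IsProbabilityMeasure μ]

theorem IsBoundedCentered.memLp_birkhoffSum (h : IsBoundedCentered μ τ φ B) (n : ℕ) :
    MemLp (birkhoffSum τ φ n) 2 μ :=
  MemLp.of_bound (measurable_birkhoffSum h.measurePreserving.measurable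
    h.measurable n).aestronglyMeasurable (n * B)
    (Eventually.of_forall fun x => abs_birkhoffSum_le h.bound n x)

/-- Existence of the asymptotic variance, with boundedness of the variances of the sums up to
their linear part. -/
theorem IsBoundedCentered.exists_asymptotic_variance (h : IsBoundedCentered μ τ φ B)
    (hsum : Summable fun j : ℕ => (j : ℝ) * |∫ x, φ x * φ (τ^[j] x) ∂μ|) :
    ∃ s : ℝ, 0 ≤ s ∧ Tendsto (lagVariance μ τ φ) atTop (𝓝 (s ^ 2)) ∧
      Tendsto (fun n : ℕ => (√(n : ℝ))⁻¹ * (eLpNorm (birkhoffSum τ φ n) 2 μ).toReal) atTop (𝓝 s) ∧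
      ∃ D : ℝ, ∀ n : ℕ, ∫ x, birkhoffSum τ φ n x ^ 2 ∂μ ≤ n * s ^ 2 + D := by
  obtain ⟨c, hc⟩ : ∃ c : ℕ → ℝ, c = fun j => ∫ x, φ x * φ (τ^[j + 1] x) ∂μ := ⟨_, rfl⟩
  have hsum' : Summable fun j : ℕ => ((j : ℝ) + 1) * |c j| := by
    have := (summable_nat_add_iff 1).2 hsum
    rw [hc]
    exact_mod_cast this
  have hcs : Summable c := by
    refine Summable.of_norm_bounded hsum' fun j => ?_
    rw [Real.norm_eq_abs]
    exact le_mul_of_one_le_left (abs_nonneg _) (by linarith [Nat.cast_nonneg (α := ℝ) j])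
  have hlag : ∀ k, lagVariance μ τ φ k = ∫ x, φ x ^ 2 ∂μ + 2 * ∑ j ∈ Finset.range k, c j := by
    intro k; rw [hc]; rfl
  have hV : Tendsto (lagVariance μ τ φ) atTop (𝓝 (∫ x, φ x ^ 2 ∂μ + 2 * ∑' j, c j)) := by
    rw [funext hlag]
    exact (hcs.hasSum.tendsto_sum_nat.const_mul 2).const_add _
  obtain ⟨V, hVe⟩ : ∃ V, V = ∫ x, φ x ^ 2 ∂μ + 2 * ∑' j, c j := ⟨_, rfl⟩
  rw [← hVe] at hV
  -- The lag variances are the increments of `E S_n²`, so `E S_n²/n` is their Cesàro mean and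
  -- converges to the same limit, which must then be nonnegative.
  have hces := hV.cesaro
  simp_rw [← h.integral_sq_birkhoffSum] at hces
  have hV0 : 0 ≤ V := ge_of_tendsto' hces fun n =>
    mul_nonneg (by positivity) (integral_nonneg fun x => sq_nonneg _)
  refine ⟨√V, Real.sqrt_nonneg _, ?_, ?_, 2 * ∑' j : ℕ, ((j : ℝ) + 1) * |c j|, ?_⟩
  · rwa [Real.sq_sqrt hV0]
  · have := (Real.continuous_sqrt.tendsto V).comp hces
    refine this.congr fun n => ?_
    simp only [Function.comp]
    rw [toReal_eLpNorm_two (h.memLp_birkhoffSum n).1, Real.sqrt_mul (by positivity), Real.sqrt_inv]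
  · intro n
    rw [Real.sq_sqrt hV0]
    -- The excess over the linear part is `∑_{i<n} (V_i - V_N)`, in which the correlation at lag `j
    -- + 1` occurs at most `j + 1` times. This is the reason for the weight `j` in the summability
    -- condition. At the end `N` tends to infinity.
    have hb : ∀ N, n ≤ N → ∫ x, birkhoffSum τ φ n x ^ 2 ∂μ - n * lagVariance μ τ φ N
        ≤ 2 * ∑' j : ℕ, ((j : ℝ) + 1) * |c j| := by
      intro N hN
      have e1 : ∫ x, birkhoffSum τ φ n x ^ 2 ∂μ - n * lagVariance μ τ φ N
          = ∑ i ∈ Finset.range n, (lagVariance μ τ φ i - lagVariance μ τ φ N) := by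
        rw [h.integral_sq_birkhoffSum, Finset.sum_sub_distrib]
        simp
      have e2 : ∀ i ∈ Finset.range n, lagVariance μ τ φ i - lagVariance μ τ φ N
          ≤ 2 * ∑ j ∈ Finset.range N, if i ≤ j then |c j| else 0 := by
        intro i hi
        have hiN : i ≤ N := (Finset.mem_range.1 hi).le.trans hN
        have e3 : lagVariance μ τ φ i - lagVariance μ τ φ N = 2 * ∑ j ∈ Finset.Ico i N, -c j := by
          rw [hlag, hlag, Finset.sum_neg_distrib, Finset.sum_Ico_eq_sub _ hiN]
          ring
        rw [e3, ← Finset.sum_filter]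
        have e4 : (Finset.range N).filter (fun j => i ≤ j) = Finset.Ico i N := by
          ext j; simp [and_comm]
        rw [e4]
        gcongr with j
        exact neg_le_abs _
      rw [e1]
      refine (Finset.sum_le_sum e2).trans ?_
      rw [← Finset.mul_sum, Finset.sum_comm]
      gcongr
      refine le_trans (Finset.sum_le_sum (g := fun j : ℕ => ((j : ℝ) + 1) * |c j|) ?_)
        (hsum'.sum_le_tsum _ fun j _ => by positivity)
      intro j _
      rw [← Finset.sum_filter, Finset.sum_const, nsmul_eq_mul]
      gcongr
      have : ((Finset.range n).filter (fun i => i ≤ j)).card ≤ (Finset.range (j + 1)).card :=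
        Finset.card_le_card fun i hi => by
          simp only [Finset.mem_filter, Finset.mem_range] at hi ⊢; omega
      rw [Finset.card_range] at this
      exact_mod_cast this
    have := le_of_tendsto ((hV.const_mul (n : ℝ)).const_sub _)
      ((eventually_ge_atTop n).mono fun N hN => hb N hN)
    linarith

/-- If the Birkhoff sums are bounded in `L²` the observable is a coboundary. -/
theorem IsBoundedCentered.exists_coboundary (h : IsBoundedCentered μ τ φ B) {D : ℝ}
    (hD : ∀ n : ℕ, ∫ x, birkhoffSum τ φ n x ^ 2 ∂μ ≤ D) :
    ∃ r : Ω → ℝ, MemLp r 2 μ ∧ φ =ᵐ[μ] fun x => r (τ x) - r x := by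
  have hφ : MemLp φ 2 μ := by simpa [birkhoffSum] using! h.memLp_birkhoffSum 1
  set U := Lp.compMeasurePreserving (E := ℝ) (p := 2) τ h.measurePreserving with hU
  -- The affine isometry `r ↦ r∘τ - φ` of `L²` has the orbit `-S_n` starting at 0, bounded by
  -- assumption; a fixed point is a solution of `φ = r∘τ - r`.
  obtain ⟨c, hc⟩ := exists_fixedPoint_of_bounded_orbit (A := fun r : Lp ℝ 2 μ => U r - hφ.toLp φ)
    (x := fun n => -(h.memLp_birkhoffSum n).toLp _) (b := √D)
    (fun a b => by
      rw [sub_sub_sub_cancel_right, ← map_sub, Lp.norm_compMeasurePreserving])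
    (fun n => by
      simp only [map_neg, hU, Lp.toLp_compMeasurePreserving]
      rw [← neg_add', neg_inj]
      have : birkhoffSum τ φ (n + 1) = birkhoffSum τ φ n ∘ τ + φ := by
        ext x; simp [birkhoffSum_succ', add_comm]
      rw [← MemLp.toLp_add]
      congr 1)
    (fun n => by
      rw [norm_neg, Lp.norm_toLp, toReal_eLpNorm_two (h.memLp_birkhoffSum n).1]
      exact Real.sqrt_le_sqrt (hD n))
  refine ⟨c, Lp.memLp c, ?_⟩
  have h1 := Lp.coeFn_compMeasurePreserving c h.measurePreserving
  have h2 := hφ.coeFn_toLp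
  have h3 := Lp.coeFn_sub (U c) (hφ.toLp φ)
  rw [hc] at h3
  filter_upwards [h1, h2, h3] with x e1 e2 e3
  simp only [Pi.sub_apply] at e3
  rw [← hU] at e1
  rw [e1, e2] at e3
  simp only [Function.comp] at e3
  linarith

theorem charFun_map_mul_gaussianReal (s θ : ℝ) :
    charFun ((gaussianReal 0 1).map fun z => s * z) θ
      = (Real.exp (-(s ^ 2 * θ ^ 2 / 2)) : ℂ) := by
  rw [charFun_map_mul, charFun_gaussianReal_zero_one]
  congr 3
  ring

theorem IsBoundedCentered.tendstoInDistribution (h : IsBoundedCentered μ τ φ B) {s : ℝ}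
    (hlim : ∀ θ : ℝ, Tendsto (fun n : ℕ => sumCharFun μ τ φ (θ * (√(n : ℝ))⁻¹) n) atTop
      (𝓝 (Real.exp (-(s ^ 2 * θ ^ 2 / 2)) : ℂ))) :
    TendstoInDistribution (fun (n : ℕ) x => (√(n : ℝ))⁻¹ * birkhoffSum τ φ n x) atTop
      (fun z : ℝ => s * z) (fun _ => μ) (gaussianReal 0 1) where
  forall_aemeasurable n := ((measurable_birkhoffSum h.measurePreserving.measurable
    h.measurable n).const_mul _).aemeasurable
  tendsto := by
    refine ProbabilityMeasure.tendsto_of_tendsto_charFun fun θ => ?_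
    simp only [ProbabilityMeasure.coe_mk]
    rw [charFun_map_mul_gaussianReal]
    simp_rw [h.charFun_map]
    exact hlim θ

/-- The degenerate case `s = 0` of the central limit theorem, where the block argument has no
contraction to use. -/
theorem IsBoundedCentered.tendsto_sumCharFun_of_bounded (h : IsBoundedCentered μ τ φ B) {D : ℝ}
    (hD : ∀ n : ℕ, ∫ x, birkhoffSum τ φ n x ^ 2 ∂μ ≤ D) (θ : ℝ) :
    Tendsto (fun n : ℕ => sumCharFun μ τ φ (θ * (√(n : ℝ))⁻¹) n) atTop (𝓝 1) := by
  rw [tendsto_iff_norm_sub_tendsto_zero]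
  have hl : Tendsto (fun n : ℕ => 3 * (θ * (√(n : ℝ))⁻¹) ^ 2 * D) atTop (𝓝 0) := by
    have : Tendsto (fun n : ℕ => (√(n : ℝ))⁻¹) atTop (𝓝 0) :=
      tendsto_inv_atTop_zero.comp (Real.tendsto_sqrt_atTop.comp tendsto_natCast_atTop_atTop)
    simpa using (((this.const_mul θ).pow 2).const_mul 3).mul_const D
  refine squeeze_zero (fun n => norm_nonneg _) (fun n => ?_) hl
  exact (h.norm_sumCharFun_sub_one_le _ n).trans
    (mul_le_mul_of_nonneg_left (hD n) (by positivity))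

end Variance

end RandomMaps

/-! ### Calculus of the BV norm and the fibre cocycle. -/

namespace RandomMaps

section BoundedVariation

variable {X : Type*} [MeasurableSpace X] {m : Measure X} {v : (X → ℂ) → ℝ≥0∞} {C₀ : ℝ}

/-- `g` is a measurable function with BV norm at most `β`. -/
structure BVBound (m : Measure X) (v : (X → ℂ) → ℝ≥0∞) (g : X → ℂ) (β : ℝ) : Prop where
  aestronglyMeasurable : AEStronglyMeasurable g m
  nonneg : 0 ≤ β
  le : bvNorm m v g ≤ ENNReal.ofReal β

/-- The supremum axiom is tested on the constant function 1, whose variation is 0 and whose `L¹`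
norm is 1. -/
theorem IsVariation.one_le [IsProbabilityMeasure m] (hv : IsVariation m v C₀) : 1 ≤ C₀ := by
  obtain ⟨x⟩ := nonempty_of_isProbabilityMeasure m
  have h1 := hv.sup_le (fun _ => 1) aestronglyMeasurable_const
  rw [hv.const] at h1
  have h2 : (1 : ℝ≥0∞) ≤ ENNReal.ofReal C₀ := by
    simpa using (le_iSup (fun _ : X => ‖(1 : ℂ)‖ₑ) x).trans h1
  rwa [ENNReal.one_le_ofReal] at h2

theorem BVBound.mono {g : X → ℂ} {β γ : ℝ} (h : BVBound m v g β) (hle : β ≤ γ) :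
    BVBound m v g γ :=
  ⟨h.1, h.2.trans hle, h.3.trans (ENNReal.ofReal_le_ofReal hle)⟩

theorem BVBound.iSup_le [IsProbabilityMeasure m] (hv : IsVariation m v C₀) {g : X → ℂ} {β : ℝ}
    (h : BVBound m v g β) :
    ⨆ x, ‖g x‖ₑ ≤ ENNReal.ofReal (C₀ * β) := by
  rw [ENNReal.ofReal_mul (zero_le_one.trans hv.one_le)]
  refine (hv.sup_le g h.1).trans ?_
  rw [add_comm]
  exact mul_le_mul_right h.3 _

theorem BVBound.norm_le [IsProbabilityMeasure m] (hv : IsVariation m v C₀) {g : X → ℂ} {β : ℝ}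
    (h : BVBound m v g β) (x : X) : ‖g x‖ ≤ C₀ * β := by
  have h1 := (le_iSup (fun x => ‖g x‖ₑ) x).trans (h.iSup_le hv)
  have h0 : 0 ≤ C₀ * β := mul_nonneg (zero_le_one.trans hv.one_le) h.2
  rwa [← ofReal_norm, ENNReal.ofReal_le_ofReal_iff h0] at h1

theorem BVBound.const [IsProbabilityMeasure m] (hv : IsVariation m v C₀) (c : ℂ) :
    BVBound m v (fun _ => c) ‖c‖ := by
  refine ⟨aestronglyMeasurable_const, norm_nonneg _, ?_⟩
  simp [bvNorm, hv.const]

theorem BVBound.add (hv : IsVariation m v C₀) {f g : X → ℂ} {β γ : ℝ}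
    (hf : BVBound m v f β) (hg : BVBound m v g γ) :
    BVBound m v (fun x => f x + g x) (β + γ) := by
  refine ⟨hf.1.add hg.1, add_nonneg hf.2 hg.2, ?_⟩
  rw [ENNReal.ofReal_add hf.2 hg.2]
  refine le_trans ?_ (add_le_add hf.3 hg.3)
  have h1 : ∫⁻ x, ‖f x + g x‖ₑ ∂m ≤ ∫⁻ x, ‖f x‖ₑ ∂m + ∫⁻ x, ‖g x‖ₑ ∂m := by
    rw [← lintegral_add_left' hf.1.enorm]
    exact lintegral_mono fun x => enorm_add_le _ _
  calc _ ≤ (∫⁻ x, ‖f x‖ₑ ∂m + ∫⁻ x, ‖g x‖ₑ ∂m) + (v f + v g) :=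
        add_le_add h1 (hv.add_le f g hf.1 hg.1)
    _ = _ := by simp only [bvNorm]; ring

theorem BVBound.mul [IsProbabilityMeasure m] (hv : IsVariation m v C₀) {f g : X → ℂ} {β γ : ℝ}
    (hf : BVBound m v f β) (hg : BVBound m v g γ) :
    BVBound m v (fun x => f x * g x) (2 * C₀ * β * γ) := by
  have hC := zero_le_one.trans hv.one_le
  have hβ := hf.2
  have hγ := hg.2
  refine ⟨hf.1.mul hg.1, by positivity, ?_⟩
  have h1 : ∫⁻ x, ‖f x * g x‖ₑ ∂m ≤ (⨆ x, ‖f x‖ₑ) * ∫⁻ x, ‖g x‖ₑ ∂m := by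
    rw [← lintegral_const_mul'' _ hg.1.enorm]
    refine lintegral_mono fun x => ?_
    rw [enorm_mul]
    gcongr
    exact le_iSup (fun x => ‖f x‖ₑ) x
  have h2 : v f ≤ ENNReal.ofReal β := le_trans le_add_self hf.3
  calc bvNorm m v (fun x => f x * g x)
      ≤ (⨆ x, ‖f x‖ₑ) * ∫⁻ x, ‖g x‖ₑ ∂m + ((⨆ x, ‖f x‖ₑ) * v g + (⨆ x, ‖g x‖ₑ) * v f) :=
        add_le_add h1 (hv.mul_le f g hf.1 hg.1)
    _ = (⨆ x, ‖f x‖ₑ) * bvNorm m v g + (⨆ x, ‖g x‖ₑ) * v f := by simp only [bvNorm]; ring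
    _ ≤ ENNReal.ofReal (C₀ * β) * ENNReal.ofReal γ + ENNReal.ofReal (C₀ * γ) * ENNReal.ofReal β :=
        add_le_add (mul_le_mul' (hf.iSup_le hv) hg.3) (mul_le_mul' (hg.iSup_le hv) h2)
    _ = ENNReal.ofReal (2 * C₀ * β * γ) := by
        rw [← ENNReal.ofReal_mul (by positivity), ← ENNReal.ofReal_mul (by positivity),
          ← ENNReal.ofReal_add (by positivity) (by positivity)]
        congr 1; ring

theorem BVBound.const_mul [IsProbabilityMeasure m] (hv : IsVariation m v C₀) (c : ℂ) {f : X → ℂ}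
    {β : ℝ} (hf : BVBound m v f β) : BVBound m v (fun x => c * f x) (‖c‖ * β) := by
  have := nonempty_of_isProbabilityMeasure m
  refine ⟨hf.1.const_mul c, mul_nonneg (norm_nonneg _) hf.2, ?_⟩
  have h1 := hv.mul_le (fun _ => c) f aestronglyMeasurable_const hf.1
  rw [hv.const, mul_zero, add_zero] at h1
  have h2 : (⨆ _ : X, ‖c‖ₑ) = ‖c‖ₑ := ciSup_const
  rw [h2] at h1
  have h3 : ∫⁻ x, ‖c * f x‖ₑ ∂m = ‖c‖ₑ * ∫⁻ x, ‖f x‖ₑ ∂m := by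
    simp_rw [enorm_mul]
    exact lintegral_const_mul'' _ hf.1.enorm
  calc _ ≤ ‖c‖ₑ * ∫⁻ x, ‖f x‖ₑ ∂m + ‖c‖ₑ * v f := add_le_add h3.le h1
    _ = ‖c‖ₑ * bvNorm m v f := by simp only [bvNorm]; ring
    _ ≤ ‖c‖ₑ * ENNReal.ofReal β := by gcongr; exact hf.3
    _ = _ := by rw [ENNReal.ofReal_mul (norm_nonneg _), ofReal_norm]

theorem BVBound.sum [IsProbabilityMeasure m] (hv : IsVariation m v C₀) {f : ℕ → X → ℂ} {β : ℕ → ℝ}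
    (n : ℕ) (h : ∀ j < n, BVBound m v (f j) (β j)) :
    BVBound m v (fun x => ∑ j ∈ Finset.range n, f j x) (∑ j ∈ Finset.range n, β j) := by
  induction n with
  | zero => simpa using BVBound.const hv (0 : ℂ)
  | succ n ih =>
    simp_rw [Finset.sum_range_succ]
    exact (ih fun j hj => h j (by omega)).add hv (h n (by omega))

theorem BVBound.pow [IsProbabilityMeasure m] (hv : IsVariation m v C₀) {f : X → ℂ} {β : ℝ}
    (hf : BVBound m v f β) (n : ℕ) :
    BVBound m v (fun x => f x ^ (n + 1)) ((2 * C₀ * β) ^ n * β) := by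
  induction n with
  | zero => simpa using hf
  | succ n ih =>
    have := ih.mul hv hf
    simp_rw [pow_succ _ (n + 1)]
    refine this.mono (le_of_eq ?_)
    ring

/-- The Taylor polynomials of `exp (c f) - 1` have small BV norm. -/
theorem BVBound.taylor [IsProbabilityMeasure m] (hv : IsVariation m v C₀) {f : X → ℂ} {β : ℝ}
    (hf : BVBound m v f β) (c : ℂ) (hc : 2 * C₀ * (‖c‖ * β) ≤ 1 / 2) (d : ℕ) :
    BVBound m v (fun x => ∑ r ∈ Finset.range d, (c * f x) ^ (r + 1) / ((r + 1).factorial : ℂ))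
      (2 * (‖c‖ * β)) := by
  have hC := zero_le_one.trans hv.one_le
  have hg := hf.const_mul hv c
  have hβ := hg.2
  obtain ⟨γ, hγ⟩ : ∃ γ, γ = ‖c‖ * β := ⟨_, rfl⟩
  rw [← hγ] at hg hc hβ ⊢
  -- The axioms give stability under sums and products but not under limits, so the exponential
  -- itself is out of reach and a bound independent of `d` is needed. Each product costs `2 * C₀`,
  -- so the term of degree `r + 1` is at most `2^{-r} γ`.
  have h1 := BVBound.sum hv (f := fun r x => (c * f x) ^ (r + 1) / ((r + 1).factorial : ℂ))
    (β := fun r => (1 / 2) ^ r * γ) d (fun r _ => by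
      have h2 := (hg.pow hv r).const_mul hv (((r + 1).factorial : ℂ)⁻¹)
      simp_rw [div_eq_inv_mul (_ : ℂ)]
      refine h2.mono ?_
      rw [norm_inv, Complex.norm_natCast]
      have h3 : (((r + 1).factorial : ℝ))⁻¹ ≤ 1 :=
        inv_le_one_of_one_le₀ (by exact_mod_cast Nat.one_le_iff_ne_zero.2 (Nat.factorial_ne_zero _))
      calc _ ≤ 1 * ((2 * C₀ * γ) ^ r * γ) := by gcongr
        _ ≤ _ := by
            rw [one_mul]
            exact mul_le_mul_of_nonneg_right (pow_le_pow_left₀ (by positivity) hc r) hβ)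
  refine h1.mono ?_
  rw [← Finset.sum_mul]
  gcongr
  have := geom_sum_eq (show (1 / 2 : ℝ) ≠ 1 by norm_num) d
  rw [this]
  have : (0 : ℝ) < (1 / 2) ^ d := by positivity
  rw [div_le_iff_of_neg (by norm_num)]
  linarith

end BoundedVariation

section Cocycle

variable {X Y : Type*}

/-- The composition `T_{ω_{n-1}} ∘ ⋯ ∘ T_{ω_0}`. -/
def cocycle (T : Y → X → X) (ω : ℤ → Y) : ℕ → X → X
  | 0 => id
  | n + 1 => T (ω n) ∘ cocycle T ω n

theorem shift_shift (a b : ℤ) (ω : ℤ → Y) : shift a (shift b ω) = shift (a + b) ω := by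
  funext j; simp only [shift, add_assoc]

theorem shift_zero (ω : ℤ → Y) : shift 0 ω = ω := by funext j; simp [shift]

theorem iterate_skew (T : Y → X → X) (ω : ℤ → Y) (n : ℕ) (x : X) :
    (skew T)^[n] (ω, x) = (shift n ω, cocycle T ω n x) := by
  induction n with
  | zero => simp [cocycle, shift_zero]
  | succ n ih =>
    rw [Function.iterate_succ_apply', ih]
    simp only [skew, shift_shift, cocycle, Function.comp]
    simp [shift, add_comm]

theorem cocycle_add (T : Y → X → X) (ω : ℤ → Y) (a b : ℕ) (x : X) :
    cocycle T ω (a + b) x = cocycle T (shift a ω) b (cocycle T ω a x) := by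
  induction b with
  | zero => rfl
  | succ b ih =>
    rw [← add_assoc]
    simp only [cocycle, Function.comp, ih, shift]
    push_cast
    rw [add_comm]

theorem cocycle_congr (T : Y → X → X) {ω ω' : ℤ → Y} {n : ℕ}
    (h : ∀ i : ℤ, 0 ≤ i → i < n → ω i = ω' i) (x : X) : cocycle T ω n x = cocycle T ω' n x := by
  induction n with
  | zero => rfl
  | succ n ih =>
    simp only [cocycle, Function.comp]
    rw [ih fun i h0 hi => h i h0 (by push_cast; omega), h n (by omega) (by push_cast; omega)]

theorem measurable_cocycle [MeasurableSpace X] {m : Measure X} {T : Y → X → X}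
    (hT : ∀ y, Measure.QuasiMeasurePreserving (T y) m m) (ω : ℤ → Y) (n : ℕ) :
    Measurable (cocycle T ω n) := by
  induction n with
  | zero => exact measurable_id
  | succ n ih => exact (hT _).measurable.comp ih

end Cocycle

end RandomMaps

/-! ### Duality and exponential mixing on a single fibre. -/

namespace RandomMaps

section Fibre

variable {X Y : Type*} [MeasurableSpace X] {m : Measure X}
  {v : (X → ℂ) → ℝ≥0∞} {C₀ : ℝ} {T : Y → X → X} {h : (ℤ → Y) × X → ℝ}
  {K : (ℤ → Y) → ℝ} {lam ε : ℝ} {ω : ℤ → Y}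

/-- The measure `μ_ω = h_ω dm`. -/
noncomputable def fibreMeasure (m : Measure X) (h : (ℤ → Y) × X → ℝ) (ω : ℤ → Y) : Measure X :=
  m.withDensity fun x => ENNReal.ofReal (h (ω, x))

/-- The standing assumption at a single point of the base. -/
structure IsGoodFibre (m : Measure X) (v : (X → ℂ) → ℝ≥0∞) (T : Y → X → X)
    (h : (ℤ → Y) × X → ℝ) (K : (ℤ → Y) → ℝ) (lam ε : ℝ) (ω : ℤ → Y) : Prop where
  measurable_h : Measurable fun x => h (ω, x)
  h_nonneg : ∀ x, 0 ≤ h (ω, x)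
  integral_h : ∫ x, h (ω, x) ∂m = 1
  h_pos : ∀ᵐ x ∂m, 0 < h (ω, x)
  equivariant : transfer m (T (ω 0)) (fun x => (h (ω, x) : ℂ))
    =ᵐ[m] fun x => (h (shift 1 ω, x) : ℂ)
  slowly_varying : ∀ n : ℤ, K ω * Real.exp (-ε * |(n : ℝ)|) ≤ K (shift n ω) ∧
      K (shift n ω) ≤ K ω * Real.exp (ε * |(n : ℝ)|)
  exp_transfer : ∀ n : ℕ, ∃ u : X → ℂ, u =ᵐ[m] transferIter m T ω n (fun _ => 1) ∧
    bvNorm m v (fun x => u x - (h (shift n ω, x) : ℂ)) ≤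
      ENNReal.ofReal (K ω * Real.exp (-lam * n))
  exp_normTransfer : ∀ n : ℕ, ∀ g : X → ℂ, AEStronglyMeasurable g m → bvNorm m v g < ∞ →
    ∃ u : X → ℂ, u =ᵐ[m] normTransferIter m T h ω n g ∧
      bvNorm m v (fun x => u x - ∫ z, g z * (h (ω, z) : ℂ) ∂m) ≤
        ENNReal.ofReal (K ω) * bvNorm m v g * ENNReal.ofReal (Real.exp (-lam * n))
  one_le_K : 1 ≤ K ω

/-- The standing assumption along a whole orbit of the base. -/
def IsGoodPoint (m : Measure X) (v : (X → ℂ) → ℝ≥0∞) (T : Y → X → X)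
    (h : (ℤ → Y) × X → ℝ) (K : (ℤ → Y) → ℝ) (lam ε : ℝ) (ω : ℤ → Y) : Prop :=
  ∀ j : ℤ, IsGoodFibre m v T h K lam ε (shift j ω)

theorem IsGoodPoint.comp_shift (hω : IsGoodPoint m v T h K lam ε ω) (j : ℤ) :
    IsGoodPoint m v T h K lam ε (shift j ω) := fun i => by
  rw [shift_shift]; exact hω _

theorem IsGoodPoint.fibre (hω : IsGoodPoint m v T h K lam ε ω) : IsGoodFibre m v T h K lam ε ω := by
  simpa [shift_zero] using hω 0

theorem fibreMeasure_absolutelyContinuous : fibreMeasure m h ω ≪ m :=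
  withDensity_absolutelyContinuous _ _

theorem IsGoodFibre.integrable_h (hω : IsGoodFibre m v T h K lam ε ω) :
    Integrable (fun x => h (ω, x)) m := by
  by_contra hn
  have := integral_undef hn
  rw [hω.integral_h] at this
  exact one_ne_zero this

theorem IsGoodFibre.isProbabilityMeasure (hω : IsGoodFibre m v T h K lam ε ω) :
    IsProbabilityMeasure (fibreMeasure m h ω) := by
  refine ⟨?_⟩
  rw [fibreMeasure, withDensity_apply _ MeasurableSet.univ, Measure.restrict_univ,
    ← ofReal_integral_eq_lintegral_ofReal hω.integrable_h (Eventually.of_forall hω.h_nonneg),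
    hω.integral_h, ENNReal.ofReal_one]

theorem IsGoodFibre.integral_fibreMeasure (hω : IsGoodFibre m v T h K lam ε ω) (f : X → ℂ) :
    ∫ x, f x ∂(fibreMeasure m h ω) = ∫ x, f x * (h (ω, x) : ℂ) ∂m := by
  rw [fibreMeasure, integral_withDensity_eq_integral_toReal_smul
    hω.measurable_h.ennreal_ofReal (by simp)]
  refine integral_congr_ae (Eventually.of_forall fun x => ?_)
  simp [ENNReal.toReal_ofReal (hω.h_nonneg x), mul_comm]

theorem IsGoodFibre.norm_integral_le (hω : IsGoodFibre m v T h K lam ε ω) {f : X → ℂ} {q : ℝ}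
    (hf : ∀ x, ‖f x‖ ≤ q) : ‖∫ x, f x ∂(fibreMeasure m h ω)‖ ≤ q := by
  have := hω.isProbabilityMeasure
  simpa using norm_integral_le_of_norm_le_const (μ := fibreMeasure m h ω)
    (Eventually.of_forall hf)

theorem IsGoodFibre.integrable_of_bound (hω : IsGoodFibre m v T h K lam ε ω) {f : X → ℂ} {q : ℝ}
    (hm : AEStronglyMeasurable f m) (hf : ∀ x, ‖f x‖ ≤ q) :
    Integrable f (fibreMeasure m h ω) := by
  have := hω.isProbabilityMeasure
  exact Integrable.of_bound (hm.mono_ac fibreMeasure_absolutelyContinuous) q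
    (Eventually.of_forall hf)

variable [IsProbabilityMeasure m]

theorem transferIter_duality (hT : ∀ y, Measure.QuasiMeasurePreserving (T y) m m) {g : X → ℂ}
    (hg : Integrable g m) (n : ℕ) :
    Integrable (transferIter m T ω n g) m ∧ ∀ f : X → ℂ, Measurable f → ∀ q : ℝ,
      (∀ x, ‖f x‖ ≤ q) →
      ∫ x, g x * f (cocycle T ω n x) ∂m = ∫ x, transferIter m T ω n g x * f x ∂m := by
  induction n with
  | zero => exact ⟨hg, fun f _ q _ => rfl⟩
  | succ n ih =>
    have h1 := isTransferImage_transfer (hT (ω n)) ih.1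
    refine ⟨h1.integrable_right, fun f hf q hq => ?_⟩
    rw [transferIter, ← h1.duality f (memLp_top_of_bound hf.aestronglyMeasurable q
      (Eventually.of_forall hq))]
    exact ih.2 (fun x => f (T (ω n) x)) (hf.comp (hT _).measurable) q fun x => hq _

/-- Multiplying by the density conjugates the normalized operator to the transfer operator. The
division by `h` is harmless because `h > 0` almost everywhere at every point of the orbit. -/
theorem IsGoodPoint.normTransferIter_duality (hω : IsGoodPoint m v T h K lam ε ω)
    (hT : ∀ y, Measure.QuasiMeasurePreserving (T y) m m) {g : X → ℂ}
    (hg : Integrable (fun x => g x * (h (ω, x) : ℂ)) m) (n : ℕ) :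
    Integrable (fun x => normTransferIter m T h ω n g x * (h (shift n ω, x) : ℂ)) m ∧
      ∀ f : X → ℂ, Measurable f → ∀ q : ℝ, (∀ x, ‖f x‖ ≤ q) →
      ∫ x, g x * f (cocycle T ω n x) * (h (ω, x) : ℂ) ∂m
        = ∫ x, normTransferIter m T h ω n g x * f x * (h (shift n ω, x) : ℂ) ∂m := by
  induction n with
  | zero =>
    simp only [normTransferIter, Nat.cast_zero, shift_zero, cocycle, id]
    exact ⟨hg, fun f _ q _ => trivial⟩
  | succ n ih =>
    have h1 := isTransferImage_transfer (hT (shift n ω 0)) ih.1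
    have hpos := (hω ((n + 1 : ℕ) : ℤ)).h_pos
    have hsh : shift 1 (shift n ω) = shift ((n + 1 : ℕ) : ℤ) ω := by
      rw [shift_shift]; push_cast; rw [add_comm]
    have h2 : (fun x => normTransferIter m T h ω (n + 1) g x *
        (h (shift ((n + 1 : ℕ) : ℤ) ω, x) : ℂ)) =ᵐ[m] transfer m (T (shift n ω 0))
        (fun x => normTransferIter m T h ω n g x * (h (shift n ω, x) : ℂ)) := by
      filter_upwards [hpos] with x hx
      rw [normTransferIter, normTransfer, hsh]
      exact div_mul_cancel₀ _ (by exact_mod_cast hx.ne')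
    refine ⟨h1.integrable_right.congr h2.symm, fun f hf q hq => ?_⟩
    have h3 := ih.2 (fun x => f (T (ω n) x)) (hf.comp (hT _).measurable) q fun x => hq _
    have h4 := h1.duality f (memLp_top_of_bound hf.aestronglyMeasurable q (Eventually.of_forall hq))
    have h5 : shift n ω 0 = ω n := by simp [shift]
    simp only [cocycle, Function.comp]
    rw [h3]
    calc _ = ∫ x, normTransferIter m T h ω n g x * (h (shift n ω, x) : ℂ) * f (T (ω n) x) ∂m := by
          congr 1; funext x; ring
      _ = _ := by
          rw [← h5, h4]
          refine integral_congr_ae ?_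
          filter_upwards [h2] with x hx
          rw [← hx]; ring

/-- One step of exponential mixing: the error term is again of bounded variation. -/
theorem IsGoodPoint.exists_push (hω : IsGoodPoint m v T h K lam ε ω) (hv : IsVariation m v C₀)
    (hT : ∀ y, Measure.QuasiMeasurePreserving (T y) m m) {g : X → ℂ} {β : ℝ}
    (hg : BVBound m v g β) (n : ℕ) :
    ∃ w : X → ℂ, BVBound m v w (K ω * β * Real.exp (-lam * n)) ∧
      ∀ f : X → ℂ, Measurable f → ∀ q : ℝ, (∀ x, ‖f x‖ ≤ q) →
      ∫ x, g x * f (cocycle T ω n x) ∂(fibreMeasure m h ω)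
        = (∫ x, g x ∂(fibreMeasure m h ω)) * ∫ x, f x ∂(fibreMeasure m h (shift n ω))
          + ∫ x, w x * f x ∂(fibreMeasure m h (shift n ω)) := by
  have hK := hω.fibre.one_le_K
  have hgi : Integrable (fun x => g x * (h (ω, x) : ℂ)) m :=
    hω.fibre.integrable_h.ofReal.bdd_mul hg.1 (Eventually.of_forall (hg.norm_le hv))
  obtain ⟨hi, hd⟩ := hω.normTransferIter_duality hT hgi n
  obtain ⟨u, hu, hb⟩ := hω.fibre.exp_normTransfer n g hg.1 (hg.3.trans_lt ENNReal.ofReal_lt_top)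
  rw [← hω.fibre.integral_fibreMeasure] at hb
  set e := ∫ x, g x ∂(fibreMeasure m h ω) with he
  -- The axiom gives no measurability for the version `u`; it is recovered by dividing the
  -- integrable function `L^n g · h` by `h`.
  have hum : AEStronglyMeasurable u m := by
    have h1 : AEStronglyMeasurable (fun x => (normTransferIter m T h ω n g x *
      (h (shift n ω, x) : ℂ)) * ((h (shift n ω, x) : ℂ))⁻¹) m := by
      refine hi.1.mul ?_
      have := (hω n).measurable_h
      exact (Complex.measurable_ofReal.comp this).inv.aestronglyMeasurable
    refine h1.congr ?_
    filter_upwards [hu, (hω n).h_pos] with x hx hpos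
    rw [hx, mul_assoc, mul_inv_cancel₀ (by exact_mod_cast hpos.ne'), mul_one]
  have hβ := hg.2
  have hw : BVBound m v (fun x => u x - e) (K ω * β * Real.exp (-lam * n)) := by
    refine ⟨hum.sub aestronglyMeasurable_const, by positivity, hb.trans ?_⟩
    rw [ENNReal.ofReal_mul (by positivity), ENNReal.ofReal_mul (by positivity)]
    gcongr
    exact hg.3
  refine ⟨_, hw, fun f hf q hq => ?_⟩
  rw [hω.fibre.integral_fibreMeasure, hd f hf q hq]
  have hq0 : ∀ x, 0 ≤ q := fun x => (norm_nonneg _).trans (hq x)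
  have i1 : Integrable (fun x => (u x - e) * f x) (fibreMeasure m h (shift n ω)) := by
    refine (hω n).integrable_of_bound (hw.1.mul hf.aestronglyMeasurable)
      (q := C₀ * (K ω * β * Real.exp (-lam * n)) * q) fun x => ?_
    rw [norm_mul]
    exact mul_le_mul (hw.norm_le hv x) (hq x) (norm_nonneg _)
      ((norm_nonneg _).trans (hw.norm_le hv x))
  have i2 : Integrable (fun x => e * f x) (fibreMeasure m h (shift n ω)) :=
    ((hω n).integrable_of_bound hf.aestronglyMeasurable hq).const_mul _
  rw [← integral_const_mul, ← integral_add i2 i1, (hω n).integral_fibreMeasure]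
  refine integral_congr_ae ?_
  filter_upwards [hu] with x hx
  rw [hx]; ring

/-- Equivariance of the densities says that `T_ω` carries `μ_ω` to `μ_{σω}`; the induction peels off
the last map. -/
theorem IsGoodPoint.integral_comp_cocycle (hω : IsGoodPoint m v T h K lam ε ω)
    (hT : ∀ y, Measure.QuasiMeasurePreserving (T y) m m) {f : X → ℂ} (hf : Measurable f) {q : ℝ}
    (hq : ∀ x, ‖f x‖ ≤ q) (n : ℕ) :
    ∫ x, f (cocycle T ω n x) ∂(fibreMeasure m h ω)
      = ∫ x, f x ∂(fibreMeasure m h (shift n ω)) := by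
  induction n generalizing f with
  | zero => simp [cocycle, shift_zero]
  | succ n ih =>
    simp only [cocycle, Function.comp]
    have h5 : shift n ω 0 = ω n := by simp [shift]
    have hsh : shift 1 (shift n ω) = shift ((n + 1 : ℕ) : ℤ) ω := by
      rw [shift_shift]; push_cast; rw [add_comm]
    rw [ih (f := fun x => f (T (ω n) x)) (hf.comp (hT _).measurable) fun x => hq _,
      (hω n).integral_fibreMeasure, (hω _).integral_fibreMeasure]
    have h1 := isTransferImage_transfer (hT (shift n ω 0))
      (g := fun x => (h (shift n ω, x) : ℂ)) (hω n).integrable_h.ofReal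
    have h4 := h1.duality f (memLp_top_of_bound hf.aestronglyMeasurable q (Eventually.of_forall hq))
    have h2 := (hω n).equivariant
    rw [hsh] at h2
    rw [← h5]
    simp_rw [mul_comm (f _)]
    rw [h4]
    refine integral_congr_ae ?_
    filter_upwards [h2] with x hx
    rw [hx]

end Fibre

end RandomMaps

/-! ### Fibre mixing for long products, uniformly in their length. -/

namespace RandomMaps

section FibreDecorrelation

variable {X Y : Type*} {T : Y → X → X} {ω : ℤ → Y}

/-- The products `∏_{j<n} (1 + u_j ∘ T^j)`. -/
noncomputable def prodAlong (T : Y → X → X) (ω : ℤ → Y) (u : ℕ → X → ℂ) (n : ℕ) (x : X) : ℂ :=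
  ∏ j ∈ Finset.range n, (1 + u j (cocycle T ω j x))

/-- Telescoping isolates in each term one last small factor `u j`. The earlier factors enter only
through the induction hypothesis at time `j`, and the time from `j` on is free for contraction. -/
theorem prodAlong_eq_one_add_sum (u : ℕ → X → ℂ) (n : ℕ) (x : X) :
    prodAlong T ω u n x
      = 1 + ∑ j ∈ Finset.range n, prodAlong T ω u j x * u j (cocycle T ω j x) := by
  induction n with
  | zero => simp [prodAlong]
  | succ n ih =>
    rw [Finset.sum_range_succ, ← add_assoc, ← ih, prodAlong, Finset.prod_range_succ, ← prodAlong]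
    ring

variable [MeasurableSpace X] {m : Measure X}
  {v : (X → ℂ) → ℝ≥0∞} {C₀ : ℝ} {h : (ℤ → Y) × X → ℝ} {K : (ℤ → Y) → ℝ} {lam ε : ℝ}

theorem shift_natCast_add (a b : ℕ) (ω : ℤ → Y) :
    shift b (shift a ω) = shift ((a + b : ℕ) : ℤ) ω := by
  rw [shift_shift]; push_cast; rw [add_comm]

theorem measurable_prodAlong (hT : ∀ y, Measure.QuasiMeasurePreserving (T y) m m) {u : ℕ → X → ℂ}
    (hu : ∀ j, Measurable (u j)) (n : ℕ) : Measurable (prodAlong T ω u n) :=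
  Finset.measurable_prod _ fun j _ =>
    measurable_const.add ((hu j).comp (measurable_cocycle hT ω j))

variable [IsProbabilityMeasure m]

/-- Multiplying by a further factor and pushing forward. -/
theorem IsGoodPoint.exists_push_mul (hω : IsGoodPoint m v T h K lam ε ω) (hv : IsVariation m v C₀)
    (hT : ∀ y, Measure.QuasiMeasurePreserving (T y) m m) {F w u : X → ℂ} {j : ℕ} {β κ : ℝ}
    (hF : ∀ x, ‖F x‖ ≤ 2) (hw : BVBound m v w 2)
    (hFw : ∀ f : X → ℂ, Measurable f → ∀ q : ℝ, (∀ x, ‖f x‖ ≤ q) →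
      ∫ x, F x * f (cocycle T ω j x) ∂(fibreMeasure m h ω)
        = (∫ x, F x ∂(fibreMeasure m h ω)) * ∫ x, f x ∂(fibreMeasure m h (shift j ω))
          + ∫ x, w x * f x ∂(fibreMeasure m h (shift j ω)))
    (hum : Measurable u) (hu : BVBound m v u β) (hβ : K (shift j ω) * β ≤ κ) (l : ℕ) :
    ∃ w' : X → ℂ, BVBound m v w' (8 * C₀ * κ * Real.exp (-lam * l)) ∧
      ∀ f : X → ℂ, Measurable f → ∀ q : ℝ, (∀ x, ‖f x‖ ≤ q) →
      ∫ x, F x * u (cocycle T ω j x) * f (cocycle T ω (j + l) x) ∂(fibreMeasure m h ω)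
        = (∫ x, F x * u (cocycle T ω j x) ∂(fibreMeasure m h ω)) *
            ∫ x, f x ∂(fibreMeasure m h (shift ((j + l : ℕ) : ℤ) ω))
          + ∫ x, w' x * f x ∂(fibreMeasure m h (shift ((j + l : ℕ) : ℤ) ω)) := by
  have hC := zero_le_one.trans hv.one_le
  obtain ⟨a, ha⟩ : ∃ a, a = ∫ x, F x ∂(fibreMeasure m h ω) := ⟨_, rfl⟩
  have ha2 : ‖a‖ ≤ 2 := ha ▸ hω.fibre.norm_integral_le hF
  -- Against functions of the state at time `j`, the factor `F` acts as the BV density `a + w`, of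
  -- norm at most `2 + 2`. Multiplication by `u` gives `2 * C₀ * 4 * β`, hence the constant 8.
  have hg : BVBound m v (fun x => a + w x) 4 :=
    ((BVBound.const hv a).add hv hw).mono (by linarith)
  have key : ∀ f : X → ℂ, Measurable f → ∀ q : ℝ, (∀ x, ‖f x‖ ≤ q) →
      ∫ x, F x * f (cocycle T ω j x) ∂(fibreMeasure m h ω)
        = ∫ x, (a + w x) * f x ∂(fibreMeasure m h (shift j ω)) := by
    intro f hf q hq
    have i1 : Integrable (fun x => a * f x) (fibreMeasure m h (shift j ω)) :=
      ((hω j).integrable_of_bound hf.aestronglyMeasurable hq).const_mul _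
    have i2 : Integrable (fun x => w x * f x) (fibreMeasure m h (shift j ω)) := by
      refine (hω j).integrable_of_bound (hw.1.mul hf.aestronglyMeasurable)
        (q := C₀ * 2 * q) fun x => ?_
      rw [norm_mul]
      exact mul_le_mul (hw.norm_le hv x) (hq x) (norm_nonneg _)
        ((norm_nonneg _).trans (hw.norm_le hv x))
    simp_rw [add_mul]
    rw [hFw f hf q hq, ← ha, integral_add i1 i2, integral_const_mul]
  obtain ⟨w', hw', hpush⟩ := (hω.comp_shift j).exists_push hv hT (hg.mul hv hu) l
  rw [shift_natCast_add] at hpush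
  refine ⟨w', hw'.mono ?_, fun f hf q hq => ?_⟩
  · calc K (shift j ω) * (2 * C₀ * 4 * β) * Real.exp (-lam * l)
        = 8 * C₀ * (K (shift j ω) * β) * Real.exp (-lam * l) := by ring
      _ ≤ _ := by gcongr
  · have hl := measurable_cocycle hT (shift j ω) l
    have e1 := key (fun x => u x * f (cocycle T (shift j ω) l x)) (hum.mul (hf.comp hl))
      (C₀ * β * q) fun x => by
        rw [norm_mul]
        exact mul_le_mul (hu.norm_le hv x) (hq _) (norm_nonneg _)
          ((norm_nonneg _).trans (hu.norm_le hv x))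
    have e2 := key u hum _ (hu.norm_le hv)
    rw [e2, ← hpush f hf q hq]
    simp_rw [cocycle_add, mul_assoc] at e1 ⊢
    exact e1

/-- Exponential mixing for products of small factors along the orbit, with a constant which does
not depend on the number of factors. -/
theorem IsGoodPoint.exists_push_prod (hω : IsGoodPoint m v T h K lam ε ω) (hv : IsVariation m v C₀)
    (hT : ∀ y, Measure.QuasiMeasurePreserving (T y) m m) (hlam : 0 < lam) {u : ℕ → X → ℂ}
    {β : ℕ → ℝ} {κ : ℝ} (hκ0 : 0 ≤ κ) (hum : ∀ j, Measurable (u j))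
    (hu : ∀ j, BVBound m v (u j) (β j))
    (hβ : ∀ j : ℕ, K (shift j ω) * β j ≤ κ) (hκ : 8 * C₀ * κ / (1 - Real.exp (-lam)) ≤ 2) {N : ℕ}
    (hF : ∀ n ≤ N, ∀ x, ‖prodAlong T ω u n x‖ ≤ 2) (n : ℕ) (hn : n ≤ N) (k : ℕ) :
    ∃ w : X → ℂ, BVBound m v w (8 * C₀ * κ / (1 - Real.exp (-lam)) * Real.exp (-lam * k)) ∧
      ∀ f : X → ℂ, Measurable f → ∀ q : ℝ, (∀ x, ‖f x‖ ≤ q) →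
      ∫ x, prodAlong T ω u n x * f (cocycle T ω (n + k) x) ∂(fibreMeasure m h ω)
        = (∫ x, prodAlong T ω u n x ∂(fibreMeasure m h ω)) *
            ∫ x, f x ∂(fibreMeasure m h (shift ((n + k : ℕ) : ℤ) ω))
          + ∫ x, w x * f x ∂(fibreMeasure m h (shift ((n + k : ℕ) : ℤ) ω)) := by
  have hC := zero_le_one.trans hv.one_le
  have hprob := hω.fibre.isProbabilityMeasure
  induction n using Nat.strong_induction_on generalizing k with
  | _ n ih =>
  -- A bootstrap: the induction hypothesis at `j` with gap 0 has error norm at most 2 by `hκ`, which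
  -- is just what multiplication by the next factor accepts. The new error then decays over `n + k -
  -- j` steps, and the sum over `j` is geometric whatever `n` is.
  have step : ∀ j, ∃ w' : X → ℂ, j < n →
      (BVBound m v w' (8 * C₀ * κ * Real.exp (-lam * (n + k - j : ℕ))) ∧
      ∀ f : X → ℂ, Measurable f → ∀ q : ℝ, (∀ x, ‖f x‖ ≤ q) →
      ∫ x, prodAlong T ω u j x * u j (cocycle T ω j x) * f (cocycle T ω (n + k) x)
          ∂(fibreMeasure m h ω)
        = (∫ x, prodAlong T ω u j x * u j (cocycle T ω j x) ∂(fibreMeasure m h ω)) *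
            ∫ x, f x ∂(fibreMeasure m h (shift ((n + k : ℕ) : ℤ) ω))
          + ∫ x, w' x * f x ∂(fibreMeasure m h (shift ((n + k : ℕ) : ℤ) ω))) := by
    intro j
    by_cases hj : j < n
    · obtain ⟨w, hw, hFw⟩ := ih j hj (by omega) 0
      simp only [Nat.add_zero] at hFw
      have hw2 : BVBound m v w 2 := hw.mono (by simpa using hκ)
      obtain ⟨w', hw', hd⟩ := hω.exists_push_mul hv hT (hF j (by omega)) hw2 hFw (hum j) (hu j)
        (hβ j) (n + k - j)
      rw [show j + (n + k - j) = n + k by omega] at hd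
      exact ⟨w', fun _ => ⟨hw', hd⟩⟩
    -- The default value is never used, since the sums run over `j < n`.
    · exact ⟨0, fun h => absurd h hj⟩
  choose w hw using step
  have h1e : 0 < 1 - Real.exp (-lam) := by
    rw [sub_pos, Real.exp_lt_one_iff]
    linarith
  refine ⟨fun x => ∑ j ∈ Finset.range n, w j x, ?_, fun f hf q hq => ?_⟩
  · refine (BVBound.sum hv n fun j hj => (hw j hj).1).mono ?_
    have e1 : ∀ j ∈ Finset.range n, 8 * C₀ * κ * Real.exp (-lam * (n + k - j : ℕ))
        ≤ 8 * C₀ * κ * Real.exp (-lam * k) * Real.exp (-lam) ^ (n - 1 - j) := by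
      intro j hj
      rw [Finset.mem_range] at hj
      rw [← Real.exp_nat_mul, mul_assoc (8 * C₀ * κ) (Real.exp (-lam * k)), ← Real.exp_add]
      gcongr
      have e2 : ((n + k - j : ℕ) : ℝ) = (k : ℝ) + ((n - 1 - j : ℕ) : ℝ) + 1 := by
        rw [show n + k - j = k + (n - 1 - j) + 1 by omega]; push_cast; ring
      rw [e2]
      nlinarith
    refine (Finset.sum_le_sum e1).trans ?_
    rw [← Finset.mul_sum, Finset.sum_range_reflect (fun j => Real.exp (-lam) ^ j) n,
      div_mul_eq_mul_div, mul_div_assoc, mul_assoc (8 * C₀ * κ), div_eq_mul_inv]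
    gcongr
    have := summable_geometric_of_lt_one (Real.exp_nonneg (-lam)) (by linarith)
    rw [← tsum_geometric_of_lt_one (Real.exp_nonneg (-lam)) (by linarith)]
    exact this.sum_le_tsum _ fun j _ => by positivity
  · have hfT : Measurable fun x => f (cocycle T ω (n + k) x) :=
      hf.comp (measurable_cocycle hT ω _)
    have hP : ∀ j, Measurable fun x => prodAlong T ω u j x * u j (cocycle T ω j x) := fun j =>
      (measurable_prodAlong hT hum j).mul ((hum j).comp (measurable_cocycle hT ω j))
    have hb : ∀ j < n, ∀ x, ‖prodAlong T ω u j x * u j (cocycle T ω j x)‖ ≤ 2 * (C₀ * β j) := by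
      intro j hj x
      rw [norm_mul]
      exact mul_le_mul (hF j (by omega) x) ((hu j).norm_le hv _) (norm_nonneg _) (by norm_num)
    have i0 : Integrable (fun x => f (cocycle T ω (n + k) x)) (fibreMeasure m h ω) :=
      hω.fibre.integrable_of_bound hfT.aestronglyMeasurable fun x => hq _
    have i1 : ∀ j ∈ Finset.range n, Integrable (fun x => prodAlong T ω u j x *
        u j (cocycle T ω j x)) (fibreMeasure m h ω) := fun j hj =>
      hω.fibre.integrable_of_bound (hP j).aestronglyMeasurable (hb j (Finset.mem_range.1 hj))
    have i2 : ∀ j ∈ Finset.range n, Integrable (fun x => prodAlong T ω u j x *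
        u j (cocycle T ω j x) * f (cocycle T ω (n + k) x)) (fibreMeasure m h ω) := fun j hj => by
      refine hω.fibre.integrable_of_bound ((hP j).mul hfT).aestronglyMeasurable
        (q := 2 * (C₀ * β j) * q) fun x => ?_
      rw [norm_mul]
      have := hb j (Finset.mem_range.1 hj) x
      exact mul_le_mul this (hq _) (norm_nonneg _) ((norm_nonneg _).trans this)
    have i3 : ∀ j ∈ Finset.range n, Integrable (fun x => w j x * f x)
        (fibreMeasure m h (shift ((n + k : ℕ) : ℤ) ω)) := fun j hj => by
      have hwj := (hw j (Finset.mem_range.1 hj)).1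
      refine (hω _).integrable_of_bound (hwj.1.mul hf.aestronglyMeasurable)
        (q := C₀ * (8 * C₀ * κ * Real.exp (-lam * (n + k - j : ℕ))) * q) fun x => ?_
      rw [norm_mul]
      exact mul_le_mul (hwj.norm_le hv x) (hq _) (norm_nonneg _)
        ((norm_nonneg _).trans (hwj.norm_le hv x))
    simp_rw [prodAlong_eq_one_add_sum u n, add_mul, one_mul, Finset.sum_mul]
    rw [integral_add i0 (integrable_finsetSum _ i2), integral_finsetSum _ i2,
      integral_finsetSum _ i3, integral_add (integrable_const _) (integrable_finsetSum _ i1),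
      integral_finsetSum _ i1, hω.integral_comp_cocycle hT hf hq]
    simp only [integral_const, probReal_univ, one_smul]
    rw [add_mul, one_mul, add_assoc, Finset.sum_mul, ← Finset.sum_add_distrib]
    congr 1
    exact Finset.sum_congr rfl fun j hj => (hw j (Finset.mem_range.1 hj)).2 f hf q hq

end FibreDecorrelation

end RandomMaps

/-! ### Fibre mixing for exponentials of Birkhoff sums. -/

namespace RandomMaps

section FibreObservable

theorem norm_cis_sub_taylor_le {x : ℝ} (hx : |x| ≤ 1) (d : ℕ) :
    ‖cis x - (1 + ∑ r ∈ Finset.range d, (Complex.I * x) ^ (r + 1) / ((r + 1).factorial : ℂ))‖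
      ≤ 2 / ((d : ℝ) + 1) := by
  have hn : ‖Complex.I * (x : ℂ)‖ ≤ 1 := by simpa using hx
  have h1 := Complex.exp_bound hn (Nat.succ_pos d)
  rw [Finset.sum_range_succ', add_comm] at h1
  simp only [pow_zero, Nat.factorial_zero, Nat.cast_one, div_one] at h1
  refine h1.trans ?_
  have h2 : ‖Complex.I * (x : ℂ)‖ ^ d.succ ≤ 1 := pow_le_one₀ (norm_nonneg _) hn
  have h3 : (1 : ℝ) ≤ ((d.succ).factorial : ℝ) := by
    exact_mod_cast Nat.one_le_iff_ne_zero.2 (Nat.factorial_ne_zero _)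
  have h4 : ((d + 1 : ℕ) : ℝ) ≤ ((d.succ).factorial : ℝ) := by
    exact_mod_cast Nat.self_le_factorial (d + 1)
  push_cast at h4 ⊢
  have hd : (0 : ℝ) ≤ d := Nat.cast_nonneg d
  calc _ ≤ 1 * (((d : ℝ) + 1 + 1) * (((d + 1).factorial : ℝ) * (d + 1))⁻¹) := by
        gcongr
    _ ≤ 1 * (2 * (d + 1) * (((d : ℝ) + 1) * (d + 1))⁻¹) := by
        gcongr
        linarith
    _ = _ := by field_simp

theorem cis_birkhoffSum {Ω : Type*} (τ : Ω → Ω) (φ : Ω → ℝ) (t : ℝ) (n : ℕ) (x : Ω) :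
    cis (t * birkhoffSum τ φ n x) = ∏ j ∈ Finset.range n, cis (t * φ (τ^[j] x)) := by
  induction n with
  | zero => simp [cis_zero]
  | succ n ih => rw [birkhoffSum_succ, mul_add, cis_add, ih, Finset.prod_range_succ]

variable {X Y : Type*} {T : Y → X → X} {ω : ℤ → Y} {φ : Y → X → ℝ}

theorem observable_iterate_skew (j : ℕ) (x : X) :
    observable φ ((skew T)^[j] (ω, x)) = φ (ω j) (cocycle T ω j x) := by
  rw [iterate_skew]
  simp [observable, shift]

variable [MeasurableSpace X] {m : Measure X} [IsProbabilityMeasure m]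
  {v : (X → ℂ) → ℝ≥0∞} {C₀ : ℝ} {h : (ℤ → Y) × X → ℝ} {K : (ℤ → Y) → ℝ} {lam ε M : ℝ}

/-- Along the orbit of `ω` the observable has BV norm at most `M / K`. -/
def HasScaledBound (m : Measure X) (v : (X → ℂ) → ℝ≥0∞) (K : (ℤ → Y) → ℝ) (φ : Y → X → ℝ) (M : ℝ)
    (ω : ℤ → Y) : Prop :=
  ∀ j : ℤ, ∃ β : ℝ, BVBound m v (fun x => (φ (ω j) x : ℂ)) β ∧ K (shift j ω) * β ≤ M

set_option maxHeartbeats 400000 in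
/-- Exponential mixing on the fibres for the exponentials of the sums. -/
theorem IsGoodPoint.norm_cis_decorrelation_le (hω : IsGoodPoint m v T h K lam ε ω)
    (hv : IsVariation m v C₀) (hT : ∀ y, Measure.QuasiMeasurePreserving (T y) m m) (hlam : 0 < lam)
    (hφm : ∀ y, Measurable (φ y)) (hM : 0 ≤ M) (hφ : HasScaledBound m v K φ M ω) {t : ℝ}
    (ht : 8 * C₀ * M * |t| ≤ 1 - Real.exp (-lam)) (N k : ℕ) {f : X → ℂ} (hf : Measurable f) {q : ℝ}
    (hq : ∀ x, ‖f x‖ ≤ q) :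
    ‖∫ x, cis (t * birkhoffSum (skew T) (observable φ) N (ω, x)) * f (cocycle T ω (N + k) x)
        ∂(fibreMeasure m h ω)
      - (∫ x, cis (t * birkhoffSum (skew T) (observable φ) N (ω, x)) ∂(fibreMeasure m h ω)) *
        ∫ x, f x ∂(fibreMeasure m h (shift ((N + k : ℕ) : ℤ) ω))‖
      ≤ C₀ * (16 * C₀ * M * |t| / (1 - Real.exp (-lam)) * Real.exp (-lam * k)) * q := by
  have hC1 := hv.one_le
  have hC := zero_le_one.trans hC1
  have hprob := hω.fibre.isProbabilityMeasure
  have hpos := Real.exp_pos (-lam)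
  have h1e : 0 < 1 - Real.exp (-lam) := by
    rw [sub_pos, Real.exp_lt_one_iff]; linarith
  choose β hβ hKβ using hφ
  have hβM : ∀ j, β j ≤ M := fun j =>
    (le_mul_of_one_le_left (hβ j).2 (hω j).one_le_K).trans (hKβ j)
  have ht0 := abs_nonneg t
  have hsmall : C₀ * (|t| * M) ≤ 1 / 8 := by linarith
  have hφt : ∀ (j : ℤ) x, |t * φ (ω j) x| ≤ 1 := by
    intro j x
    have := (hβ j).norm_le hv x
    rw [Complex.norm_real, Real.norm_eq_abs] at this
    rw [abs_mul]
    calc |t| * |φ (ω j) x| ≤ |t| * (C₀ * M) := by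
          gcongr
          exact this.trans (mul_le_mul_of_nonneg_left (hβM j) hC)
      _ = C₀ * (|t| * M) := by ring
      _ ≤ 1 := by linarith
  -- The functions `u d j` are Taylor polynomials of `e^{itφ} - 1`, which unlike the exponential
  -- have controlled BV norm. The estimate does not depend on the degree `d`, so dominated
  -- convergence yields the result for the exponentials.
  obtain ⟨u, hu⟩ : ∃ u : ℕ → ℕ → X → ℂ, u = fun d (j : ℕ) x => ∑ r ∈ Finset.range d,
    ((Complex.I * t) * (φ (ω j) x : ℂ)) ^ (r + 1) / ((r + 1).factorial : ℂ) := ⟨_, rfl⟩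
  have hum : ∀ d j, Measurable (u d j) := by
    intro d j
    rw [hu]
    refine Finset.measurable_sum _ fun r _ => ?_
    have := Complex.measurable_ofReal.comp (hφm (ω j))
    exact ((this.const_mul _).pow_const _).div_const _
  have hnc : ‖Complex.I * (t : ℂ)‖ = |t| := by simp
  have hub : ∀ d j, BVBound m v (u d j) (2 * (|t| * β j)) := by
    intro d j
    rw [hu, ← hnc]
    refine (hβ j).taylor hv _ ?_ d
    rw [hnc]
    have : |t| * β j ≤ |t| * M := by gcongr; exact hβM j
    have := mul_le_mul_of_nonneg_left this hC
    linarith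
  have hKu : ∀ j : ℕ, K (shift j ω) * (2 * (|t| * β j)) ≤ 2 * |t| * M := by
    intro j
    have := mul_le_mul_of_nonneg_left (hKβ j) ht0
    linarith
  have hclose : ∀ d (j : ℕ) x, ‖cis (t * φ (ω j) x) - (1 + u d j x)‖ ≤ 2 / ((d : ℝ) + 1) := by
    intro d j x
    have := norm_cis_sub_taylor_le (hφt j x) d
    rw [hu]
    push_cast at this
    simpa only [mul_assoc] using this
  have hdlim : Tendsto (fun d : ℕ => 2 / ((d : ℝ) + 1)) atTop (𝓝 0) := by
    simpa [div_eq_mul_inv] using (tendsto_one_div_add_atTop_nhds_zero_nat (𝕜 := ℝ)).const_mul 2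
  -- The exact factors have modulus 1, so for the fixed `N` a large degree keeps all partial
  -- products below 2.
  have hev : ∀ᶠ d : ℕ in atTop, ∀ n ≤ N, ∀ x, ‖prodAlong T ω (u d) n x‖ ≤ 2 := by
    have hl : Tendsto (fun d : ℕ => (1 + 2 / ((d : ℝ) + 1)) ^ N) atTop (𝓝 1) := by
      simpa using (hdlim.const_add 1).pow N
    filter_upwards [hl.eventually_le_const (show (1 : ℝ) < 2 by norm_num)] with d hd n hn x
    have hd0 : 0 ≤ 2 / ((d : ℝ) + 1) := by positivity
    have hb : ∀ j ∈ Finset.range n, ‖1 + u d j (cocycle T ω j x)‖ ≤ 1 + 2 / ((d : ℝ) + 1) := by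
      intro j _
      have h1 := hclose d j (cocycle T ω j x)
      have h2 := norm_sub_norm_le (1 + u d j (cocycle T ω j x)) (cis (t * φ (ω j) (cocycle T ω j x)))
      rw [norm_sub_rev, norm_cis] at h2
      linarith
    rw [prodAlong, norm_prod]
    refine (Finset.prod_le_prod (fun _ _ => norm_nonneg _) hb).trans ?_
    rw [Finset.prod_const, Finset.card_range]
    exact (pow_le_pow_right₀ (by linarith) hn).trans hd
  have hpt : ∀ x, Tendsto (fun d => prodAlong T ω (u d) N x) atTop
      (𝓝 (cis (t * birkhoffSum (skew T) (observable φ) N (ω, x)))) := by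
    intro x
    rw [cis_birkhoffSum]
    refine tendsto_finsetProd _ fun j _ => ?_
    rw [observable_iterate_skew, tendsto_iff_norm_sub_tendsto_zero]
    refine squeeze_zero (fun _ => norm_nonneg _) (fun d => ?_) hdlim
    rw [norm_sub_rev]
    exact hclose d j _
  have hq0 : 0 ≤ q := by
    have := nonempty_of_isProbabilityMeasure m
    exact (norm_nonneg _).trans (hq (Classical.arbitrary X))
  have hlimg : ∀ g : X → ℂ, Measurable g → ∀ p : ℝ, (∀ x, ‖g x‖ ≤ p) →
      Tendsto (fun d => ∫ x, prodAlong T ω (u d) N x * g x ∂(fibreMeasure m h ω)) atTop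
      (𝓝 (∫ x, cis (t * birkhoffSum (skew T) (observable φ) N (ω, x)) * g x
        ∂(fibreMeasure m h ω))) := by
    intro g hg p hp
    refine tendsto_integral_filter_of_dominated_convergence (fun _ => 2 * p) ?_ ?_
      (integrable_const _) ?_
    · exact Eventually.of_forall fun d =>
        ((measurable_prodAlong hT (hum d) N).mul hg).aestronglyMeasurable
    · filter_upwards [hev] with d hd
      refine Eventually.of_forall fun x => ?_
      rw [norm_mul]
      exact mul_le_mul (hd N le_rfl x) (hp x) (norm_nonneg _) (by norm_num)
    · exact Eventually.of_forall fun x => (hpt x).mul_const _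
  have hl1 := hlimg _ (hf.comp (measurable_cocycle hT ω (N + k))) q fun x => hq _
  have hl2 := hlimg (fun _ => 1) measurable_const 1 (fun _ => by simp)
  simp only [mul_one] at hl2
  have hl3 := (hl1.sub (hl2.mul_const (∫ x, f x ∂(fibreMeasure m h
    (shift ((N + k : ℕ) : ℤ) ω))))).norm
  refine le_of_tendsto hl3 ?_
  filter_upwards [hev] with d hd
  -- With `κ = 2|t|M`, the smallness of `t` is exactly the bootstrap condition `8 C₀ κ / (1 -
  -- e^{-λ}) ≤ 2`.
  obtain ⟨w, hw, hwf⟩ := hω.exists_push_prod hv hT hlam (κ := 2 * |t| * M) (by positivity) (hum d)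
    (hub d) hKu (by rw [div_le_iff₀ h1e]; linarith) hd N le_rfl k
  simp only [Function.comp]
  rw [hwf f hf q hq, add_sub_cancel_left]
  refine ((hω _).norm_integral_le (q := C₀ * (8 * C₀ * (2 * |t| * M) / (1 - Real.exp (-lam)) *
    Real.exp (-lam * k)) * q) fun x => ?_).trans (le_of_eq (by ring))
  rw [norm_mul]
  exact mul_le_mul (hw.norm_le hv x) (hq x) (norm_nonneg _)
    ((norm_nonneg _).trans (hw.norm_le hv x))

/-- Decay of correlations on the fibres. -/
theorem IsGoodPoint.norm_covariance_le (hω : IsGoodPoint m v T h K lam ε ω)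
    (hv : IsVariation m v C₀) (hT : ∀ y, Measure.QuasiMeasurePreserving (T y) m m)
    (hφ : HasScaledBound m v K φ M ω) (n : ℕ) {f : X → ℂ} (hf : Measurable f) {q : ℝ}
    (hq : ∀ x, ‖f x‖ ≤ q) :
    ‖∫ x, (φ (ω 0) x : ℂ) * f (cocycle T ω n x) ∂(fibreMeasure m h ω)
      - (∫ x, (φ (ω 0) x : ℂ) ∂(fibreMeasure m h ω)) *
        ∫ x, f x ∂(fibreMeasure m h (shift n ω))‖
      ≤ C₀ * (M * Real.exp (-lam * n)) * q := by
  have hC := zero_le_one.trans hv.one_le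
  obtain ⟨β, hβ, hKβ⟩ := hφ 0
  rw [shift_zero] at hKβ
  obtain ⟨w, hw, hwf⟩ := hω.exists_push hv hT hβ n
  have hw' := hw.mono (mul_le_mul_of_nonneg_right hKβ (Real.exp_nonneg _))
  rw [hwf f hf q hq, add_sub_cancel_left]
  refine (hω _).norm_integral_le fun x => ?_
  rw [norm_mul]
  exact mul_le_mul (hw'.norm_le hv x) (hq x) (norm_nonneg _)
    ((norm_nonneg _).trans (hw'.norm_le hv x))

/-- The fibre measures are approximated by images of `m`. -/
theorem IsGoodPoint.norm_integral_sub_integral_cocycle_le (hω : IsGoodPoint m v T h K lam ε ω)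
    (hT : ∀ y, Measure.QuasiMeasurePreserving (T y) m m) (n : ℕ) {f : X → ℂ} (hf : Measurable f)
    {q : ℝ} (hq : ∀ x, ‖f x‖ ≤ q) :
    ‖∫ x, f x ∂(fibreMeasure m h (shift n ω)) - ∫ x, f (cocycle T ω n x) ∂m‖
      ≤ q * (K ω * Real.exp (-lam * n)) := by
  have hK := hω.fibre.one_le_K
  obtain ⟨u, hu, hb⟩ := hω.fibre.exp_transfer n
  obtain ⟨hi, hd⟩ := transferIter_duality (ω := ω) hT (integrable_const (1 : ℂ)) n
  have hui : Integrable u m := hi.congr hu.symm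
  have hh := (hω n).integrable_h.ofReal (𝕜 := ℂ)
  have h1 := hd f hf q hq
  simp only [one_mul] at h1
  have hbd : ∀ᵐ x ∂m, ‖f x‖ ≤ q := Eventually.of_forall hq
  have i1 : Integrable (fun x => u x * f x) m := hui.mul_bdd hf.aestronglyMeasurable hbd
  have i2 : Integrable (fun x => f x * (h (shift n ω, x) : ℂ)) m :=
    hh.bdd_mul hf.aestronglyMeasurable hbd
  have i3 : Integrable (fun x => u x - (h (shift n ω, x) : ℂ)) m := hui.sub hh
  have h2 : ∫ x, transferIter m T ω n (fun _ => 1) x * f x ∂m = ∫ x, u x * f x ∂m := by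
    refine integral_congr_ae ?_
    filter_upwards [hu] with x hx
    rw [hx]
  rw [h1, h2, (hω n).integral_fibreMeasure, norm_sub_rev, ← integral_sub i1 i2]
  have hL : ∫ x, ‖u x - (h (shift n ω, x) : ℂ)‖ ∂m ≤ K ω * Real.exp (-lam * n) := by
    rw [integral_norm_eq_lintegral_enorm i3.1]
    exact ENNReal.toReal_le_of_le_ofReal (by positivity) (le_self_add.trans hb)
  calc _ ≤ ∫ x, q * ‖u x - (h (shift n ω, x) : ℂ)‖ ∂m := by
        refine norm_integral_le_of_norm_le (i3.norm.const_mul q) (Eventually.of_forall fun x => ?_)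
        rw [show u x * f x - f x * (h (shift n ω, x) : ℂ) = f x * (u x - (h (shift n ω, x) : ℂ)) by
          ring, norm_mul]
        exact mul_le_mul_of_nonneg_right (hq x) (norm_nonneg _)
    _ = q * ∫ x, ‖u x - (h (shift n ω, x) : ℂ)‖ ∂m := integral_const_mul _ _
    _ ≤ _ := by
        have := nonempty_of_isProbabilityMeasure m
        exact mul_le_mul_of_nonneg_left hL ((norm_nonneg _).trans (hq (Classical.arbitrary X)))

end FibreObservable

end RandomMaps

/-! ### Mixing of the driving process and disintegration. -/

namespace RandomMaps

section Driving

variable {Ω₀ Y : Type*} [MeasurableSpace Ω₀] [MeasurableSpace Y] {P₀ : Measure Ω₀}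
  {ξ : ℤ → Ω₀ → Y}

theorem measurable_shift (n : ℤ) : Measurable (shift n : (ℤ → Y) → ℤ → Y) :=
  measurable_pi_iff.2 fun _ => measurable_pi_apply _

theorem IsStationary.measurable_path (hξ : IsStationary P₀ ξ) : Measurable fun w j => ξ j w :=
  measurable_pi_iff.2 hξ.measurable

theorem IsStationary.isProbabilityMeasure [IsProbabilityMeasure P₀] (hξ : IsStationary P₀ ξ) :
    IsProbabilityMeasure (pathLaw P₀ ξ) :=
  Measure.isProbabilityMeasure_map hξ.measurable_path.aemeasurable

theorem measurePreserving_shift {P : Measure (ℤ → Y)} (hP : P.map (shift 1) = P) (n : ℤ) :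
    MeasurePreserving (shift n) P P := by
  have hnat : ∀ n : ℕ, MeasurePreserving (shift n) P P := by
    intro n
    induction n with
    | zero =>
      rw [show (shift ((0 : ℕ) : ℤ) : (ℤ → Y) → ℤ → Y) = id from funext shift_zero]
      exact MeasurePreserving.id P
    | succ n ih =>
      have h1 : MeasurePreserving (shift 1) P P := ⟨measurable_shift 1, hP⟩
      have := h1.comp ih
      rwa [show shift 1 ∘ shift (n : ℤ) = (shift ((n + 1 : ℕ) : ℤ) : (ℤ → Y) → ℤ → Y) from
        funext fun ω => by simp [Function.comp, shift_shift, add_comm]] at this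
  obtain ⟨k, rfl | rfl⟩ := n.eq_nat_or_neg
  · exact hnat k
  · refine ⟨measurable_shift _, ?_⟩
    conv_lhs => rw [← (hnat k).map_eq]
    rw [Measure.map_map (measurable_shift _) (measurable_shift _)]
    rw [show shift (-(k : ℤ)) ∘ shift (k : ℤ) = (id : (ℤ → Y) → ℤ → Y) from
        funext fun ω => by simp [Function.comp, shift_shift, shift_zero]]
    exact Measure.map_id

theorem ae_forall_shift {P : Measure (ℤ → Y)} (hP : P.map (shift 1) = P) {p : (ℤ → Y) → Prop}
    (hp : ∀ᵐ ω ∂P, p ω) : ∀ᵐ ω ∂P, ∀ j : ℤ, p (shift j ω) :=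
  ae_all_iff.2 fun j => (measurePreserving_shift hP j).quasiMeasurePreserving.ae hp

theorem abs_measureReal_inter_sub_le [IsProbabilityMeasure P₀] (A B : Set Ω₀) :
    |P₀.real (A ∩ B) - P₀.real A * P₀.real B| ≤ 1 := by
  have h1 : P₀.real (A ∩ B) ≤ 1 := measureReal_le_one
  have h2 : P₀.real A * P₀.real B ≤ 1 :=
    mul_le_one₀ measureReal_le_one measureReal_nonneg measureReal_le_one
  have h3 : 0 ≤ P₀.real (A ∩ B) := measureReal_nonneg
  have h4 : 0 ≤ P₀.real A * P₀.real B := mul_nonneg measureReal_nonneg measureReal_nonneg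
  rw [abs_le]
  constructor <;> linarith

/-- The coefficients are real suprema, which dominate their members only when bounded above; the
bound 1 secures this. -/
theorem alphaDep_le_one {Ω₀ : Type*} (𝒢 ℋ : MeasurableSpace Ω₀) [MeasurableSpace Ω₀]
    {P₀ : Measure Ω₀} [IsProbabilityMeasure P₀] : alphaDep P₀ 𝒢 ℋ ≤ 1 := by
  refine csSup_le ⟨_, ∅, ∅, @MeasurableSet.empty _ 𝒢, @MeasurableSet.empty _ ℋ, rfl⟩ ?_
  rintro _ ⟨A, B, -, -, rfl⟩
  exact abs_measureReal_inter_sub_le A B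

theorem abs_measureReal_inter_sub_le_alphaCoeff [IsProbabilityMeasure P₀] {k : ℤ} {n : ℕ}
    {A B : Set Ω₀} (hA : MeasurableSet[pastAlgebra ξ k] A)
    (hB : MeasurableSet[futureAlgebra ξ (k + n)] B) :
    |P₀.real (A ∩ B) - P₀.real A * P₀.real B| ≤ alphaCoeff P₀ ξ n := by
  refine le_trans ?_ (le_ciSup (f := fun k : ℤ => alphaDep P₀ (pastAlgebra ξ k)
    (futureAlgebra ξ (k + n))) ⟨1, by rintro _ ⟨k, rfl⟩; exact alphaDep_le_one _ _⟩ k)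
  refine le_csSup ⟨1, ?_⟩ ⟨A, B, hA, hB, rfl⟩
  rintro _ ⟨A, B, -, -, rfl⟩
  exact abs_measureReal_inter_sub_le A B

theorem alphaCoeff_nonneg [IsProbabilityMeasure P₀] (n : ℕ) : 0 ≤ alphaCoeff P₀ ξ n :=
  (abs_nonneg _).trans (abs_measureReal_inter_sub_le_alphaCoeff (k := 0) (A := ∅) (B := ∅)
    (@MeasurableSet.empty _ (pastAlgebra ξ 0)) (@MeasurableSet.empty _ (futureAlgebra ξ (0 + n))))

/-- The covariance inequality for functions of the past and of the future of the process. -/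
theorem IsStationary.norm_cov_le [IsProbabilityMeasure P₀] (hξ : IsStationary P₀ ξ) {a : ℤ} {n : ℕ}
    {f g : (ℤ → Y) → ℂ} (hf : Measurable f) (hg : Measurable g) {p q : ℝ} (hp : 0 < p) (hq : 0 < q)
    (hfp : ∀ ω, ‖f ω‖ ≤ p) (hgq : ∀ ω, ‖g ω‖ ≤ q)
    (hfa : ∀ ω ω', (∀ j ≤ a, ω j = ω' j) → f ω = f ω')
    (hga : ∀ ω ω', (∀ j ≥ a + n, ω j = ω' j) → g ω = g ω') :
    ‖∫ ω, f ω * g ω ∂(pathLaw P₀ ξ) - (∫ ω, f ω ∂(pathLaw P₀ ξ)) * ∫ ω, g ω ∂(pathLaw P₀ ξ)‖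
      ≤ 16 * p * q * alphaCoeff P₀ ξ n := by
  have hpm := hξ.measurable_path
  rw [pathLaw, integral_map (f := fun ω => f ω * g ω) hpm.aemeasurable (hf.mul hg).aestronglyMeasurable,
    integral_map hpm.aemeasurable hf.aestronglyMeasurable,
    integral_map hpm.aemeasurable hg.aestronglyMeasurable]
  have hle : ∀ j, MeasurableSpace.comap (ξ j) inferInstance ≤ (inferInstance : MeasurableSpace Ω₀) :=
    fun j => (hξ.measurable j).comap_le
  refine norm_cov_le_of_bounded (𝒢 := pastAlgebra ξ a) (ℋ := futureAlgebra ξ (a + n))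
    (iSup₂_le fun j _ => hle j) (iSup₂_le fun j _ => hle j)
    (fun A B hA hB => abs_measureReal_inter_sub_le_alphaCoeff hA hB) ?_ ?_ hp hq
    (fun w => hfp _) (fun w => hgq _)
  -- Clamping the indices at `a` changes nothing for a function of the past, and exhibits it as a
  -- measurable function of the variables `ξ j` with `j ≤ a`.
  · have e : (fun w => f fun j => ξ j w) = f ∘ fun w j => ξ (min j a) w :=
      funext fun w => hfa _ _ fun j hj => by beta_reduce; rw [min_eq_left hj]
    rw [e]
    refine hf.comp (@measurable_pi_iff _ _ _ (_) _ _ |>.2 fun j => ?_)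
    exact measurable_iff_comap_le.2
      (le_iSup₂_of_le (f := fun j (_ : j ≤ a) => MeasurableSpace.comap (ξ j) inferInstance)
        (min j a) (min_le_right _ _) le_rfl)
  · have e : (fun w => g fun j => ξ j w) = g ∘ fun w j => ξ (max j (a + n)) w :=
      funext fun w => hga _ _ fun j hj => by beta_reduce; rw [max_eq_left hj]
    rw [e]
    refine hg.comp (@measurable_pi_iff _ _ _ (_) _ _ |>.2 fun j => ?_)
    exact measurable_iff_comap_le.2
      (le_iSup₂_of_le (f := fun j (_ : a + n ≤ j) => MeasurableSpace.comap (ξ j) inferInstance)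
        (max j (a + n)) (le_max_right _ _) le_rfl)

end Driving

section Disintegration

variable {X Y : Type*} [MeasurableSpace X] [MeasurableSpace Y] {m : Measure X}
  [IsProbabilityMeasure m] {P : Measure (ℤ → Y)} [IsProbabilityMeasure P] {h : (ℤ → Y) × X → ℝ}

/-- The fibrewise expectation. -/
noncomputable def fibreExp (m : Measure X) (h : (ℤ → Y) × X → ℝ) (F : (ℤ → Y) × X → ℂ)
    (ω : ℤ → Y) : ℂ :=
  ∫ x, F (ω, x) ∂(fibreMeasure m h ω)

omit [IsProbabilityMeasure m] in
theorem fibreExp_eq (hh : Measurable h) (F : (ℤ → Y) × X → ℂ) (ω : ℤ → Y) :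
    fibreExp m h F ω = ∫ x, (ENNReal.ofReal (h (ω, x))).toReal • F (ω, x) ∂m := by
  rw [fibreExp, fibreMeasure, integral_withDensity_eq_integral_toReal_smul
    (f := fun x => ENNReal.ofReal (h (ω, x)))
    (hh.comp measurable_prodMk_left).ennreal_ofReal (by simp)]

theorem measurable_fibreExp (hh : Measurable h) {F : (ℤ → Y) × X → ℂ} (hF : Measurable F) :
    Measurable (fibreExp m h F) := by
  rw [funext (fibreExp_eq hh F)]
  have : Measurable fun p : (ℤ → Y) × X => (ENNReal.ofReal (h p)).toReal • F p :=
    hh.ennreal_ofReal.ennreal_toReal.smul hF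
  exact (this.stronglyMeasurable.integral_prod_right (ν := m)).measurable

theorem integral_skewMeasure (hh : Measurable h) (hprob : IsProbabilityMeasure (skewMeasure P m h))
    {F : (ℤ → Y) × X → ℂ} (hF : Measurable F) {q : ℝ} (hq : ∀ z, ‖F z‖ ≤ q) :
    ∫ z, F z ∂(skewMeasure P m h) = ∫ ω, fibreExp m h F ω ∂P := by
  have hi : Integrable F (skewMeasure P m h) :=
    Integrable.of_bound hF.aestronglyMeasurable q (Eventually.of_forall hq)
  rw [skewMeasure, integrable_withDensity_iff_integrable_smul'
    hh.ennreal_ofReal (by simp)] at hi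
  rw [skewMeasure, integral_withDensity_eq_integral_toReal_smul hh.ennreal_ofReal (by simp),
    integral_prod _ hi]
  simp_rw [fibreExp_eq hh]

end Disintegration

end RandomMaps

/-! ### Decorrelation of fibrewise expectations over the base. -/

namespace RandomMaps

section Annealed

variable {X Y : Type*} [MeasurableSpace X] {m : Measure X} {T : Y → X → X}
  {h : (ℤ → Y) × X → ℝ}

/-- The average of `F(ω, ·)` over the image of `m` under the maps of the last `n` steps. -/
noncomputable def pullAverage (m : Measure X) (T : Y → X → X) (F : (ℤ → Y) × X → ℂ) (n : ℕ)
    (ω : ℤ → Y) : ℂ :=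
  ∫ x, F (ω, cocycle T (shift (-n) ω) n x) ∂m

/-- The pulled-back cocycle reads the coordinates `-n, …, -1`, which belong to the past as soon as
`-1 ≤ a`. -/
theorem pullAverage_congr_past {F : (ℤ → Y) × X → ℂ} {a : ℤ} (ha : -1 ≤ a)
    (hF : ∀ ω ω' x, (∀ j ≤ a, ω j = ω' j) → F (ω, x) = F (ω', x)) (n : ℕ) {ω ω' : ℤ → Y}
    (hω : ∀ j ≤ a, ω j = ω' j) : pullAverage m T F n ω = pullAverage m T F n ω' := by
  unfold pullAverage
  congr 1
  funext x
  rw [hF ω ω' _ hω, cocycle_congr T (ω := shift (-n) ω) (ω' := shift (-n) ω')]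
  intro i _ hi
  exact hω _ (by omega)

theorem pullAverage_congr_future {F : (ℤ → Y) × X → ℂ}
    (hF : ∀ ω ω' x, (∀ j ≥ 0, ω j = ω' j) → F (ω, x) = F (ω', x)) (n : ℕ) {ω ω' : ℤ → Y}
    (hω : ∀ j ≥ -(n : ℤ), ω j = ω' j) : pullAverage m T F n ω = pullAverage m T F n ω' := by
  unfold pullAverage
  congr 1
  funext x
  rw [hF ω ω' _ fun j hj => hω j (by omega),
    cocycle_congr T (ω := shift (-n) ω) (ω' := shift (-n) ω')]
  intro i hi _
  exact hω _ (by omega)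

theorem measurable_pullAverage [MeasurableSpace Y] [IsProbabilityMeasure m]
    (hT : Measurable (skew T)) {F : (ℤ → Y) × X → ℂ}
    (hF : Measurable F) (n : ℕ) : Measurable (pullAverage m T F n) := by
  have h1 : Measurable fun z : (ℤ → Y) × X => ((skew T)^[n] (shift (-n) z.1, z.2)).2 :=
    measurable_snd.comp ((hT.iterate n).comp
      (((measurable_shift _).comp measurable_fst).prodMk measurable_snd))
  simp_rw [iterate_skew] at h1
  have h2 : Measurable fun z : (ℤ → Y) × X => F (z.1, cocycle T (shift (-n) z.1) n z.2) :=
    hF.comp (measurable_fst.prodMk h1)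
  exact (h2.stronglyMeasurable.integral_prod_right (ν := m)).measurable

theorem norm_pullAverage_le [IsProbabilityMeasure m] {F : (ℤ → Y) × X → ℂ} {p : ℝ}
    (hF : ∀ z, ‖F z‖ ≤ p) (n : ℕ) (ω : ℤ → Y) : ‖pullAverage m T F n ω‖ ≤ p := by
  simpa using! norm_integral_le_of_norm_le_const (μ := m)
    (Eventually.of_forall fun x => hF (ω, cocycle T (shift (-n) ω) n x))

variable [IsProbabilityMeasure m] {v : (X → ℂ) → ℝ≥0∞} {C₀ : ℝ} {K : (ℤ → Y) → ℝ} {lam ε M : ℝ}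
  {φ : Y → X → ℝ} {ω : ℤ → Y}

/-- The measure `μ_ω` is approximated by the image of `m` under the `n` maps that lead from
`σ^{-n}ω` to `ω`, so the constant `K` is evaluated at the starting point `σ^{-n}ω`. -/
theorem IsGoodPoint.norm_fibreExp_sub_pullAverage_le (hω : IsGoodPoint m v T h K lam ε ω)
    (hT : ∀ y, Measure.QuasiMeasurePreserving (T y) m m) {F : (ℤ → Y) × X → ℂ}
    (hF : Measurable fun x => F (ω, x)) {q : ℝ} (hq : ∀ x, ‖F (ω, x)‖ ≤ q) (n : ℕ) :
    ‖fibreExp m h F ω - pullAverage m T F n ω‖ ≤ q * (K (shift (-n) ω) * Real.exp (-lam * n)) := by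
  have h1 := (hω.comp_shift (-n)).norm_integral_sub_integral_cocycle_le hT n hF hq
  rw [shift_shift, add_neg_cancel, shift_zero] at h1
  exact h1

/-- Functions of the past: the fibrewise expectations are limits of averages which depend on the
past only. -/
theorem IsGoodPoint.tendsto_pullAverage (hω : IsGoodPoint m v T h K lam ε ω) (hεl : ε < lam)
    (hT : ∀ y, Measure.QuasiMeasurePreserving (T y) m m) {F : (ℤ → Y) × X → ℂ}
    (hF : Measurable fun x => F (ω, x)) {q : ℝ} (hq : ∀ x, ‖F (ω, x)‖ ≤ q) :
    Tendsto (fun n => pullAverage m T F n ω) atTop (𝓝 (fibreExp m h F ω)) := by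
  rw [tendsto_iff_norm_sub_tendsto_zero]
  have hq0 : 0 ≤ q := by
    have := nonempty_of_isProbabilityMeasure m
    exact (norm_nonneg _).trans (hq (Classical.arbitrary X))
  have hl : Tendsto (fun n : ℕ => q * (K ω * Real.exp (ε - lam) ^ n)) atTop (𝓝 0) := by
    have := tendsto_pow_atTop_nhds_zero_of_lt_one (Real.exp_nonneg (ε - lam))
      (Real.exp_lt_one_iff.2 (by linarith))
    simpa using (this.const_mul (K ω)).const_mul q
  refine squeeze_zero (fun _ => norm_nonneg _) (fun n => ?_) hl
  rw [norm_sub_rev]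
  refine (hω.norm_fibreExp_sub_pullAverage_le hT hF hq n).trans (mul_le_mul_of_nonneg_left ?_ hq0)
  have h1 := (hω.fibre.slowly_varying (-n)).2
  calc K (shift (-n) ω) * Real.exp (-lam * n)
      ≤ K ω * Real.exp (ε * |((-n : ℤ) : ℝ)|) * Real.exp (-lam * n) := by gcongr
    _ = K ω * Real.exp (ε - lam) ^ n := by
        rw [mul_assoc, ← Real.exp_add, ← Real.exp_nat_mul]
        congr 2
        push_cast
        rw [abs_neg, Nat.abs_cast]
        ring

/-- Functions of the future which are small together with the observable: the weights in the bound
on the observable make the approximation uniform in `ω`. -/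
theorem IsGoodPoint.norm_fibreExp_sub_pullAverage_le_of_weight
    (hω : IsGoodPoint m v T h K lam ε ω) (hv : IsVariation m v C₀) (hε : 0 < ε)
    (hT : ∀ y, Measure.QuasiMeasurePreserving (T y) m m) (hM : 0 ≤ M)
    (hφ : HasScaledBound m v K φ M ω)
    {G : (ℤ → Y) × X → ℂ} (hG : Measurable fun x => G (ω, x)) {Q : ℝ} (hQ : 0 ≤ Q) {k : ℕ}
    (hGφ : ∀ x, ‖G (ω, x)‖ ≤ Q * ∑ i ∈ Finset.range k, |φ (ω i) (cocycle T ω i x)|) (l : ℕ) :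
    ‖fibreExp m h G ω - pullAverage m T G l ω‖
      ≤ Q * (C₀ * M * k * Real.exp (ε * (l + k) - lam * l)) := by
  have hC := zero_le_one.trans hv.one_le
  choose β hβ hKβ using hφ
  have h1 : ∀ x, ‖G (ω, x)‖ ≤ Q * ∑ i ∈ Finset.range k, C₀ * β i := by
    intro x
    refine (hGφ x).trans (mul_le_mul_of_nonneg_left (Finset.sum_le_sum fun i _ => ?_) hQ)
    simpa using (hβ i).norm_le hv (cocycle T ω i x)
  refine (hω.norm_fibreExp_sub_pullAverage_le hT hG h1 l).trans ?_
  rw [mul_assoc, Finset.sum_mul]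
  gcongr
  -- Slow variation gives `K(σ^{-l}ω) ≤ K(σ^iω) e^{ε(l+i)}`, and `K(σ^iω) β i ≤ M`. The unbounded
  -- `K` thus cancels against the observable at time `i`.
  have h2 : ∀ i ∈ Finset.range k, C₀ * β i * (K (shift (-l) ω) * Real.exp (-lam * l))
      ≤ C₀ * M * Real.exp (ε * (l + k) - lam * l) := by
    intro i hi
    rw [Finset.mem_range] at hi
    have h3 := ((hω i).slowly_varying (-(l : ℤ) - i)).2
    rw [shift_shift, sub_add_cancel] at h3
    have hb := (hβ i).2
    have hK0 : 0 ≤ K (shift i ω) := zero_le_one.trans (hω i).one_le_K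
    have h4 : |((-(l : ℤ) - i : ℤ) : ℝ)| = (l : ℝ) + i := by
      push_cast
      rw [show -(l : ℝ) - i = -((l : ℝ) + i) by ring, abs_neg, abs_of_nonneg (by positivity)]
    rw [h4] at h3
    have hik : (i : ℝ) ≤ k := by exact_mod_cast hi.le
    calc C₀ * β i * (K (shift (-l) ω) * Real.exp (-lam * l))
        ≤ C₀ * β i * (K (shift i ω) * Real.exp (ε * (l + i)) * Real.exp (-lam * l)) := by gcongr
      _ = C₀ * (K (shift i ω) * β i) * Real.exp (ε * (l + i) - lam * l) := by
          rw [mul_assoc (K _), ← Real.exp_add]; ring_nf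
      _ ≤ C₀ * M * Real.exp (ε * (l + k) - lam * l) := by
          gcongr
          exact hKβ i
  refine (Finset.sum_le_sum h2).trans (le_of_eq ?_)
  rw [Finset.sum_const, Finset.card_range, nsmul_eq_mul]
  ring

variable [MeasurableSpace Y] {P : Measure (ℤ → Y)} [IsProbabilityMeasure P]

set_option maxHeartbeats 400000 in
/-- Decorrelation of the fibrewise expectations of a function of the past and a function of the
future. -/
theorem norm_integral_fibreExp_mul_sub_le (hP : P.map (shift 1) = P) (hv : IsVariation m v C₀)
    (hT : ∀ y, Measure.QuasiMeasurePreserving (T y) m m) (hskew : Measurable (skew T))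
    (hh : Measurable h) (hε : 0 < ε) (hεl : ε < lam)
    (hgood : ∀ᵐ ω ∂P, IsGoodPoint m v T h K lam ε ω) (hM : 0 ≤ M)
    (hφ : ∀ᵐ ω ∂P, HasScaledBound m v K φ M ω)
    {F G : (ℤ → Y) × X → ℂ} (hF : Measurable F) (hG : Measurable G) {p q : ℝ} (hp : ∀ z, ‖F z‖ ≤ p)
    (hq : ∀ z, ‖G z‖ ≤ q) {a b : ℤ} (ha : -1 ≤ a)
    (hFa : ∀ ω ω' x, (∀ j ≤ a, ω j = ω' j) → F (ω, x) = F (ω', x))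
    (hG0 : ∀ ω ω' x, (∀ j ≥ 0, ω j = ω' j) → G (ω, x) = G (ω', x))
    {Q : ℝ} (hQ : 0 ≤ Q) {k : ℕ}
    (hGφ : ∀ ω x, ‖G (ω, x)‖ ≤ Q * ∑ i ∈ Finset.range k, |φ (ω i) (cocycle T ω i x)|) (l : ℕ) {A : ℝ}
    (hcov : ∀ f g : (ℤ → Y) → ℂ, Measurable f → Measurable g → (∀ ω, ‖f ω‖ ≤ p) →
      (∀ ω, ‖g ω‖ ≤ q) → (∀ ω ω', (∀ j ≤ a, ω j = ω' j) → f ω = f ω') →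
      (∀ ω ω', (∀ j ≥ b - l, ω j = ω' j) → g ω = g ω') →
      ‖∫ ω, f ω * g ω ∂P - (∫ ω, f ω ∂P) * ∫ ω, g ω ∂P‖ ≤ A) :
    ‖∫ ω, fibreExp m h F ω * fibreExp m h G (shift b ω) ∂P
        - (∫ ω, fibreExp m h F ω ∂P) * ∫ ω, fibreExp m h G ω ∂P‖
      ≤ A + 2 * p * (Q * (C₀ * M * k * Real.exp (ε * (l + k) - lam * l))) := by
  obtain ⟨δ, hδ⟩ : ∃ δ, δ = Q * (C₀ * M * k * Real.exp (ε * (l + k) - lam * l)) := ⟨_, rfl⟩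
  rw [← hδ]
  obtain ⟨f, hf⟩ : ∃ f, f = fibreExp m h F := ⟨_, rfl⟩
  obtain ⟨γ, hγ⟩ : ∃ γ, γ = fibreExp m h G := ⟨_, rfl⟩
  -- The substitute for the future expectation depends on the coordinates from `b - l` on only, so
  -- α-mixing applies to it.
  obtain ⟨g, hg⟩ : ∃ g : (ℤ → Y) → ℂ, g = fun ω => pullAverage m T G l (shift b ω) := ⟨_, rfl⟩
  have hsb := measurePreserving_shift hP b
  have hgm : Measurable g := by
    rw [hg]; exact (measurable_pullAverage hskew hG l).comp (measurable_shift b)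
  have hfm : Measurable f := hf ▸ measurable_fibreExp hh hF
  have hγm : Measurable γ := hγ ▸ measurable_fibreExp hh hG
  have hγbm : Measurable fun ω => γ (shift b ω) := hγm.comp (measurable_shift b)
  have hgq : ∀ ω, ‖g ω‖ ≤ q := fun ω => by rw [hg]; exact norm_pullAverage_le hq l _
  have hfp : ∀ᵐ ω ∂P, ‖f ω‖ ≤ p := by
    filter_upwards [hgood] with ω hω
    rw [hf]
    exact hω.fibre.norm_integral_le fun x => hp _
  have hgγ : ∀ᵐ ω ∂P, ‖γ (shift b ω) - g ω‖ ≤ δ := by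
    refine hsb.quasiMeasurePreserving.ae (p := fun ω => ‖γ ω - pullAverage m T G l ω‖ ≤ δ) ?_ |>.mono
      fun ω hω => by rw [hg]; exact hω
    filter_upwards [hgood, hφ] with ω hω hφω
    rw [hδ, hγ]
    exact hω.norm_fibreExp_sub_pullAverage_le_of_weight hv hε hT hM hφω
      (hG.comp measurable_prodMk_left) hQ (hGφ ω) l
  have hp0 : 0 ≤ p := by
    have := nonempty_of_isProbabilityMeasure m
    obtain ⟨ω₀⟩ := nonempty_of_isProbabilityMeasure P
    exact (norm_nonneg _).trans (hp (ω₀, Classical.arbitrary X))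
  have hδ0 : 0 ≤ δ := by
    obtain ⟨ω, hω⟩ := hgγ.exists
    exact (norm_nonneg _).trans hω
  -- No rate is needed on the side of the past: every pulled-back average is a function of the
  -- coordinates up to `a`, so the covariance bound passes to the limit. Only `g` is approximated
  -- with an error.
  have hlim : ‖∫ ω, f ω * g ω ∂P - (∫ ω, f ω ∂P) * ∫ ω, g ω ∂P‖ ≤ A := by
    have hA : ∀ n, ‖∫ ω, pullAverage m T F n ω * g ω ∂P
        - (∫ ω, pullAverage m T F n ω ∂P) * ∫ ω, g ω ∂P‖ ≤ A := fun n =>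
      hcov _ g (measurable_pullAverage hskew hF n) hgm (norm_pullAverage_le hp n) hgq
        (fun ω ω' h1 => pullAverage_congr_past ha hFa n h1)
        (fun ω ω' h1 => by
          rw [hg]
          exact pullAverage_congr_future hG0 l fun j hj => h1 _ (by omega))
    have hpt : ∀ᵐ ω ∂P, Tendsto (fun n => pullAverage m T F n ω) atTop (𝓝 (f ω)) := by
      filter_upwards [hgood] with ω hω
      rw [hf]
      exact hω.tendsto_pullAverage hεl hT (hF.comp measurable_prodMk_left) fun x => hp _
    have l1 : Tendsto (fun n => ∫ ω, pullAverage m T F n ω * g ω ∂P) atTop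
        (𝓝 (∫ ω, f ω * g ω ∂P)) := by
      refine tendsto_integral_of_dominated_convergence (fun _ => p * q)
        (fun n => ((measurable_pullAverage hskew hF n).mul hgm).aestronglyMeasurable)
        (integrable_const _) (fun n => Eventually.of_forall fun ω => ?_) ?_
      · rw [norm_mul]
        exact mul_le_mul (norm_pullAverage_le hp n ω) (hgq ω) (norm_nonneg _) hp0
      · filter_upwards [hpt] with ω hω
        exact hω.mul_const _
    have l2 : Tendsto (fun n => ∫ ω, pullAverage m T F n ω ∂P) atTop (𝓝 (∫ ω, f ω ∂P)) :=
      tendsto_integral_of_dominated_convergence (fun _ => p)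
        (fun n => (measurable_pullAverage hskew hF n).aestronglyMeasurable)
        (integrable_const _) (fun n => Eventually.of_forall fun ω => norm_pullAverage_le hp n ω) hpt
    exact le_of_tendsto' (l1.sub (l2.mul_const _)).norm hA
  have hγint : ∫ ω, fibreExp m h G ω ∂P = ∫ ω, γ (shift b ω) ∂P := by
    rw [← hγ]
    conv_lhs => rw [← hsb.map_eq]
    exact integral_map hsb.measurable.aemeasurable hγm.aestronglyMeasurable
  rw [hγint, ← hf, ← hγ]
  have ig : Integrable g P := Integrable.of_bound hgm.aestronglyMeasurable q (Eventually.of_forall hgq)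
  have iγ : Integrable (fun ω => γ (shift b ω)) P := by
    refine Integrable.of_bound hγbm.aestronglyMeasurable (q + δ) ?_
    filter_upwards [hgγ] with ω hω
    have := norm_add_le (g ω) (γ (shift b ω) - g ω)
    rw [add_sub_cancel] at this
    linarith [hgq ω]
  have ifg : Integrable (fun ω => f ω * g ω) P := ig.bdd_mul hfm.aestronglyMeasurable hfp
  have ifγ : Integrable (fun ω => f ω * γ (shift b ω)) P := iγ.bdd_mul hfm.aestronglyMeasurable hfp
  have e1 : ‖∫ ω, f ω * γ (shift b ω) ∂P - ∫ ω, f ω * g ω ∂P‖ ≤ p * δ := by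
    rw [← integral_sub ifγ ifg]
    have : ∀ᵐ ω ∂P, ‖f ω * γ (shift b ω) - f ω * g ω‖ ≤ p * δ := by
      filter_upwards [hfp, hgγ] with ω h1 h2
      rw [← mul_sub, norm_mul]
      exact mul_le_mul h1 h2 (norm_nonneg _) hp0
    simpa using norm_integral_le_of_norm_le_const this
  have e2 : ‖∫ ω, γ (shift b ω) ∂P - ∫ ω, g ω ∂P‖ ≤ δ := by
    rw [← integral_sub iγ ig]
    simpa using norm_integral_le_of_norm_le_const hgγ
  have e3 : ‖∫ ω, f ω ∂P‖ ≤ p := by simpa using norm_integral_le_of_norm_le_const hfp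
  have e4 : ‖(∫ ω, f ω ∂P) * (∫ ω, γ (shift b ω) ∂P - ∫ ω, g ω ∂P)‖ ≤ p * δ := by
    rw [norm_mul]
    exact mul_le_mul e3 e2 (norm_nonneg _) hp0
  calc _ = ‖(∫ ω, f ω * γ (shift b ω) ∂P - ∫ ω, f ω * g ω ∂P)
        + (∫ ω, f ω * g ω ∂P - (∫ ω, f ω ∂P) * ∫ ω, g ω ∂P)
        - (∫ ω, f ω ∂P) * (∫ ω, γ (shift b ω) ∂P - ∫ ω, g ω ∂P)‖ := by
          congr 1; ring
    _ ≤ p * δ + A + p * δ :=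
        (norm_sub_le _ _).trans (add_le_add ((norm_add_le _ _).trans (add_le_add e1 hlim)) e4)
    _ = _ := by ring

end Annealed

end RandomMaps

/-! ### Decorrelation for the skew product. -/

namespace RandomMaps

section Skew

theorem observable_iterate_congr {X Y : Type*} {T : Y → X → X} {φ : Y → X → ℝ} {ω ω' : ℤ → Y} {n : ℕ} (hω : ∀ j : ℤ, 0 ≤ j → j ≤ n → ω j = ω' j)
    (x : X) : observable φ ((skew T)^[n] (ω, x)) = observable φ ((skew T)^[n] (ω', x)) := by
  rw [observable_iterate_skew, observable_iterate_skew, hω n (by omega) le_rfl,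
    cocycle_congr T fun i h0 hi => hω i h0 hi.le]

theorem birkhoffSum_congr_iterate {Ω : Type*} {τ : Ω → Ω} {φ : Ω → ℝ} {x y : Ω} {n : ℕ}
    (hxy : ∀ i < n, φ (τ^[i] x) = φ (τ^[i] y)) : birkhoffSum τ φ n x = birkhoffSum τ φ n y :=
  Finset.sum_congr rfl fun i hi => hxy i (Finset.mem_range.1 hi)

theorem blockProd_congr_iterate {Ω : Type*} {τ : Ω → Ω} {φ : Ω → ℝ} {x y : Ω} (t : ℝ) (k m : ℕ)
    (hxy : ∀ i, φ (τ^[i] x) = φ (τ^[i] y)) :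
    blockProd τ φ t k m x = blockProd τ φ t k m y := by
  induction m generalizing x y with
  | zero => simp only [blockProd]; rw [show φ x = φ y from hxy 0]
  | succ m ih =>
    rw [blockProd, blockProd, birkhoffSum_congr_iterate fun i _ => hxy i, ih fun i => ?_]
    rw [← Function.iterate_add_apply, ← Function.iterate_add_apply]
    exact hxy _

variable {Ω₀ X Y : Type*} [MeasurableSpace Ω₀] [MeasurableSpace X] [MeasurableSpace Y]
  {P₀ : Measure Ω₀} {ξ : ℤ → Ω₀ → Y} {m : Measure X} {v : (X → ℂ) → ℝ≥0∞} {C₀ : ℝ}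
  {T : Y → X → X} {h : (ℤ → Y) × X → ℝ} {K : (ℤ → Y) → ℝ} {lam : ℝ} {φ : Y → X → ℝ} {M B : ℝ}

/-- Random maps satisfying the standing assumption, with a bounded observable. -/
structure IsAdmissible (P₀ : Measure Ω₀) (ξ : ℤ → Ω₀ → Y) (m : Measure X) (v : (X → ℂ) → ℝ≥0∞)
    (C₀ : ℝ) (T : Y → X → X) (h : (ℤ → Y) × X → ℝ) (K : (ℤ → Y) → ℝ) (lam : ℝ) (φ : Y → X → ℝ)
    (M B : ℝ) : Prop where
  stationary : IsStationary P₀ ξ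
  variation : IsVariation m v C₀
  nonsingular : ∀ y, Measure.QuasiMeasurePreserving (T y) m m
  measurable_skew : Measurable (skew T)
  expanding : IsExpandingOnAverage (pathLaw P₀ ξ) m v T h K lam
  measurable_observable : Measurable (Function.uncurry φ)
  abs_le : ∀ y x, |φ y x| ≤ B
  pos : 0 < B
  nonneg : 0 ≤ M
  scaled : ∀ᵐ ω ∂(pathLaw P₀ ξ), HasScaledBound m v K φ M ω
  integral_eq_zero : ∫ p, observable φ p ∂(skewMeasure (pathLaw P₀ ξ) m h) = 0

theorem measurable_observable' (hφ : Measurable (Function.uncurry φ)) :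
    Measurable (observable φ : (ℤ → Y) × X → ℝ) := by
  have h1 : Measurable fun z : (ℤ → Y) × X => (z.1 0, z.2) :=
    ((measurable_pi_apply 0).comp measurable_fst).prodMk measurable_snd
  exact hφ.comp h1

theorem IsAdmissible.isBoundedCentered (hs : IsAdmissible P₀ ξ m v C₀ T h K lam φ M B) :
    IsBoundedCentered (skewMeasure (pathLaw P₀ ξ) m h) (skew T) (observable φ) B where
  measurePreserving := hs.expanding.invariant
  measurable := measurable_observable' hs.measurable_observable
  bound _ := hs.abs_le _ _
  integral_eq_zero := hs.integral_eq_zero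

theorem IsAdmissible.exists_isGoodPoint (hs : IsAdmissible P₀ ξ m v C₀ T h K lam φ M B) :
    ∃ ε, 0 < ε ∧ ε < lam / 3 ∧ ∀ᵐ ω ∂(pathLaw P₀ ξ), IsGoodPoint m v T h K lam ε ω := by
  have he := hs.expanding
  obtain ⟨ε, hε, hεl, hsl⟩ := he.slowly_varying
  refine ⟨ε, hε, hεl, ae_forall_shift hs.stationary.map_shift ?_⟩
  filter_upwards [hsl, he.integral_h, he.h_pos, he.equivariant, he.exp_transfer,
    he.exp_normTransfer] with ω h1 h2 h3 h4 h5 h6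
  exact ⟨he.measurable_h.comp measurable_prodMk_left, fun x => he.h_nonneg _, h2, h3, h4, h1, h5,
    h6, he.one_le_K ω⟩

variable [IsProbabilityMeasure P₀] [IsProbabilityMeasure m]

/-- Decorrelation of a function of the past and a function of the future for the skew product,
given decorrelation on the fibres. -/
theorem IsAdmissible.norm_integral_mul_comp_sub_le
    (hs : IsAdmissible P₀ ξ m v C₀ T h K lam φ M B)
    {F G : (ℤ → Y) × X → ℂ} (hF : Measurable F) (hG : Measurable G) {p q : ℝ} (hp0 : 0 < p)
    (hq0 : 0 < q) (hp : ∀ z, ‖F z‖ ≤ p) (hq : ∀ z, ‖G z‖ ≤ q) {a : ℤ} (ha : -1 ≤ a)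
    (hFa : ∀ ω ω' x, (∀ j ≤ a, ω j = ω' j) → F (ω, x) = F (ω', x))
    (hG0 : ∀ ω ω' x, (∀ j ≥ 0, ω j = ω' j) → G (ω, x) = G (ω', x))
    {Q : ℝ} (hQ : 0 ≤ Q) {k : ℕ}
    (hGφ : ∀ z, ‖G z‖ ≤ Q * ∑ i ∈ Finset.range k, |observable φ ((skew T)^[i] z)|) {b l n : ℕ}
    (hb : (b : ℤ) - l = a + n) {r : ℝ}
    (hr : ∀ ε, 0 < ε → ε < lam / 3 → Real.exp (ε * (l + k) - lam * l) ≤ r) {A : ℝ}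
    (hfib : ∀ ε, ∀ ω, IsGoodPoint m v T h K lam ε ω → HasScaledBound m v K φ M ω →
      ‖fibreExp m h (fun z => F z * G ((skew T)^[b] z)) ω
        - fibreExp m h F ω * fibreExp m h G (shift b ω)‖ ≤ A) :
    ‖∫ z, F z * G ((skew T)^[b] z) ∂(skewMeasure (pathLaw P₀ ξ) m h)
        - (∫ z, F z ∂(skewMeasure (pathLaw P₀ ξ) m h)) *
          ∫ z, G z ∂(skewMeasure (pathLaw P₀ ξ) m h)‖
      ≤ A + 16 * p * q * alphaCoeff P₀ ξ n + 2 * p * (Q * (C₀ * M * k * r)) := by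
  have hPp := hs.stationary.isProbabilityMeasure
  have hprob := hs.expanding.isProbability
  have hh := hs.expanding.measurable_h
  have hC := zero_le_one.trans hs.variation.one_le
  have hM := hs.nonneg
  obtain ⟨ε, hε, hεl, hgood⟩ := hs.exists_isGoodPoint
  have hlam := hs.expanding.lam_pos
  have hFG : Measurable fun z => F z * G ((skew T)^[b] z) :=
    hF.mul (hG.comp (hs.measurable_skew.iterate b))
  rw [integral_skewMeasure hh hprob hFG (q := p * q) fun z => by
      rw [norm_mul]; exact mul_le_mul (hp _) (hq _) (norm_nonneg _) hp0.le,
    integral_skewMeasure hh hprob hF hp, integral_skewMeasure hh hprob hG hq]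
  -- The base contribution: the past ends at `a` and the approximated future begins at `b - l = a +
  -- n`, which leaves a mixing gap `n`. The fibre contribution `A` is added below.
  have h1 := norm_integral_fibreExp_mul_sub_le hs.stationary.map_shift hs.variation hs.nonsingular
    hs.measurable_skew hh hε (by linarith) hgood hs.nonneg hs.scaled hF hG hp hq ha hFa hG0 hQ
    (k := k) (fun ω x => by
      have := hGφ (ω, x)
      simpa only [observable_iterate_skew] using this) l (b := b)
    (A := 16 * p * q * alphaCoeff P₀ ξ n) (fun f g hf hg hfp hgq hfa hga =>
      hs.stationary.norm_cov_le hf hg hp0 hq0 hfp hgq hfa (by rwa [hb] at hga))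
  have h2 : 2 * p * (Q * (C₀ * M * k * Real.exp (ε * (l + k) - lam * l)))
      ≤ 2 * p * (Q * (C₀ * M * k * r)) := by
    have := hr ε hε hεl
    gcongr
  have hFm := measurable_fibreExp (m := m) hh hF
  have hGm := (measurable_fibreExp (m := m) hh hG).comp (measurable_shift (Y := Y) b)
  have hfp : ∀ᵐ ω ∂(pathLaw P₀ ξ), ‖fibreExp m h F ω‖ ≤ p := by
    filter_upwards [hgood] with ω hω using hω.fibre.norm_integral_le fun x => hp _
  have hgq : ∀ᵐ ω ∂(pathLaw P₀ ξ), ‖fibreExp m h G (shift b ω)‖ ≤ q := by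
    filter_upwards [hgood] with ω hω using (hω b).norm_integral_le fun x => hq _
  have i1 : Integrable (fibreExp m h fun z => F z * G ((skew T)^[b] z)) (pathLaw P₀ ξ) := by
    refine Integrable.of_bound (measurable_fibreExp hh hFG).aestronglyMeasurable (p * q) ?_
    filter_upwards [hgood] with ω hω
    refine hω.fibre.norm_integral_le fun x => ?_
    rw [norm_mul]; exact mul_le_mul (hp _) (hq _) (norm_nonneg _) hp0.le
  have i2 : Integrable (fun ω => fibreExp m h F ω * fibreExp m h G (shift b ω)) (pathLaw P₀ ξ) :=
    (Integrable.of_bound hGm.aestronglyMeasurable q hgq).bdd_mul hFm.aestronglyMeasurable hfp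
  have h3 : ‖∫ ω, fibreExp m h (fun z => F z * G ((skew T)^[b] z)) ω ∂(pathLaw P₀ ξ)
      - ∫ ω, fibreExp m h F ω * fibreExp m h G (shift b ω) ∂(pathLaw P₀ ξ)‖ ≤ A := by
    rw [← integral_sub i1 i2]
    have : ∀ᵐ ω ∂(pathLaw P₀ ξ), ‖fibreExp m h (fun z => F z * G ((skew T)^[b] z)) ω
        - fibreExp m h F ω * fibreExp m h G (shift b ω)‖ ≤ A := by
      filter_upwards [hgood, hs.scaled] with ω h1 h2 using hfib ε ω h1 h2
    have := norm_integral_le_of_norm_le_const this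
    simpa only [probReal_univ, mul_one] using this
  have h4 := norm_add_le _ _ |>.trans (add_le_add h3 (h1.trans (add_le_add le_rfl h2)))
  rw [sub_add_sub_cancel] at h4
  linarith

theorem exp_weight_le {ε lam : ℝ} (hε : ε < lam / 3) (hlam : 0 < lam) {j l : ℕ}
    (hl : 3 * j ≤ 4 * l + 3) :
    Real.exp (ε * (l + (1 : ℕ)) - lam * l) ≤ Real.exp lam * Real.exp (-lam * j / 6) := by
  rw [← Real.exp_add]
  apply Real.exp_le_exp.2
  have h1 : ε * (l + (1 : ℕ)) ≤ lam / 3 * (l + (1 : ℕ)) := by gcongr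
  have h2 : lam * (3 * j : ℝ) ≤ lam * (4 * l + 3) :=
    mul_le_mul_of_nonneg_left (by exact_mod_cast hl) hlam.le
  have h3 : 0 ≤ lam * (j : ℝ) := by positivity
  push_cast at h1 ⊢
  linarith

/-- With `ε < λ/3` and `l ≥ 3k/4` the exponent is at most `λk/3 - 2λl/3 ≤ -λk/6`. This fixes the
division of the gap into about `k/4` for mixing and `3k/4` for approximation. -/
theorem exp_weight_le' {ε lam : ℝ} (hε : ε < lam / 3) (hlam : 0 < lam) {k l : ℕ}
    (hl : 3 * k ≤ 4 * l) : Real.exp (ε * (l + k) - lam * l) ≤ Real.exp (-lam * k / 6) := by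
  apply Real.exp_le_exp.2
  have h1 : ε * (l + k) ≤ lam / 3 * (l + k) := by gcongr
  have h2 : lam * (3 * k : ℝ) ≤ lam * (4 * l) :=
    mul_le_mul_of_nonneg_left (by exact_mod_cast hl) hlam.le
  linarith

/-- Both functions are the observable, with `a = 0`, gap `(j + 3)/4` and the rest of `j` for
approximation. The fibrewise means of `φ` need not vanish, only their average over the base does, so
base mixing is needed here too. -/
theorem IsAdmissible.abs_correlation_le (hs : IsAdmissible P₀ ξ m v C₀ T h K lam φ M B) (j : ℕ)
    (hj : 1 ≤ j) :
    |∫ z, observable φ z * observable φ ((skew T)^[j] z) ∂(skewMeasure (pathLaw P₀ ξ) m h)|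
      ≤ (C₀ * M * B + 16 * B ^ 2 + 2 * B * C₀ * M * Real.exp lam) *
        (Real.exp (-lam * j / 6) + alphaCoeff P₀ ξ ((j + 3) / 4)) := by
  have hC := zero_le_one.trans hs.variation.one_le
  have hM := hs.nonneg
  have hB := hs.pos
  have hlam := hs.expanding.lam_pos
  have hα := alphaCoeff_nonneg (P₀ := P₀) (ξ := ξ) ((j + 3) / 4)
  have hFm : Measurable fun z : (ℤ → Y) × X => (observable φ z : ℂ) :=
    Complex.measurable_ofReal.comp (measurable_observable' hs.measurable_observable)
  have hb : ∀ z : (ℤ → Y) × X, ‖(observable φ z : ℂ)‖ ≤ B := fun z => by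
    rw [Complex.norm_real]; exact hs.abs_le _ _
  have key := hs.norm_integral_mul_comp_sub_le hFm hFm hB hB hb hb (a := 0) (by norm_num)
    (fun ω ω' x hω => by simp [observable, hω 0 le_rfl])
    (fun ω ω' x hω => by simp [observable, hω 0 le_rfl]) (Q := 1) zero_le_one (k := 1)
    (fun z => by simp) (b := j) (l := j - (j + 3) / 4) (n := (j + 3) / 4) (by omega)
    (r := Real.exp lam * Real.exp (-lam * j / 6))
    (fun ε _ hε => exp_weight_le hε hlam (by omega))
    (A := C₀ * (M * Real.exp (-lam * j)) * B) (fun ε ω hω hφ => by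
      have h1 := hω.norm_covariance_le hs.variation hs.nonsingular hφ j
        (f := fun x => (φ (ω j) x : ℂ))
        (Complex.measurable_ofReal.comp (hs.measurable_observable.comp measurable_prodMk_left))
        (q := B) fun x => by simpa using hs.abs_le _ _
      simp only [fibreExp, observable_iterate_skew]
      simpa only [observable, shift, zero_add] using h1)
  have h0 : ∫ z, (observable φ z : ℂ) ∂(skewMeasure (pathLaw P₀ ξ) m h) = 0 := by
    rw [integral_complex_ofReal, hs.integral_eq_zero]; simp
  rw [h0, zero_mul, sub_zero] at key
  simp_rw [← Complex.ofReal_mul] at key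
  rw [integral_complex_ofReal, Complex.norm_real, Real.norm_eq_abs] at key
  refine key.trans ?_
  obtain ⟨e, he⟩ : ∃ e, e = Real.exp (-lam * j / 6) := ⟨_, rfl⟩
  have he0 : 0 ≤ e := he ▸ Real.exp_nonneg _
  have h1 : Real.exp (-lam * j) ≤ e := by
    rw [he]
    apply Real.exp_le_exp.2
    have : 0 ≤ lam * (j : ℝ) := by positivity
    linarith
  rw [← he]
  push_cast
  have h2 : C₀ * (M * Real.exp (-lam * j)) * B ≤ C₀ * (M * e) * B := by gcongr
  have h3 : 0 ≤ (C₀ * M * B + 2 * B * C₀ * M * Real.exp lam) * alphaCoeff P₀ ξ ((j + 3) / 4) := by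
    positivity
  have h4 : 0 ≤ 16 * B ^ 2 * e := by positivity
  linarith

/-- The sum `S_N` reads the coordinates up to `N - 1`, so `a = N - 1`; this equals `-1` when `N =
0`, the reason for allowing that value. The single factor `|t|` comes from the block product. -/
theorem IsAdmissible.norm_decorrelation_le (hs : IsAdmissible P₀ ξ m v C₀ T h K lam φ M B) {t : ℝ}
    (ht : 8 * C₀ * M * |t| ≤ 1 - Real.exp (-lam)) {k : ℕ} (hk : 1 ≤ k) (N i : ℕ) :
    ‖∫ z, cis (t * birkhoffSum (skew T) (observable φ) N z) *
          blockProd (skew T) (observable φ) t k i ((skew T)^[N + k] z)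
          ∂(skewMeasure (pathLaw P₀ ξ) m h)
        - sumCharFun (skewMeasure (pathLaw P₀ ξ) m h) (skew T) (observable φ) t N *
          ∫ z, blockProd (skew T) (observable φ) t k i z ∂(skewMeasure (pathLaw P₀ ξ) m h)‖
      ≤ |t| * 2 ^ i * ((2 * C₀ * B + 16 * B + 2 * C₀ * M) *
        (k * (Real.exp (-lam * k / 6) + alphaCoeff P₀ ξ ((k + 3) / 4)))) := by
  have hC := zero_le_one.trans hs.variation.one_le
  have hM := hs.nonneg
  have hB := hs.pos
  have hlam := hs.expanding.lam_pos
  have hα := alphaCoeff_nonneg (P₀ := P₀) (ξ := ξ) ((k + 3) / 4)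
  have ht0 := abs_nonneg t
  have hGφ := norm_blockProd_le_sum (τ := skew T) (φ := observable (Y := Y) φ) (t := t) k hk i
  have hG : ∀ z, ‖blockProd (skew T) (observable (Y := Y) φ) t k i z‖ ≤ |t| * 2 ^ i * (k * B) := by
    intro z
    refine (hGφ z).trans (mul_le_mul_of_nonneg_left ?_ (by positivity))
    refine (Finset.sum_le_card_nsmul _ _ B fun _ _ => hs.abs_le _ _).trans (by simp)
  -- The covariance inequality asks for strictly positive bounds, so `t = 0`, where the block
  -- product vanishes, is treated apart.
  rcases eq_or_ne t 0 with rfl | htne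
  · have hz : ∀ z, blockProd (skew T) (observable (Y := Y) φ) 0 k i z = 0 := fun z => by
      simpa using hG z
    simp [hz]
  have htp : 0 < |t| := abs_pos.2 htne
  have hk0 : (0 : ℝ) < k := by exact_mod_cast hk
  have h1e : 0 < 1 - Real.exp (-lam) := by
    rw [sub_pos, Real.exp_lt_one_iff]; linarith
  have hobs : Measurable (observable φ : (ℤ → Y) × X → ℝ) :=
    measurable_observable' hs.measurable_observable
  have hFm : Measurable fun z => cis (t * birkhoffSum (skew T) (observable (Y := Y) φ) N z) :=
    measurable_cis.comp ((measurable_birkhoffSum hs.measurable_skew hobs N).const_mul t)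
  have hGm := measurable_blockProd hs.measurable_skew hobs t k i
  have key := hs.norm_integral_mul_comp_sub_le hFm hGm one_pos
    (q := |t| * 2 ^ i * (k * B)) (by positivity) (fun z => (norm_cis _).le) hG (a := N - 1)
    (by omega)
    (fun ω ω' x hω => by
      rw [birkhoffSum_congr_iterate fun j hj => observable_iterate_congr
        (fun l _ hl => hω l (by omega)) x])
    (fun ω ω' x hω => blockProd_congr_iterate t k i fun j => observable_iterate_congr
      (fun l hl _ => hω l hl) x) (Q := |t| * 2 ^ i) (by positivity) (k := k) hGφ
    (b := N + k) (l := k + 1 - (k + 3) / 4) (n := (k + 3) / 4) (by omega)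
    (r := Real.exp (-lam * k / 6)) (fun ε _ hε => exp_weight_le' hε hlam (by omega))
    (A := C₀ * (16 * C₀ * M * |t| / (1 - Real.exp (-lam)) * Real.exp (-lam * k)) *
      (|t| * 2 ^ i * (k * B))) (fun ε ω hω hφ => by
      have h1 := hω.norm_cis_decorrelation_le (φ := φ) hs.variation hs.nonsingular hlam
        (fun y => hs.measurable_observable.comp measurable_prodMk_left) hM hφ ht N k
        (f := fun x => blockProd (skew T) (observable φ) t k i (shift ((N + k : ℕ) : ℤ) ω, x))
        (hGm.comp measurable_prodMk_left) (q := |t| * 2 ^ i * (k * B)) fun x => hG _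
      simpa only [fibreExp, iterate_skew] using h1)
  refine key.trans ?_
  obtain ⟨e, he⟩ : ∃ e, e = Real.exp (-lam * k / 6) := ⟨_, rfl⟩
  have he0 : 0 ≤ e := he ▸ Real.exp_nonneg _
  have h1 : Real.exp (-lam * k) ≤ e := by
    rw [he]
    apply Real.exp_le_exp.2
    have : 0 ≤ lam * (k : ℝ) := by positivity
    linarith
  rw [← he]
  have h2 : 16 * C₀ * M * |t| / (1 - Real.exp (-lam)) ≤ 2 := by
    rw [div_le_iff₀ h1e]; linarith
  obtain ⟨w, hw⟩ : ∃ w, w = |t| * 2 ^ i := ⟨_, rfl⟩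
  have hw0 : 0 ≤ w := by rw [hw]; positivity
  rw [← hw]
  calc C₀ * (16 * C₀ * M * |t| / (1 - Real.exp (-lam)) * Real.exp (-lam * k)) * (w * (k * B))
        + 16 * 1 * (w * (k * B)) * alphaCoeff P₀ ξ ((k + 3) / 4)
        + 2 * 1 * (w * (C₀ * M * k * e))
      ≤ C₀ * (2 * e) * (w * (k * B)) + 16 * 1 * (w * (k * B)) * alphaCoeff P₀ ξ ((k + 3) / 4)
        + 2 * 1 * (w * (C₀ * M * k * e)) := by gcongr
    _ ≤ _ := by
        have h3 : 0 ≤ w * k * ((2 * C₀ * B + 2 * C₀ * M) * alphaCoeff P₀ ξ ((k + 3) / 4)) := by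
          positivity
        have h4 : 0 ≤ w * k * (16 * B * e) := by positivity
        linarith

end Skew

end RandomMaps

/-! ### Rates, and reduction to a bounded observable. -/

namespace RandomMaps

section Rates

theorem exists_exp_neg_mul_rpow_le {c η : ℝ} (hc : 0 < c) (hη : 0 < η) (p : ℕ) :
    ∃ C : ℝ, 0 ≤ C ∧ ∀ k : ℕ, 1 ≤ k → Real.exp (-c * ((k : ℝ) / 4) ^ η) ≤ C / (k : ℝ) ^ p := by
  have hx : Tendsto (fun k : ℕ => ((k : ℝ) / 4) ^ η) atTop atTop :=
    (tendsto_rpow_atTop hη).comp (tendsto_natCast_atTop_atTop.atTop_div_const (by norm_num))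
  have hl : Tendsto (fun k : ℕ => (4 : ℝ) ^ p * ((((k : ℝ) / 4) ^ η) ^ ((p : ℝ) / η) *
      Real.exp (-c * ((k : ℝ) / 4) ^ η))) atTop (𝓝 0) := by
    simpa using ((tendsto_rpow_mul_exp_neg_mul_atTop_nhds_zero ((p : ℝ) / η) c hc).comp
      hx).const_mul ((4 : ℝ) ^ p)
  obtain ⟨C, hC⟩ := hl.bddAbove_range
  refine ⟨max C 0, le_max_right _ _, fun k hk => ?_⟩
  have hk0 : (0 : ℝ) < k := by exact_mod_cast hk
  have h1 := hC ⟨k, rfl⟩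
  simp only at h1
  rw [← Real.rpow_mul (by positivity), mul_div_cancel₀ _ hη.ne', Real.rpow_natCast, ← mul_assoc,
    ← mul_pow, mul_div_cancel₀ _ (by norm_num : (4 : ℝ) ≠ 0)] at h1
  rw [le_div_iff₀ (by positivity), mul_comm]
  exact h1.trans (le_max_left _ _)

/-- Integer division by 4 takes every value four times. -/
theorem summable_comp_div_four {g : ℕ → ℝ} (hg : ∀ n, 0 ≤ g n) (hs : Summable g) :
    Summable fun j : ℕ => g (j / 4) := by
  have h1 : ∀ N, ∑ j ∈ Finset.range (4 * N), g (j / 4) = 4 * ∑ n ∈ Finset.range N, g n := by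
    intro N
    induction N with
    | zero => simp
    | succ N ih =>
      rw [show 4 * (N + 1) = 4 * N + 1 + 1 + 1 + 1 by ring]
      simp only [Finset.sum_range_succ]
      rw [ih, show 4 * N / 4 = N by omega, show (4 * N + 1) / 4 = N by omega,
        show (4 * N + 1 + 1) / 4 = N by omega, show (4 * N + 1 + 1 + 1) / 4 = N by omega]
      ring
  refine summable_of_sum_range_le (c := 4 * ∑' n, g n) (fun _ => hg _) fun n => ?_
  calc ∑ j ∈ Finset.range n, g (j / 4) ≤ ∑ j ∈ Finset.range (4 * n), g (j / 4) :=
        Finset.sum_le_sum_of_subset_of_nonneg (Finset.range_mono (by omega)) fun _ _ _ => hg _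
    _ = 4 * ∑ i ∈ Finset.range n, g i := h1 n
    _ ≤ _ := by
        gcongr
        exact hs.sum_le_tsum _ fun i _ => hg i

theorem summable_mul_comp_add_three_div_four {a : ℕ → ℝ} (ha : ∀ n, 0 ≤ a n)
    (hs : Summable fun n : ℕ => (n : ℝ) * a n) :
    Summable fun j : ℕ => (j : ℝ) * a ((j + 3) / 4) := by
  have h1 := summable_comp_div_four (g := fun n : ℕ => (n : ℝ) * a n)
    (fun n => mul_nonneg (Nat.cast_nonneg n) (ha n)) hs
  have h2 := ((summable_nat_add_iff 3).2 h1).mul_left 4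
  refine Summable.of_nonneg_of_le (fun j => mul_nonneg (Nat.cast_nonneg j) (ha _)) (fun j => ?_) h2
  rw [← mul_assoc]
  refine mul_le_mul_of_nonneg_right ?_ (ha _)
  exact_mod_cast (by omega : j ≤ 4 * ((j + 3) / 4))

/-- The rate of decorrelation for stretched exponentially mixing driving processes. -/
noncomputable def mixingRate (D lam c₁ c₂ η : ℝ) (k : ℕ) : ℝ :=
  D * (k * (Real.exp (-lam * k / 6) + c₁ * Real.exp (-c₂ * ((k : ℝ) / 4) ^ η)))

theorem decaysFast_mixingRate {D lam c₁ c₂ η : ℝ} (hD : 0 ≤ D) (hlam : 0 < lam) (hc₁ : 0 < c₁)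
    (hc₂ : 0 < c₂) (hη : 0 < η) : DecaysFast (mixingRate D lam c₁ c₂ η) := by
  intro p
  obtain ⟨A, hA, hA'⟩ := exists_exp_neg_mul_rpow_le (c := lam * 4 / 6) (η := 1) (by positivity)
    one_pos (p + 1)
  obtain ⟨A', hA'0, hA''⟩ := exists_exp_neg_mul_rpow_le hc₂ hη (p + 1)
  refine ⟨D * (A + c₁ * A'), by positivity, fun k hk => ?_⟩
  have hk0 : (0 : ℝ) < k := by exact_mod_cast hk
  have h1 := hA' k hk
  rw [Real.rpow_one, show -(lam * 4 / 6) * ((k : ℝ) / 4) = -lam * k / 6 by ring] at h1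
  have h2 := hA'' k hk
  calc mixingRate D lam c₁ c₂ η k
      ≤ D * (k * (A / (k : ℝ) ^ (p + 1) + c₁ * (A' / (k : ℝ) ^ (p + 1)))) := by
        unfold mixingRate; gcongr
    _ = _ := by field_simp; ring

end Rates

section Truncation

variable {Ω₀ X Y : Type*} [MeasurableSpace Ω₀] [MeasurableSpace X] [MeasurableSpace Y]
  {P₀ : Measure Ω₀} {ξ : ℤ → Ω₀ → Y} {m : Measure X} {v : (X → ℂ) → ℝ≥0∞} {C₀ : ℝ}
  {T : Y → X → X} {h : (ℤ → Y) × X → ℝ} {K : (ℤ → Y) → ℝ} {lam : ℝ} {φ : Y → X → ℝ} {M B : ℝ}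

/-- The observable clipped to `[-B, B]`. -/
def clip (B : ℝ) (φ : Y → X → ℝ) (y : Y) (x : X) : ℝ := max (-B) (min (φ y x) B)

omit [MeasurableSpace X] [MeasurableSpace Y] in
theorem abs_clip_le (hB : 0 ≤ B) (y : Y) (x : X) : |clip B φ y x| ≤ B :=
  abs_le.2 ⟨le_max_left _ _, max_le (by linarith) (min_le_right _ _)⟩

omit [MeasurableSpace X] [MeasurableSpace Y] in
theorem clip_eq {y : Y} {x : X} (hB : |φ y x| ≤ B) : clip B φ y x = φ y x := by
  rw [clip, min_eq_left (abs_le.1 hB).2, max_eq_right (abs_le.1 hB).1]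

theorem measurable_clip (hφ : Measurable (Function.uncurry φ)) :
    Measurable (Function.uncurry (clip B φ)) :=
  measurable_const.max (hφ.min measurable_const)

/-- Clipping does not change the observable on almost every orbit, where it has the required
BV bounds. -/
theorem ae_clip_eq_and_hasScaledBound [IsProbabilityMeasure m] {P : Measure (ℤ → Y)}
    (hP : P.map (shift 1) = P) (hv : IsVariation m v C₀) (hK : ∀ ω, 1 ≤ K ω)
    (hφ : Measurable (Function.uncurry φ))
    (hM : scaledNorm P m v K φ ≤ ENNReal.ofReal M) :
    ∀ᵐ ω ∂P, (∀ j : ℤ, clip (C₀ * max M 0 + 1) φ (ω j) = φ (ω j)) ∧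
      HasScaledBound m v K (clip (C₀ * max M 0 + 1) φ) (max M 0) ω := by
  have hC := zero_le_one.trans hv.one_le
  have h1 : ∀ᵐ ω ∂P, ENNReal.ofReal (K ω) * bvNorm m v (fun x => (φ (ω 0) x : ℂ))
      ≤ ENNReal.ofReal (max M 0) := by
    filter_upwards [ENNReal.ae_le_essSup fun ω => ENNReal.ofReal (K ω) *
      bvNorm m v (fun x => (φ (ω 0) x : ℂ))] with ω hω
    exact (hω.trans hM).trans (ENNReal.ofReal_le_ofReal (le_max_left _ _))
  filter_upwards [ae_forall_shift hP h1] with ω hω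
  have hb : ∀ j : ℤ, ∃ β, BVBound m v (fun x => (φ (ω j) x : ℂ)) β ∧
      K (shift j ω) * β ≤ max M 0 := by
    intro j
    have h2 := hω j
    rw [show shift j ω 0 = ω j by simp [shift]] at h2
    have hKj := hK (shift j ω)
    have h3 : bvNorm m v (fun x => (φ (ω j) x : ℂ)) ≠ ∞ := by
      intro htop
      rw [htop, ENNReal.mul_top (by simpa using lt_of_lt_of_le zero_lt_one hKj)] at h2
      exact absurd h2 (not_le.2 ENNReal.ofReal_lt_top)
    refine ⟨(bvNorm m v (fun x => (φ (ω j) x : ℂ))).toReal,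
      ⟨(Complex.measurable_ofReal.comp (hφ.comp measurable_prodMk_left)).aestronglyMeasurable,
        ENNReal.toReal_nonneg, (ENNReal.ofReal_toReal h3).ge⟩, ?_⟩
    have h4 := ENNReal.toReal_le_of_le_ofReal (le_max_right _ _) h2
    rwa [ENNReal.toReal_mul, ENNReal.toReal_ofReal (zero_le_one.trans hKj)] at h4
  -- The supremum axiom bounds `φ (ω j)` at every point of `X`, so on a good orbit clipping is the
  -- identity. Off good orbits it provides the everywhere bound required of a bounded observable;
  -- the summand 1 keeps the level positive.
  have he : ∀ j : ℤ, clip (C₀ * max M 0 + 1) φ (ω j) = φ (ω j) := by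
    intro j
    funext x
    apply clip_eq
    obtain ⟨β, hβ, hKβ⟩ := hb j
    have h5 := hβ.norm_le hv x
    rw [Complex.norm_real, Real.norm_eq_abs] at h5
    have h6 : β ≤ max M 0 := (le_mul_of_one_le_left hβ.2 (hK _)).trans hKβ
    have := mul_le_mul_of_nonneg_left h6 hC
    linarith
  exact ⟨he, fun j => by rw [he j]; exact hb j⟩

variable [IsProbabilityMeasure P₀] [IsProbabilityMeasure m]

/-- The correlation bound involves `α` at about `j/4`; the weighted sum over `j` changes only by a
constant factor. -/
theorem IsAdmissible.summable_correlation (hs : IsAdmissible P₀ ξ m v C₀ T h K lam φ M B)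
    (hα : Summable fun n : ℕ => (n : ℝ) * alphaCoeff P₀ ξ n) :
    Summable fun j : ℕ => (j : ℝ) *
      |∫ z, observable φ z * observable φ ((skew T)^[j] z) ∂(skewMeasure (pathLaw P₀ ξ) m h)| := by
  have hlam := hs.expanding.lam_pos
  have h1 := summable_mul_comp_add_three_div_four (fun n => alphaCoeff_nonneg n) hα
  have h2 := Real.summable_pow_mul_exp_neg_nat_mul 1 (show 0 < lam / 6 by positivity)
  refine Summable.of_nonneg_of_le (fun j => by positivity) (fun j => ?_)
    ((h2.add h1).mul_left (C₀ * M * B + 16 * B ^ 2 + 2 * B * C₀ * M * Real.exp lam))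
  rcases Nat.eq_zero_or_pos j with rfl | hj
  · simp
  · have := mul_le_mul_of_nonneg_left (hs.abs_correlation_le j hj) (Nat.cast_nonneg (α := ℝ) j)
    refine this.trans (le_of_eq ?_)
    rw [show -(lam / 6) * (j : ℝ) = -lam * j / 6 by ring]
    ring

/-- The threshold for `t` has `M + 1` in its denominator to remain positive and finite when `M = 0`,
and one rate serves both estimates because the two constants are added. -/
theorem IsAdmissible.hasDecorrelation {c₁ c₂ η : ℝ} (hc₁ : 0 < c₁) (hc₂ : 0 < c₂) (hη : 0 < η)
    (hs : IsAdmissible P₀ ξ m v C₀ T h K lam φ M B)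
    (hα : ∀ n : ℕ, alphaCoeff P₀ ξ n ≤ c₁ * Real.exp (-c₂ * (n : ℝ) ^ η)) :
    HasDecorrelation (skewMeasure (pathLaw P₀ ξ) m h) (skew T) (observable φ) B
      ((1 - Real.exp (-lam)) / (8 * C₀ * (M + 1)))
      (mixingRate ((C₀ * M * B + 16 * B ^ 2 + 2 * B * C₀ * M * Real.exp lam) +
        (2 * C₀ * B + 16 * B + 2 * C₀ * M)) lam c₁ c₂ η) := by
  have hC1 := hs.variation.one_le
  have hC := zero_le_one.trans hC1
  have hM := hs.nonneg
  have hB := hs.pos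
  obtain ⟨D₁, hD₁⟩ : ∃ D, D = C₀ * M * B + 16 * B ^ 2 + 2 * B * C₀ * M * Real.exp lam := ⟨_, rfl⟩
  obtain ⟨D₂, hD₂⟩ : ∃ D, D = 2 * C₀ * B + 16 * B + 2 * C₀ * M := ⟨_, rfl⟩
  have hD₁0 : 0 ≤ D₁ := by rw [hD₁]; positivity
  have hD₂0 : 0 ≤ D₂ := by rw [hD₂]; positivity
  have hrate : ∀ k : ℕ, Real.exp (-lam * k / 6) + alphaCoeff P₀ ξ ((k + 3) / 4)
      ≤ Real.exp (-lam * k / 6) + c₁ * Real.exp (-c₂ * ((k : ℝ) / 4) ^ η) := by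
    intro k
    gcongr
    refine (hα _).trans ?_
    gcongr c₁ * Real.exp ?_
    rw [neg_mul, neg_mul, neg_le_neg_iff]
    gcongr
    rw [div_le_iff₀ (by norm_num)]
    exact_mod_cast (by omega : k ≤ (k + 3) / 4 * 4)
  have hr0 : ∀ k : ℕ, 0 ≤ Real.exp (-lam * k / 6) + c₁ * Real.exp (-c₂ * ((k : ℝ) / 4) ^ η) :=
    fun k => by positivity
  refine ⟨hs.isBoundedCentered, fun j hj => ?_, fun t ht k hk N i => ?_⟩
  · refine (hs.abs_correlation_le j hj).trans ?_
    rw [← hD₁, ← hD₂, mixingRate]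
    have hj1 : (1 : ℝ) ≤ j := by exact_mod_cast hj
    refine mul_le_mul (by linarith) ?_ (add_nonneg (Real.exp_nonneg _) (alphaCoeff_nonneg _))
      (by linarith)
    exact (hrate j).trans (le_mul_of_one_le_left (hr0 j) hj1)
  · have ht' : 8 * C₀ * M * |t| ≤ 1 - Real.exp (-lam) := by
      rw [le_div_iff₀ (by positivity)] at ht
      have : 0 ≤ C₀ * |t| := by positivity
      linarith
    refine (hs.norm_decorrelation_le ht' hk N i).trans ?_
    rw [← hD₁, ← hD₂, mixingRate]
    refine mul_le_mul_of_nonneg_left (mul_le_mul (by linarith)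
      (mul_le_mul_of_nonneg_left (hrate k) (Nat.cast_nonneg k)) ?_ (by linarith)) (by positivity)
    exact mul_nonneg (Nat.cast_nonneg k) (add_nonneg (Real.exp_nonneg _) (alphaCoeff_nonneg _))

end Truncation

end RandomMaps

/-! ### Assembly of the limit theorems. -/

namespace RandomMaps

section Limit

universe u₁ u₂ u₃

theorem partialSum_eq_of_forall {X Y : Type*} {T : Y → X → X} {φ ψ : Y → X → ℝ} {ω : ℤ → Y}
    (hω : ∀ j : ℤ, ψ (ω j) = φ (ω j)) (n : ℕ) (x : X) :
    partialSum T φ n (ω, x) = birkhoffSum (skew T) (observable ψ) n (ω, x) := by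
  unfold partialSum birkhoffSum
  refine Finset.sum_congr rfl fun j _ => ?_
  rw [observable_iterate_skew, observable_iterate_skew, hω]

variable {Ω₀ : Type u₁} {Y : Type u₂} {X : Type u₃} [MeasurableSpace Ω₀] [MeasurableSpace Y]
  [MeasurableSpace X] {P₀ : Measure Ω₀} [IsProbabilityMeasure P₀] {ξ : ℤ → Ω₀ → Y} {m : Measure X}
  [IsProbabilityMeasure m] {v : (X → ℂ) → ℝ≥0∞} {C₀ : ℝ} {T : Y → X → X} {h : (ℤ → Y) × X → ℝ}
  {K : (ℤ → Y) → ℝ} {lam M B : ℝ} {φ ψ : Y → X → ℝ}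

theorem ae_skewMeasure_of_ae (P : Measure (ℤ → Y)) [SFinite P] (m : Measure X) [SFinite m]
    (h : (ℤ → Y) × X → ℝ) {p : (ℤ → Y) → Prop} (hp : ∀ᵐ ω ∂P, p ω) :
    ∀ᵐ z ∂(skewMeasure P m h), p z.1 :=
  (withDensity_absolutelyContinuous _ _).ae_le (Measure.quasiMeasurePreserving_fst.ae hp)

/-- Existence of the asymptotic variance, the characterization of coboundaries, and the central
limit theorem. -/
theorem IsAdmissible.exists_limit_variance
    (hs : IsAdmissible P₀ ξ m v C₀ T h K lam ψ M B)
    (hψ : ∀ᵐ ω ∂(pathLaw P₀ ξ), ∀ j : ℤ, ψ (ω j) = φ (ω j))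
    (hα : Summable fun n : ℕ => (n : ℝ) * alphaCoeff P₀ ξ n)
    [IsProbabilityMeasure (skewMeasure (pathLaw P₀ ξ) m h)] :
    ∃ s : ℝ, 0 ≤ s ∧
      Tendsto (lagVariance (skewMeasure (pathLaw P₀ ξ) m h) (skew T) (observable ψ)) atTop
        (𝓝 (s ^ 2)) ∧
      (∀ n, MemLp (partialSum T φ n) 2 (skewMeasure (pathLaw P₀ ξ) m h)) ∧
      Tendsto (fun n : ℕ => (√(n : ℝ))⁻¹ *
        (eLpNorm (partialSum T φ n) 2 (skewMeasure (pathLaw P₀ ξ) m h)).toReal) atTop (𝓝 s) ∧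
      (s = 0 ↔ ∃ r : (ℤ → Y) × X → ℝ, MemLp r 2 (skewMeasure (pathLaw P₀ ξ) m h) ∧
        observable φ =ᵐ[skewMeasure (pathLaw P₀ ξ) m h] fun p => r (skew T p) - r p) ∧
      (∀ c₁ c₂ η : ℝ, 0 < c₁ → 0 < c₂ → 0 < η →
        (∀ n : ℕ, alphaCoeff P₀ ξ n ≤ c₁ * Real.exp (-c₂ * (n : ℝ) ^ η)) →
        TendstoInDistribution (fun (n : ℕ) p => (√(n : ℝ))⁻¹ * partialSum T φ n p) atTop
          (fun z : ℝ => s * z) (fun _ => skewMeasure (pathLaw P₀ ξ) m h) (gaussianReal 0 1)) := by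
  have hPp := hs.stationary.isProbabilityMeasure
  have hb := hs.isBoundedCentered
  obtain ⟨s, hs0, hlag, hnorm, D, hD⟩ := hb.exists_asymptotic_variance (hs.summable_correlation hα)
  have hae := ae_skewMeasure_of_ae (pathLaw P₀ ξ) m h hψ
  have hS : ∀ n, birkhoffSum (skew T) (observable ψ) n
      =ᵐ[skewMeasure (pathLaw P₀ ξ) m h] partialSum T φ n := fun n =>
    hae.mono fun z hz => (partialSum_eq_of_forall hz n z.2).symm
  have hobs : observable ψ =ᵐ[skewMeasure (pathLaw P₀ ξ) m h] observable φ :=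
    hae.mono fun z hz => by simp only [observable, hz]
  refine ⟨s, hs0, hlag, fun n => (memLp_congr_ae (hS n)).1 (hb.memLp_birkhoffSum n), ?_,
    ⟨fun h0 => ?_, ?_⟩, fun c₁ c₂ η hc₁ hc₂ hη hα' => ?_⟩
  · exact hnorm.congr fun n => by rw [eLpNorm_congr_ae (hS n)]
  · obtain ⟨r, hr, hφr⟩ := hb.exists_coboundary (D := D) fun n => by simpa [h0] using hD n
    exact ⟨r, hr, hobs.symm.trans hφr⟩
  · rintro ⟨r, hr, hφr⟩
    exact tendsto_nhds_unique hnorm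
      (tendsto_eLpNorm_of_coboundary hb.measurePreserving hr (hobs.trans hφr))
  · refine TendstoInDistribution.congr (fun n => ?_) (ae_eq_refl _)
      (hb.tendstoInDistribution (s := s) fun θ => ?_)
    · exact (hS n).mono fun z hz => by simp only [hz]
    -- When `s = 0` the sums are bounded in `L²` and the limit is degenerate; otherwise the block
    -- argument applies with `s` itself as lower bound.
    · rcases hs0.eq_or_lt with rfl | hpos
      · simpa using hb.tendsto_sumCharFun_of_bounded (D := D) (fun n => by simpa using hD n) θ
      · have hC := zero_lt_one.trans_le hs.variation.one_le
        have hM := hs.nonneg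
        have hB := hs.pos
        have hlam := hs.expanding.lam_pos
        have h1e : 0 < 1 - Real.exp (-lam) := by
          rw [sub_pos, Real.exp_lt_one_iff]; linarith
        exact (hs.hasDecorrelation hc₁ hc₂ hη hα').tendsto_sumCharFun (by positivity)
          (decaysFast_mixingRate (by positivity) hlam hc₁ hc₂ hη) hpos hlag θ

theorem exists_limit_theorem_constant (c₁ c₂ η C₀ lam M s₀ : ℝ) (hc₁ : 0 < c₁) (hc₂ : 0 < c₂)
    (hη : 0 < η) (hs₀ : 0 < s₀) :
    ∃ C : ℝ, 0 < C ∧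
      ∀ {Ω₀ : Type u₁} {Y : Type u₂} {X : Type u₃} [MeasurableSpace Ω₀] [MeasurableSpace Y]
        [MeasurableSpace X] (P₀ : Measure Ω₀) [IsProbabilityMeasure P₀] (ξ : ℤ → Ω₀ → Y)
        (_ : IsStationary P₀ ξ)
        (m : Measure X) [IsProbabilityMeasure m] (v : (X → ℂ) → ℝ≥0∞) (_ : IsVariation m v C₀)
        (T : Y → X → X) (_ : ∀ y, Measure.QuasiMeasurePreserving (T y) m m)
        (_ : Measurable (skew T)) (h : (ℤ → Y) × X → ℝ) (K : (ℤ → Y) → ℝ)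
        (hyp : IsExpandingOnAverage (pathLaw P₀ ξ) m v T h K lam)
        (φ : Y → X → ℝ) (_ : Measurable (Function.uncurry φ))
        (_ : scaledNorm (pathLaw P₀ ξ) m v K φ ≤ ENNReal.ofReal M)
        (_ : ∫ p, observable φ p ∂(skewMeasure (pathLaw P₀ ξ) m h) = 0)
        (_ : Summable (fun n : ℕ => (n : ℝ) * alphaCoeff P₀ ξ n)),
        let μ := skewMeasure (pathLaw P₀ ξ) m h
        let S := partialSum T φ
        haveI : IsProbabilityMeasure μ := hyp.isProbability
        ∃ s : ℝ, 0 ≤ s ∧ (∀ n, MemLp (S n) 2 μ) ∧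
          Tendsto (fun n : ℕ => (√(n : ℝ))⁻¹ * (eLpNorm (S n) 2 μ).toReal) atTop (𝓝 s) ∧
          (s = 0 ↔ ∃ r : (ℤ → Y) × X → ℝ, MemLp r 2 μ ∧
            observable φ =ᵐ[μ] fun p => r (skew T p) - r p) ∧
          ((∀ n : ℕ, alphaCoeff P₀ ξ n ≤ c₁ * Real.exp (-c₂ * (n : ℝ) ^ η)) →
            TendstoInDistribution (fun (n : ℕ) p => (√(n : ℝ))⁻¹ * S n p) atTop
                (fun z : ℝ => s * z) (fun _ => μ) (gaussianReal 0 1) ∧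
              (s₀ ≤ s → ∀ n : ℕ, 1 ≤ n → ∀ t : ℝ,
                |μ.real {p | S n p ≤ t * s * √(n : ℝ)} - cdf (gaussianReal 0 1) t| ≤
                  C * (n : ℝ) ^ (-(1 / (2 + 4 * (1 / η)))))) := by
  -- The constant precedes the system, so impossible parameters must be disposed of first; for them
  -- no system exists and any constant will do.
  by_cases hpar : 1 ≤ C₀ ∧ 0 < lam
  swap
  · refine ⟨1, one_pos, ?_⟩
    intro Ω₀ Y X _ _ _ P₀ _ ξ _ m _ v hv T _ _ h K hyp
    exact absurd ⟨hv.one_le, hyp.lam_pos⟩ hpar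
  obtain ⟨hC1, hlam⟩ := hpar
  have hC := zero_lt_one.trans_le hC1
  have hM : 0 ≤ max M 0 := le_max_right _ _
  have hB : 0 < C₀ * max M 0 + 1 := by positivity
  have h1e : 0 < 1 - Real.exp (-lam) := by
    rw [sub_pos, Real.exp_lt_one_iff]; linarith
  obtain ⟨M', hM'⟩ : ∃ M', M' = max M 0 := ⟨_, rfl⟩
  obtain ⟨B, hBe⟩ : ∃ B, B = C₀ * max M 0 + 1 := ⟨_, rfl⟩
  rw [← hM'] at hM
  rw [← hBe] at hB
  -- The claimed exponent is strictly below `1/2`, so it equals `1/2 - δ` for a positive `δ`, which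
  -- the Berry–Esseen bound permits.
  have hδ : 0 < 1 / 2 - 1 / (2 + 4 * (1 / η)) := by
    rw [sub_pos]
    have : 0 < 4 * (1 / η) := by positivity
    exact one_div_lt_one_div_of_lt (by norm_num) (by linarith)
  obtain ⟨C, hCpos, hBE⟩ := exists_berryEsseen_bound.{max u₂ u₃} hB.le
    (t₀ := (1 - Real.exp (-lam)) / (8 * C₀ * (M' + 1))) (by positivity) hs₀ hδ
    (decaysFast_mixingRate (D := (C₀ * M' * B + 16 * B ^ 2 + 2 * B * C₀ * M' * Real.exp lam) +
        (2 * C₀ * B + 16 * B + 2 * C₀ * M')) (by positivity) hlam hc₁ hc₂ hη)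
  refine ⟨C, hCpos, ?_⟩
  intro Ω₀ Y X _ _ _ P₀ _ ξ hξ m _ v hv T hT hskew h K hyp φ hφ hscaled hint hα μ S
  have hPp := hξ.isProbabilityMeasure
  have hprob : IsProbabilityMeasure μ := hyp.isProbability
  have hclip := ae_clip_eq_and_hasScaledBound hξ.map_shift hv hyp.one_le_K hφ hscaled
  rw [← hBe, ← hM'] at hclip
  have hψ := hclip.mono fun ω hω => hω.1
  have hae := ae_skewMeasure_of_ae (pathLaw P₀ ξ) m h hψ
  have hs : IsAdmissible P₀ ξ m v C₀ T h K lam (clip B φ) M' B :=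
    ⟨hξ, hv, hT, hskew, hyp, measurable_clip hφ, abs_clip_le hB.le, hB, hM,
      hclip.mono fun ω hω => hω.2, by
        rw [← hint]
        exact integral_congr_ae (hae.mono fun z hz => by simp only [observable, hz])⟩
  obtain ⟨s, hs0, hlag, hmem, hnorm, hcob, hclt⟩ := hs.exists_limit_variance hψ hα
  refine ⟨s, hs0, hmem, hnorm, hcob, fun hα' => ⟨hclt c₁ c₂ η hc₁ hc₂ hη hα', ?_⟩⟩
  intro hss n hn t
  have key := hBE (hs.hasDecorrelation hc₁ hc₂ hη hα') s hss hlag n hn t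
  rw [show 1 / 2 - 1 / (2 + 4 * (1 / η)) - 1 / 2 = -(1 / (2 + 4 * (1 / η))) by ring] at key
  have hset : μ.real {p | S n p ≤ t * s * √(n : ℝ)}
      = μ.real {p | birkhoffSum (skew T) (observable (clip B φ)) n p ≤ t * s * √(n : ℝ)} := by
    refine measureReal_congr (hae.mono fun z hz => ?_)
    have := partialSum_eq_of_forall (T := T) hz n z.2
    exact propext (by
      change partialSum T φ n (z.1, z.2) ≤ _ ↔ _
      rw [this]; rfl)
  rw [hset, cdf_eq_real]
  exact key

end Limit

end RandomMaps

theorem mainTheorem1 (c₁ c₂ η C₀ lam M s₀ : ℝ) (hc₁ : 0 < c₁) (hc₂ : 0 < c₂) (hη : 0 < η)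
    (hs₀ : 0 < s₀) :
    ∃ C : ℝ, 0 < C ∧
      ∀ {Ω₀ Y X : Type*} [MeasurableSpace Ω₀] [MeasurableSpace Y] [MeasurableSpace X]
        (P₀ : Measure Ω₀) [IsProbabilityMeasure P₀] (ξ : ℤ → Ω₀ → Y)
        (_ : RandomMaps.IsStationary P₀ ξ)
        (m : Measure X) [IsProbabilityMeasure m] (v : (X → ℂ) → ℝ≥0∞)
        (_ : RandomMaps.IsVariation m v C₀)
        (T : Y → X → X) (_ : ∀ y, Measure.QuasiMeasurePreserving (T y) m m)
        (_ : Measurable (RandomMaps.skew T))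
        (h : (ℤ → Y) × X → ℝ) (K : (ℤ → Y) → ℝ)
        (hyp : RandomMaps.IsExpandingOnAverage (RandomMaps.pathLaw P₀ ξ) m v T h K lam)
        (φ : Y → X → ℝ) (_ : Measurable (Function.uncurry φ))
        (_ : RandomMaps.scaledNorm (RandomMaps.pathLaw P₀ ξ) m v K φ ≤ ENNReal.ofReal M)
        (_ : ∫ p, RandomMaps.observable φ p
          ∂(RandomMaps.skewMeasure (RandomMaps.pathLaw P₀ ξ) m h) = 0)
        (_ : Summable (fun n : ℕ => (n : ℝ) * RandomMaps.alphaCoeff P₀ ξ n)),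
        let μ := RandomMaps.skewMeasure (RandomMaps.pathLaw P₀ ξ) m h
        let S := RandomMaps.partialSum T φ
        haveI : IsProbabilityMeasure μ := hyp.isProbability
        ∃ s : ℝ, 0 ≤ s ∧ (∀ n, MemLp (S n) 2 μ) ∧
          Tendsto (fun n : ℕ => (√(n : ℝ))⁻¹ * (eLpNorm (S n) 2 μ).toReal) atTop (𝓝 s) ∧
          (s = 0 ↔ ∃ r : (ℤ → Y) × X → ℝ, MemLp r 2 μ ∧
            RandomMaps.observable φ =ᵐ[μ] fun p => r (RandomMaps.skew T p) - r p) ∧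
          ((∀ n : ℕ, RandomMaps.alphaCoeff P₀ ξ n ≤ c₁ * Real.exp (-c₂ * (n : ℝ) ^ η)) →
            TendstoInDistribution (fun (n : ℕ) p => (√(n : ℝ))⁻¹ * S n p) atTop
                (fun z : ℝ => s * z) (fun _ => μ) (gaussianReal 0 1) ∧
              (s₀ ≤ s → ∀ n : ℕ, 1 ≤ n → ∀ t : ℝ,
                |μ.real {p | S n p ≤ t * s * √(n : ℝ)} - cdf (gaussianReal 0 1) t| ≤
                  C * (n : ℝ) ^ (-(1 / (2 + 4 * (1 / η)))))) := by
  exact RandomMaps.exists_limit_theorem_constant c₁ c₂ η C₀ lam M s₀ hc₁ hc₂ hη hs₀
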